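/- Let $G$ be a compact Lie group and $K\subset G$ a closed connected subgroup. Let $Q$ be a bi-invariant inner product on $\mathfrak g$, let $\mathfrak g=\mathfrak k\oplus\mathfrak p$ with $\mathfrak p=\mathfrak k^{\perp}$, and suppose that $\mathfrak p=\mathfrak p_1\oplus\dots\oplus\mathfrak p_r$ ($r\ge 1$) is a $Q$-orthogonal decomposition into $\mathrm{Ad}(K)$-irreducible, pairwise inequivalent summands, of dimensions $d_i=\dim\mathfrak p_i$; put $n=\sum_i d_i$. For $q\in\mathbb R^r$ write the scalar curvature of the $G$-invariant metric $\sum_i e^{q_i}Q|_{\mathfrak p_i}$ on $G/K$ as $S(q)=\sum_{w\in\mathcal W}A_we^{w\cdot q}$, with $\mathcal W\subset\mathbb R^r$ finite and all $A_w\ne0$. If $r\ge2$, assume that there is no coordinate position in which all elements of $\mathcal W$ vanish. Write $\mathbf d=(d_1,\dots,d_r,-2)$, $\mathbf q=(q_1,\dots,q_r,u)$, and let $J$ be the symmetric bilinear form on $\mathbb R^{r+1}$ $$J((p,\phi),(p',\phi'))=-\Big(\sum_i\frac{p_ip_i'}{d_i}+\frac{\phi}{2}\sum_ip_i'+\frac{\phi'}{2}\sum_ip_i+\frac{n-1}{4}\phi\phi'\Big).$$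 Fix a real constant $E\ne0$. For a finite set $\mathcal C\subset\mathbb R^{r+1}\setminus\{0\}$, a (steady) superpotential with exponent set $\mathcal C$ is a function $f(\mathbf q)=\sum_{\mathbf c\in\mathcal C}f_{\mathbf c}e^{\mathbf c\cdot\mathbf q}$ with constants $f_{\mathbf c}\in\mathbb R\setminus\{0\}$ such that $$J(\nabla f,\nabla f)=e^{\mathbf d\cdot\mathbf q}\,\big(E+S(q)\big)\qquad\text{for all }\mathbf q\in\mathbb R^{r+1}.$$ Write $(a^i,b^j)$ for the vector in $\mathbb R^r$ with entries $a,b$ in positions $i,j$ and zeros elsewhere, and identify $x\in\mathbb R^r$ with $(x,0)\in\mathbb R^{r+1}$. Then a superpotential with exponent set $\mathcal C$ exists if and only if, up to a permutation of the summands $\mathfrak p_i$, one of the following holds. 1. (2-dimensional Bryant soliton) $r=1$, $d_1=1$, $\mathcal W=\emptyset$, and $\mathcal C=\frac12(\mathbf d+\{(1),(-1)\})$, or else $E>0$ and $\mathcal C$ is the trivial arrangement $\{\frac12\mathbf d\}$. 2. (5-dimensional Bryant soliton) $r=1$, $d_1=4$, $\mathcal W=\{(-1)\}$, $E>0$ and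 $\mathcal C=\frac12(\mathbf d+\{(0),(-2)\})$. 3. $r=2$, $d_1=d_2=2$, $\mathcal W=\{(-1,0),(0,-1)\}$, $E>0$ and $\mathcal C=\frac12(\mathbf d+\{(-1,-1),(-1,1),(1,-1)\})$. 4. (Bérard Bergery–Calabi ansatz) $r\ge2$, $d_1=1$, $d_i=2m_i$ with positive integers $m_i$ for $i=2,\dots,r$, $\mathcal W=\{(-1^2),\dots,(-1^r),(1^1,-2^2),\dots,(1^1,-2^r)\}$, the number $A_{(-1^i)}^2/(d_iA_{(1^1,-2^i)})$ is the same for all $i=2,\dots,r$, and $\mathcal C=\frac12(\mathbf d+\{(-1^1),(1^1),(1^1,-2^2),\dots,(1^1,-2^r)\})$. 5. (The additional superpotential in a special case of 4) $r=3$, $(d_1,d_2,d_3)=(1,2,2)$, $\mathcal W$ and the condition on the $A_w$ are as in 4, $E>0$ and $\mathcal C=\frac12(\mathbf d+\{(0,-1,-1),(0,1,-1),(0,-1,1),(1,0,-2),(1,-2,0)\})$. -/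

import Mathlib

open scoped Manifold ContDiff

noncomputable section

namespace Soliton

/-! ### Scalar curvature of an invariant metric on a homogeneous space

`V` is the Lie algebra of `G`, `g` is a `K`-invariant inner product on the reductive complement `𝔭`
of the isotropy algebra `𝔨`, extended by zero on `𝔨`, and `X` is a `g`-orthonormal basis of `𝔭`.
The Levi-Civita connection of the invariant metric and its curvature tensor at the base point are
written on `𝔭 ≅ T(G/K)` (Koszul's formula and Nomizu's formula for the curvature). -/

section Curvature

variable {V : Type*} [AddCommGroup V] [Module ℝ V] [Bracket V V] {ι : Type*} [Fintype ι]

/-- The component of `Z` in `𝔭`, along `𝔨`. -/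
def horizontal (g : V → V → ℝ) (X : ι → V) (Z : V) : V := ∑ c, g Z (X c) • X c

/-- The Levi-Civita (Nomizu) map `Λ(A)B`, given by
`2 g(Λ(A)B, Z) = g([A,B], Z) - g([B,Z], A) + g([Z,A], B)` for `Z ∈ 𝔭`. -/
def leviCivita (g : V → V → ℝ) (X : ι → V) (A B : V) : V :=
  ∑ c, ((g ⁅A, B⁆ (X c) - g ⁅B, X c⁆ A + g ⁅X c, A⁆ B) / 2) • X c

/-- `R(A,B)C = Λ(A)Λ(B)C - Λ(B)Λ(A)C - Λ([A,B]_𝔭)C - [[A,B]_𝔨, C]`. -/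
def curvature (g : V → V → ℝ) (X : ι → V) (A B C : V) : V :=
  leviCivita g X A (leviCivita g X B C) - leviCivita g X B (leviCivita g X A C)
    - leviCivita g X (horizontal g X ⁅A, B⁆) C - ⁅⁅A, B⁆ - horizontal g X ⁅A, B⁆, C⁆

def ricci (g : V → V → ℝ) (X : ι → V) (B C : V) : ℝ := ∑ a, g (curvature g X (X a) B C) (X a)

def scalar (g : V → V → ℝ) (X : ι → V) : ℝ := ∑ b, ricci g X (X b) (X b)

end Curvature

/-! ### Homogeneous spaces with monotypic isotropy representation -/

section Homogeneous

variable {E : Type*} [NormedAddCommGroup E] [NormedSpace ℝ E]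
  {G : Type*} [TopologicalSpace G] [ChartedSpace E G] [Group G]

/-- The adjoint action of `g` on the Lie algebra: the derivative at `1` of conjugation by `g`. -/
def Ad (g : G) : GroupLieAlgebra 𝓘(ℝ, E) G →L[ℝ] GroupLieAlgebra 𝓘(ℝ, E) G :=
  mfderiv 𝓘(ℝ, E) 𝓘(ℝ, E) (fun x : G => g * x * g⁻¹) 1

variable (E) (F : Type*) [NormedAddCommGroup F] [NormedSpace ℝ F]

/-- The derivative at `1` of the inclusion of a Lie subgroup `K` in `G`. -/
def inclusionDeriv (K : Subgroup G) [ChartedSpace F K] :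
    GroupLieAlgebra 𝓘(ℝ, F) K →L[ℝ] GroupLieAlgebra 𝓘(ℝ, E) G :=
  mfderiv 𝓘(ℝ, F) 𝓘(ℝ, E) (K.subtype : K → G) 1

/-- The Lie algebra `𝔨 ⊆ 𝔤` of a Lie subgroup `K`. -/
def isotropyAlgebra (K : Subgroup G) [ChartedSpace F K] :
    Submodule ℝ (GroupLieAlgebra 𝓘(ℝ, E) G) :=
  LinearMap.range (inclusionDeriv E F K).toLinearMap

/-- A bi-invariant background metric `Q`, the orthogonal splitting `𝔤 = 𝔨 ⊕ 𝔭₁ ⊕ ⋯ ⊕ 𝔭ᵣ` into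
`Ad(K)`-irreducible, pairwise inequivalent summands of `𝔭 = 𝔨^⊥`, and a choice of a `Q`-orthonormal
basis of each summand. -/
structure IsotropySplitting (K : Subgroup G) [ChartedSpace F K] (r : ℕ) where
  Q : LinearMap.BilinForm ℝ (GroupLieAlgebra 𝓘(ℝ, E) G)
  symm : ∀ X Y, Q X Y = Q Y X
  pos : ∀ X, X ≠ 0 → 0 < Q X X
  biinvariant : ∀ (g : G) X Y, Q (Ad g X) (Ad g Y) = Q X Y
  p : Fin r → Submodule ℝ (GroupLieAlgebra 𝓘(ℝ, E) G)
  orthogonal_isotropy : ∀ i, ∀ X ∈ p i, ∀ Z ∈ isotropyAlgebra E F K, Q X Z = 0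
  orthogonal : ∀ i j, i ≠ j → ∀ X ∈ p i, ∀ Y ∈ p j, Q X Y = 0
  sup_eq_top : isotropyAlgebra E F K ⊔ ⨆ i, p i = ⊤
  invariant : ∀ i, ∀ k ∈ K, ∀ X ∈ p i, Ad k X ∈ p i
  ne_bot : ∀ i, p i ≠ ⊥
  irreducible : ∀ i, ∀ U ≤ p i, (∀ k ∈ K, ∀ X ∈ U, Ad k X ∈ U) → U = ⊥ ∨ U = p i
  inequivalent : ∀ i j, i ≠ j → ¬ ∃ φ : p i ≃ₗ[ℝ] p j, ∀ k, ∀ hk : k ∈ K, ∀ X : p i,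
    (φ ⟨Ad k X, invariant i k hk X X.2⟩ : GroupLieAlgebra 𝓘(ℝ, E) G) = Ad k (φ X : GroupLieAlgebra 𝓘(ℝ, E) G)
  frame : ∀ i, Module.Basis (Fin (Module.finrank ℝ (p i))) ℝ (p i)
  orthonormal : ∀ i a b, Q (frame i a) (frame i b) = if a = b then 1 else 0

namespace IsotropySplitting

variable {E F} {K : Subgroup G} [ChartedSpace F K] {r : ℕ} (D : IsotropySplitting E F K r)

/-- `dᵢ = dim 𝔭ᵢ`. -/
def dim (i : Fin r) : ℕ := Module.finrank ℝ (D.p i)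

/-- The invariant metric `∑ᵢ e^{qᵢ} Q|𝔭ᵢ`, extended by zero on `𝔨`. -/
def metric (q : Fin r → ℝ) (Z W : GroupLieAlgebra 𝓘(ℝ, E) G) : ℝ :=
  ∑ i, Real.exp (q i) * ∑ a, D.Q (D.frame i a) Z * D.Q (D.frame i a) W

/-- The basis of `𝔭`, orthonormal for `D.metric q`, obtained by rescaling the frames. -/
def metricFrame (q : Fin r → ℝ) (a : Σ i : Fin r, Fin (Module.finrank ℝ (D.p i))) :
    GroupLieAlgebra 𝓘(ℝ, E) G :=
  Real.exp (-(q a.1) / 2) • (D.frame a.1 a.2 : GroupLieAlgebra 𝓘(ℝ, E) G)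

/-- The scalar curvature of `G/K` with the invariant metric with exponential coordinates `q`. -/
def scalarCurvature (q : Fin r → ℝ) : ℝ := scalar (D.metric q) (D.metricFrame q)

end IsotropySplitting

end Homogeneous

/-! ### Exponential sums, the Hamiltonian and superpotentials

The extended configuration space `ℝ^{r+1}`, with points `(q, u)`, is `(Fin r → ℝ) × ℝ`. -/

/-- The value at `q` of `∑_w A_w e^{w·q}`; the support of `A` is the set of weights `w`. -/
def weightSum {r : ℕ} (A : (Fin r → ℝ) →₀ ℝ) (q : Fin r → ℝ) : ℝ :=
  A.sum fun w a => a * Real.exp (∑ i, w i * q i)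

abbrev Ext (r : ℕ) : Type := (Fin r → ℝ) × ℝ

def dot {r : ℕ} (c x : Ext r) : ℝ := ∑ i, c.1 i * x.1 i + c.2 * x.2

/-- `𝐝 = (d₁, …, dᵣ, -2)`. -/
def extDim {r : ℕ} (d : Fin r → ℕ) : Ext r := (fun i => (d i : ℝ), -2)

def J {r : ℕ} (d : Fin r → ℕ) (p p' : Ext r) : ℝ :=
  -(∑ i, p.1 i * p'.1 i / (d i : ℝ) + p.2 / 2 * ∑ i, p'.1 i + p'.2 / 2 * ∑ i, p.1 i
    + ((∑ i, (d i : ℝ)) - 1) / 4 * p.2 * p'.2)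

/-- The Hamiltonian with momentum `p` at the point `x = (q, u)`; `lam = -ε`, and the steady case is
`lam = 0`. `S` is the scalar curvature of the principal orbit. -/
def hamiltonian {r : ℕ} (d : Fin r → ℕ) (S : (Fin r → ℝ) → ℝ) (lam E : ℝ) (p x : Ext r) : ℝ :=
  Real.exp (-(dot (extDim d) x) / 2) * J d p p
    - Real.exp (dot (extDim d) x / 2) *
      (E - lam * ((∑ i, (d i : ℝ)) + 1 - x.2) + S x.1)

def grad {r : ℕ} (f : Ext r → ℝ) (x : Ext r) : Ext r :=
  (fun i => fderiv ℝ f x (Pi.single i 1, 0), fderiv ℝ f x (0, 1))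

/-- A superpotential for the steady equations: `𝓗(𝐪, df(𝐪)) = 0`. -/
def IsSuperpotential {r : ℕ} (d : Fin r → ℕ) (S : (Fin r → ℝ) → ℝ) (E : ℝ)
    (f : Ext r → ℝ) : Prop :=
  Differentiable ℝ f ∧ ∀ x, hamiltonian d S 0 E (grad f x) x = 0

/-- The function `∑_c f_c e^{c·𝐪}`. -/
def expSum {r : ℕ} (f : Ext r →₀ ℝ) (x : Ext r) : ℝ := f.sum fun c a => a * Real.exp (dot c x)

/-- There is a superpotential `∑_{c ∈ C} f_c e^{c·𝐪}` with all `f_c ≠ 0`, where `0 ∉ C`. -/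
def AdmitsSuperpotential {r : ℕ} (d : Fin r → ℕ) (S : (Fin r → ℝ) → ℝ) (E : ℝ)
    (C : Finset (Ext r)) : Prop :=
  0 ∉ C ∧ ∃ f : Ext r →₀ ℝ, f.support = C ∧ IsSuperpotential d S E (expSum f)

/-! ### Renumbering the summands -/

section Renumber

variable {r s : ℕ} (e : Fin r ≃ Fin s)

def permVec : (Fin r → ℝ) ≃ (Fin s → ℝ) := e.arrowCongr (Equiv.refl ℝ)

def permDim (d : Fin r → ℕ) : Fin s → ℕ := fun i => d (e.symm i)

def permCoeff (A : (Fin r → ℝ) →₀ ℝ) : (Fin s → ℝ) →₀ ℝ := A.equivMapDomain (permVec e)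

def permExp (C : Finset (Ext r)) : Finset (Ext s) :=
  C.map ((permVec e).prodCongr (Equiv.refl ℝ)).toEmbedding

end Renumber

/-! ### The configurations of the classification

`d` are the dimensions, `A` the coefficients (with support `𝓦`) of the scalar curvature, `C` the set
of exponents of the superpotential and `E` the energy constant. -/

/-- `½(𝐝 + (B, 0))`. -/
def halfShift {r : ℕ} (d : Fin r → ℕ) (B : Set (Fin r → ℝ)) : Set (Ext r) :=
  (fun b : Fin r → ℝ => ((1 / 2 : ℝ) • (extDim d + (b, 0)) : Ext r)) '' B

/-- The two-dimensional Bryant soliton. For `E > 0` there is, besides the superpotential with two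
exponents, the trivial one `2√E e^{𝐝·𝐪/2}`. -/
def Bryant2 (E : ℝ) (d : Fin 1 → ℕ) (A : (Fin 1 → ℝ) →₀ ℝ) (C : Finset (Ext 1)) : Prop :=
  d = ![1] ∧ (A.support : Set (Fin 1 → ℝ)) = ∅ ∧
    ((C : Set (Ext 1)) = halfShift d {![1], ![-1]} ∨
      (0 < E ∧ (C : Set (Ext 1)) = halfShift d {![0]}))

/-- The five-dimensional Bryant soliton. -/
def Bryant5 (E : ℝ) (d : Fin 1 → ℕ) (A : (Fin 1 → ℝ) →₀ ℝ) (C : Finset (Ext 1)) : Prop :=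
  d = ![4] ∧ (A.support : Set (Fin 1 → ℝ)) = {![-1]} ∧ 0 < E ∧
    (C : Set (Ext 1)) = halfShift d {![0], ![-2]}

/-- The warped product of two surfaces. -/
def WarpedSurfaces (E : ℝ) (d : Fin 2 → ℕ) (A : (Fin 2 → ℝ) →₀ ℝ) (C : Finset (Ext 2)) : Prop :=
  d = ![2, 2] ∧ (A.support : Set (Fin 2 → ℝ)) = {![-1, 0], ![0, -1]} ∧ 0 < E ∧
    (C : Set (Ext 2)) = halfShift d {![-1, -1], ![-1, 1], ![1, -1]}

/-- The dimensions and the weights `(-1^i)`, `(1^1, -2^i)` of the Bérard Bergery–Calabi ansatz with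
`r = m + 1 ≥ 2` summands; the first summand has index `0`. -/
def IsCalabi {m : ℕ} (d : Fin (m + 1) → ℕ) (A : (Fin (m + 1) → ℝ) →₀ ℝ) : Prop :=
  1 ≤ m ∧ d 0 = 1 ∧ (∀ i : Fin m, ∃ k : ℕ, 1 ≤ k ∧ d i.succ = 2 * k) ∧
    (A.support : Set (Fin (m + 1) → ℝ)) =
      Set.range (fun i : Fin m => Pi.single i.succ (-1)) ∪
        Set.range (fun i : Fin m => Pi.single 0 1 + Pi.single i.succ (-2))

/-- The compatibility condition on the coefficients: `A_{(-1^i)}² / (dᵢ A_{(1^1,-2^i)})` does not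
depend on `i`. -/
def Compatible {m : ℕ} (d : Fin (m + 1) → ℕ) (A : (Fin (m + 1) → ℝ) →₀ ℝ) : Prop :=
  ∀ i j : Fin m,
    A (Pi.single i.succ (-1)) ^ 2 / (d i.succ * A (Pi.single 0 1 + Pi.single i.succ (-2))) =
      A (Pi.single j.succ (-1)) ^ 2 / (d j.succ * A (Pi.single 0 1 + Pi.single j.succ (-2)))

/-- The known superpotential of the Bérard Bergery–Calabi ansatz. -/
def Calabi {m : ℕ} (d : Fin (m + 1) → ℕ) (A : (Fin (m + 1) → ℝ) →₀ ℝ)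
    (C : Finset (Ext (m + 1))) : Prop :=
  IsCalabi d A ∧ Compatible d A ∧
    (C : Set (Ext (m + 1))) = halfShift d
      ({Pi.single 0 (-1), Pi.single 0 1} ∪
        Set.range (fun i : Fin m => Pi.single 0 1 + Pi.single i.succ (-2)))

/-- The additional superpotential of the Bérard Bergery–Calabi ansatz with `d = (1, 2, 2)`. -/
def CalabiNew (E : ℝ) (d : Fin 3 → ℕ) (A : (Fin 3 → ℝ) →₀ ℝ) (C : Finset (Ext 3)) : Prop :=
  IsCalabi (m := 2) d A ∧ d = ![1, 2, 2] ∧ Compatible (m := 2) d A ∧ 0 < E ∧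
    (C : Set (Ext 3)) = halfShift d
      {![0, -1, -1], ![0, 1, -1], ![0, -1, 1], ![1, 0, -2], ![1, -2, 0]}

end Soliton

end

/-! The proof turns the differential equation into combinatorics of exponents.

In exponential coordinates the scalar curvature is explicit (`scalar_scaledFrame`, `eq_coeff`): its
weights are -e_i or e_k - e_i - e_l, all with coordinate sum -1. Connectedness of `K` and elementary
representation theory give what else is needed, collected in `IsCurvatureData`: at most one summand
has dimension one (`dim_one_unique`), the coefficient of -e_j is positive when d_j ≥ 2
(`coeff_pos`), weights with a positive entry have nonpositive coefficients (`coeff_nonpos`), and a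
weight e_z - 2e_j with d_z = 1 forces d_j to be even (`even_dim`).

Exponentials are linearly independent, so the superpotential equation says that for every b the sum
of f_c f_c' J(c, c') over c + c' = b is the prescribed coefficient at b. Hence, if J(a, b) ≠ 0 and a
+ b is not a prescribed exponent, then a + b has a second decomposition into exponents
(`splitting_of_sum`). The form J is Lorentzian: a product of levels u minus a positive definite form
(`J_eq_centre`). On an extreme face of the set of exponents the parallelogram law limits such
decompositions, so a face too high to produce prescribed sums is a single null vector, orthogonal to
every sufficiently high exponent (`exists_unique_top`). For the coordinate u this puts all exponents
in the hyperplane u = -1 (`snd_eq_neg_one`). They are then ½(d + (b, 0)) with b in a finite set B,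
and J becomes (1 - ⟨b, b'⟩)/4.

The same principle, applied to the coordinate sum on B, leaves three cases. If some sum is positive,
the top exponent is e_z with d_z = 1, and B is the Calabi arrangement (`calabi_of_pos`), or the
two-dimensional Bryant one when r = 1. If the top sum is zero and is attained only at 0, then B is
trivial or the five-dimensional Bryant arrangement (`bryant_of_zero`). Otherwise the top face is {a,
-a} with a a unit vector; a parity argument (`odd_of_face`) yields exactly two summands of dimension
at least two, both of dimension two, and the absence or presence of a one-dimensional summand gives
`warped_of_pair` or `calabiNew_of_pair`.

For each arrangement the equations on the coefficients are then written out and solved over the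
reals. Their solvability accounts for the sign condition on E and the compatibility condition on the
A_w, and gives the converse as well. -/

noncomputable section

namespace Soliton

/-! ### The bracket and the derivative of `Ad` in a chart at the identity -/

section AdjointDerivative

open Filter Topology VectorField

variable {E : Type*} [NormedAddCommGroup E] [NormedSpace ℝ E]
  {G : Type*} [TopologicalSpace G] [ChartedSpace E G] [Group G]

/-- Multiplication in the preferred chart at the identity. -/
def chartMul (z : E × E) : E :=
  extChartAt 𝓘(ℝ, E) (1 : G)
    ((extChartAt 𝓘(ℝ, E) (1 : G)).symm z.1 * (extChartAt 𝓘(ℝ, E) (1 : G)).symm z.2)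

/-- Conjugation in the preferred chart at the identity. -/
def chartConj (z : E × E) : E :=
  extChartAt 𝓘(ℝ, E) (1 : G)
    ((extChartAt 𝓘(ℝ, E) (1 : G)).symm z.1 * (extChartAt 𝓘(ℝ, E) (1 : G)).symm z.2 *
      ((extChartAt 𝓘(ℝ, E) (1 : G)).symm z.1)⁻¹)

theorem mfderiv_at_one_eq {h : G → E} (hh : MDifferentiableAt 𝓘(ℝ, E) 𝓘(ℝ, E) h 1) :
    mfderiv 𝓘(ℝ, E) 𝓘(ℝ, E) h 1 =
      fderiv ℝ (fun y => h ((extChartAt 𝓘(ℝ, E) (1 : G)).symm y))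
        (extChartAt 𝓘(ℝ, E) (1 : G) 1) := by
  refine hh.mfderiv.trans ?_
  change fderivWithin ℝ (writtenInExtChartAt 𝓘(ℝ, E) 𝓘(ℝ, E) 1 h) (Set.range 𝓘(ℝ, E)) _ = _
  simp [writtenInExtChartAt, fderivWithin_univ, Function.comp_def]
  rfl

theorem chart_symm_one :
    (extChartAt 𝓘(ℝ, E) (1 : G)).symm (extChartAt 𝓘(ℝ, E) (1 : G) 1) = 1 :=
  extChartAt_to_inv (1 : G)

variable [LieGroup 𝓘(ℝ, E) ∞ G]

theorem contMDiffAt_chart_symm {x : E} (hx : x ∈ (extChartAt 𝓘(ℝ, E) (1 : G)).target) :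
    ContMDiffAt 𝓘(ℝ, E) 𝓘(ℝ, E) ∞ (extChartAt 𝓘(ℝ, E) (1 : G)).symm x :=
  have : IsManifold 𝓘(ℝ, E) ∞ G := inferInstance
  (contMDiffOn_extChartAt_symm (1 : G)).contMDiffAt ((isOpen_extChartAt_target (1 : G)).mem_nhds hx)

theorem contMDiffAt_chart {g : G} (hg : g ∈ (extChartAt 𝓘(ℝ, E) (1 : G)).source) :
    ContMDiffAt 𝓘(ℝ, E) 𝓘(ℝ, E) ∞ (extChartAt 𝓘(ℝ, E) (1 : G)) g := by
  have : IsManifold 𝓘(ℝ, E) ∞ G := inferInstance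
  rw [extChartAt_source] at hg
  exact contMDiffAt_extChartAt' hg

theorem contDiffAt_chartMul {x y : E} (hx : x ∈ (extChartAt 𝓘(ℝ, E) (1 : G)).target)
    (hy : y ∈ (extChartAt 𝓘(ℝ, E) (1 : G)).target)
    (hxy : (extChartAt 𝓘(ℝ, E) (1 : G)).symm x * (extChartAt 𝓘(ℝ, E) (1 : G)).symm y ∈
      (extChartAt 𝓘(ℝ, E) (1 : G)).source) :
    ContDiffAt ℝ ∞ (chartMul (G := G)) (x, y) := by
  rw [← contMDiffAt_iff_contDiffAt]
  have h1 : ContMDiffAt 𝓘(ℝ, E × E) 𝓘(ℝ, E) ∞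
      (fun z : E × E => (extChartAt 𝓘(ℝ, E) (1 : G)).symm z.1) (x, y) :=
    ContMDiffAt.comp (x, y) (contMDiffAt_chart_symm (G := G) hx)
      (contMDiffAt_iff_contDiffAt.2 contDiffAt_fst)
  have h2 : ContMDiffAt 𝓘(ℝ, E × E) 𝓘(ℝ, E) ∞
      (fun z : E × E => (extChartAt 𝓘(ℝ, E) (1 : G)).symm z.2) (x, y) :=
    ContMDiffAt.comp (x, y) (contMDiffAt_chart_symm (G := G) hy)
      (contMDiffAt_iff_contDiffAt.2 contDiffAt_snd)
  exact ContMDiffAt.comp (x, y) (contMDiffAt_chart hxy) (h1.mul h2)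

theorem contDiffAt_chartConj :
    ContDiffAt ℝ ∞ (chartConj (G := G))
      (extChartAt 𝓘(ℝ, E) (1 : G) 1, extChartAt 𝓘(ℝ, E) (1 : G) 1) := by
  rw [← contMDiffAt_iff_contDiffAt]
  set e := extChartAt 𝓘(ℝ, E) (1 : G) 1 with he
  have hx : e ∈ (extChartAt 𝓘(ℝ, E) (1 : G)).target := mem_extChartAt_target (1 : G)
  have h1 : ContMDiffAt 𝓘(ℝ, E × E) 𝓘(ℝ, E) ∞
      (fun z : E × E => (extChartAt 𝓘(ℝ, E) (1 : G)).symm z.1) (e, e) :=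
    ContMDiffAt.comp (e, e) (contMDiffAt_chart_symm (G := G) hx)
      (contMDiffAt_iff_contDiffAt.2 contDiffAt_fst)
  have h2 : ContMDiffAt 𝓘(ℝ, E × E) 𝓘(ℝ, E) ∞
      (fun z : E × E => (extChartAt 𝓘(ℝ, E) (1 : G)).symm z.2) (e, e) :=
    ContMDiffAt.comp (e, e) (contMDiffAt_chart_symm (G := G) hx)
      (contMDiffAt_iff_contDiffAt.2 contDiffAt_snd)
  have h0 : (extChartAt 𝓘(ℝ, E) (1 : G)).symm e = 1 := extChartAt_to_inv (1 : G)
  refine ContMDiffAt.comp (e, e) (contMDiffAt_chart ?_) ((h1.mul h2).mul h1.inv)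
  rw [h0]
  simp

theorem mdifferentiable_conj (g : G) :
    MDifferentiable 𝓘(ℝ, E) 𝓘(ℝ, E) (fun x : G => g * x * g⁻¹) := by
  have : ContMDiff 𝓘(ℝ, E) 𝓘(ℝ, E) ∞ (fun x : G => g * x * g⁻¹) :=
    (contMDiff_const.mul contMDiff_id).mul contMDiff_const
  exact this.mdifferentiable (by simp)

theorem mfderiv_chart_one :
    mfderiv 𝓘(ℝ, E) 𝓘(ℝ, E) (extChartAt 𝓘(ℝ, E) (1 : G)) 1 = ContinuousLinearMap.id ℝ E := by
  have hd : MDifferentiableAt 𝓘(ℝ, E) 𝓘(ℝ, E) (extChartAt 𝓘(ℝ, E) (1 : G)) 1 :=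
    (contMDiffAt_chart (mem_extChartAt_source (1 : G))).mdifferentiableAt (by simp)
  refine (mfderiv_at_one_eq hd).trans ?_
  have : (fun y => extChartAt 𝓘(ℝ, E) (1 : G) ((extChartAt 𝓘(ℝ, E) (1 : G)).symm y))
      =ᶠ[𝓝 (extChartAt 𝓘(ℝ, E) (1 : G) 1)] id := by
    filter_upwards [extChartAt_target_mem_nhds (I := 𝓘(ℝ, E)) (1 : G)] with y hy
    exact (extChartAt 𝓘(ℝ, E) (1 : G)).right_inv hy
  rw [this.fderiv_eq, fderiv_id]

/-- An invariant vector field in the preferred chart at the identity. -/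
def chartField (Y : E) (x : E) : E :=
  fderiv ℝ (chartMul (G := G)) (x, extChartAt 𝓘(ℝ, E) (1 : G) 1) (0, Y)

theorem fderiv_chartMul_snd {x : E} (hx : x ∈ (extChartAt 𝓘(ℝ, E) (1 : G)).target) (Y : E) :
    fderiv ℝ (fun y => extChartAt 𝓘(ℝ, E) (1 : G) ((extChartAt 𝓘(ℝ, E) (1 : G)).symm x *
        (extChartAt 𝓘(ℝ, E) (1 : G)).symm y)) (extChartAt 𝓘(ℝ, E) (1 : G) 1) Y =
      chartField (E := E) (G := G) Y x := by
  set e := extChartAt 𝓘(ℝ, E) (1 : G) 1 with he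
  have hm : ContDiffAt ℝ ∞ (chartMul (G := G)) (x, e) := by
    apply contDiffAt_chartMul hx (mem_extChartAt_target (1 : G))
    rw [chart_symm_one, mul_one]
    exact (extChartAt 𝓘(ℝ, E) (1 : G)).map_target hx
  have h2 : HasFDerivAt (fun y : E => (x, y)) ((0 : E →L[ℝ] E).prod (ContinuousLinearMap.id ℝ E)) e :=
    (hasFDerivAt_const x e).prodMk (hasFDerivAt_id e)
  have h3 := ((hm.differentiableAt (by simp)).hasFDerivAt).comp e h2
  have h4 := h3.fderiv
  simp only [Function.comp_def, chartMul] at h4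
  rw [h4]
  rfl

/-- The inverse derivative of the inverse chart is the derivative of the chart, so the pullback is
the derivative of a left translation read in the chart, that is, a partial derivative of `chartMul`.
-/
theorem mpullbackWithin_mulInvariantVectorField {x : E}
    (hx : x ∈ (extChartAt 𝓘(ℝ, E) (1 : G)).target) (Y : GroupLieAlgebra 𝓘(ℝ, E) G) :
    mpullbackWithin 𝓘(ℝ, E) 𝓘(ℝ, E) (extChartAt 𝓘(ℝ, E) (1 : G)).symm
      (mulInvariantVectorField Y) (Set.range 𝓘(ℝ, E)) x = chartField (E := E) (G := G) Y x := by
  have : IsManifold 𝓘(ℝ, E) 1 G := IsManifold.of_le (n := ∞) (by simp)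
  rw [mpullbackWithin_apply]
  set φ := extChartAt 𝓘(ℝ, E) (1 : G) with hφ
  have hs : φ.symm x ∈ φ.source := φ.map_target hx
  have hinv : (mfderivWithin 𝓘(ℝ, E) 𝓘(ℝ, E) φ.symm (Set.range 𝓘(ℝ, E)) x).inverse =
      mfderiv 𝓘(ℝ, E) 𝓘(ℝ, E) φ (φ.symm x) :=
    ContinuousLinearMap.inverse_eq
      (mfderivWithin_extChartAt_symm_comp_mfderiv_extChartAt hx)
      (mfderiv_extChartAt_comp_mfderivWithin_extChartAt_symm hx)
  rw [hinv]
  have hL : MDifferentiableAt 𝓘(ℝ, E) 𝓘(ℝ, E) (fun b : G => φ.symm x * b) 1 :=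
    ((contMDiff_mul_left (I := 𝓘(ℝ, E)) (n := ∞)).mdifferentiable (by simp)) 1
  have hc : MDifferentiableAt 𝓘(ℝ, E) 𝓘(ℝ, E) φ (φ.symm x * 1) := by
    rw [mul_one]
    exact (contMDiffAt_chart hs).mdifferentiableAt (by simp)
  have hcomp := mfderiv_comp (1 : G) hc hL
  have hd := mfderiv_at_one_eq (hc.comp (1 : G) hL)
  rw [mul_one] at hcomp
  have h5 := congrArg (fun T : E →L[ℝ] E => T Y) (hcomp.symm.trans hd)
  refine Eq.trans ?_ (h5.trans (fderiv_chartMul_snd hx Y))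
  rfl

variable (G) in
/-- The Lie bracket on the model space. -/
def modelBracket (X Y : E) : E :=
  Bracket.bracket (L := GroupLieAlgebra 𝓘(ℝ, E) G) (M := GroupLieAlgebra 𝓘(ℝ, E) G) X Y

/-- The adjoint action on the model space. -/
def modelAd (g : G) : E →L[ℝ] E := Ad g

theorem Ad_eq_fderiv (g : G) :
    modelAd g =
      fderiv ℝ (fun y => extChartAt 𝓘(ℝ, E) (1 : G)
        (g * (extChartAt 𝓘(ℝ, E) (1 : G)).symm y * g⁻¹)) (extChartAt 𝓘(ℝ, E) (1 : G) 1) := by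
  refine (mdifferentiable_conj g 1).mfderiv.trans ?_
  change fderivWithin ℝ (writtenInExtChartAt 𝓘(ℝ, E) 𝓘(ℝ, E) 1 fun x : G => g * x * g⁻¹)
    (Set.range 𝓘(ℝ, E)) _ = _
  simp [writtenInExtChartAt, fderivWithin_univ, Function.comp_def]


/-- The manifold bracket is computed in the preferred chart, whose derivative at the identity is the
identity map, so no correction remains. -/
theorem bracket_eq_lieBracket (X Y : E) :
    modelBracket G X Y =
      lieBracket ℝ (chartField (E := E) (G := G) X) (chartField (E := E) (G := G) Y)
        (extChartAt 𝓘(ℝ, E) (1 : G) 1) := by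
  refine Eq.trans (mlieBracketWithin_apply (I := 𝓘(ℝ, E)) (s := Set.univ) (x₀ := (1 : G))
    (V := mulInvariantVectorField (I := 𝓘(ℝ, E)) (G := G) X)
    (W := mulInvariantVectorField (I := 𝓘(ℝ, E)) (G := G) Y)) ?_
  have h0 := mfderiv_chart_one (E := E) (G := G)
  have hX : mpullbackWithin 𝓘(ℝ, E) 𝓘(ℝ, E) (extChartAt 𝓘(ℝ, E) (1 : G)).symm
      (mulInvariantVectorField X) (Set.range 𝓘(ℝ, E)) =ᶠ[𝓝 (extChartAt 𝓘(ℝ, E) (1 : G) 1)]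
      chartField (E := E) (G := G) X := by
    filter_upwards [extChartAt_target_mem_nhds (I := 𝓘(ℝ, E)) (1 : G)] with y hy
    exact mpullbackWithin_mulInvariantVectorField hy X
  have hY : mpullbackWithin 𝓘(ℝ, E) 𝓘(ℝ, E) (extChartAt 𝓘(ℝ, E) (1 : G)).symm
      (mulInvariantVectorField Y) (Set.range 𝓘(ℝ, E)) =ᶠ[𝓝 (extChartAt 𝓘(ℝ, E) (1 : G) 1)]
      chartField (E := E) (G := G) Y := by
    filter_upwards [extChartAt_target_mem_nhds (I := 𝓘(ℝ, E)) (1 : G)] with y hy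
    exact mpullbackWithin_mulInvariantVectorField hy Y
  have hb := hX.lieBracket_vectorField_eq (𝕜 := ℝ) hY
  have hset : (extChartAt 𝓘(ℝ, E) (1 : G)).symm ⁻¹' Set.univ ∩ Set.range 𝓘(ℝ, E) = Set.univ := by
    simp
  rw [hset]
  refine Eq.trans ?_ ((congrFun lieBracketWithin_univ _).trans hb)
  have hi : (mfderiv 𝓘(ℝ, E) 𝓘(ℝ, E) (extChartAt 𝓘(ℝ, E) (1 : G)) 1).inverse =
      ContinuousLinearMap.id ℝ E :=
    (congrArg (fun T : E →L[ℝ] E => T.inverse) h0).trans ContinuousLinearMap.inverse_id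
  exact congrArg (fun T : E →L[ℝ] E => T _) hi

theorem contDiffAt_chartMul_one :
    ContDiffAt ℝ ∞ (chartMul (G := G))
      (extChartAt 𝓘(ℝ, E) (1 : G) 1, extChartAt 𝓘(ℝ, E) (1 : G) 1) := by
  apply contDiffAt_chartMul (mem_extChartAt_target (1 : G)) (mem_extChartAt_target (1 : G))
  rw [chart_symm_one, mul_one]
  exact mem_extChartAt_source (1 : G)

theorem hasFDerivAt_chartField_one (Y : E) :
    HasFDerivAt (chartField (E := E) (G := G) Y)
      (((fderiv ℝ (fderiv ℝ (chartMul (G := G)))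
        (extChartAt 𝓘(ℝ, E) (1 : G) 1, extChartAt 𝓘(ℝ, E) (1 : G) 1)).comp
        (ContinuousLinearMap.inl ℝ E E)).flip (0, Y)) (extChartAt 𝓘(ℝ, E) (1 : G) 1) := by
  set e := extChartAt 𝓘(ℝ, E) (1 : G) 1 with he
  have h1 : DifferentiableAt ℝ (fderiv ℝ (chartMul (G := G))) (e, e) :=
    ((contDiffAt_chartMul_one (G := G)).fderiv_right (m := 1) (by norm_cast)).differentiableAt one_ne_zero
  have h2 : HasFDerivAt (fun x : E => (x, e)) (ContinuousLinearMap.inl ℝ E E) e :=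
    (hasFDerivAt_id e).prodMk (hasFDerivAt_const e e)
  have h3 := HasFDerivAt.comp (f := fun x : E => (x, e)) e h1.hasFDerivAt h2
  exact h3.clm_apply (hasFDerivAt_const ((0 : E), Y) e) |>.congr_fderiv (by ext; simp)

theorem chartField_one (Y : E) :
    chartField (E := E) (G := G) Y (extChartAt 𝓘(ℝ, E) (1 : G) 1) = Y := by
  rw [← fderiv_chartMul_snd (mem_extChartAt_target (1 : G))]
  have : (fun y => extChartAt 𝓘(ℝ, E) (1 : G) ((extChartAt 𝓘(ℝ, E) (1 : G)).symm
      (extChartAt 𝓘(ℝ, E) (1 : G) 1) * (extChartAt 𝓘(ℝ, E) (1 : G)).symm y))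
      =ᶠ[𝓝 (extChartAt 𝓘(ℝ, E) (1 : G) 1)] id := by
    filter_upwards [extChartAt_target_mem_nhds (I := 𝓘(ℝ, E)) (1 : G)] with y hy
    rw [chart_symm_one, one_mul]
    exact (extChartAt 𝓘(ℝ, E) (1 : G)).right_inv hy
  rw [this.fderiv_eq, fderiv_id]
  rfl

theorem fderiv_chartMul_inl_one (Y : E) :
    fderiv ℝ (chartMul (G := G))
      (extChartAt 𝓘(ℝ, E) (1 : G) 1, extChartAt 𝓘(ℝ, E) (1 : G) 1) (Y, 0) = Y := by
  set e := extChartAt 𝓘(ℝ, E) (1 : G) 1 with he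
  have h2 : HasFDerivAt (fun x : E => (x, e)) (ContinuousLinearMap.inl ℝ E E) e :=
    (hasFDerivAt_id e).prodMk (hasFDerivAt_const e e)
  have h3 := HasFDerivAt.comp (f := fun x : E => (x, e)) e
    ((contDiffAt_chartMul_one (G := G)).differentiableAt (by simp)).hasFDerivAt h2
  have : (chartMul (G := G)) ∘ (fun x : E => (x, e)) =ᶠ[𝓝 e] id := by
    filter_upwards [extChartAt_target_mem_nhds (I := 𝓘(ℝ, E)) (1 : G)] with y hy
    simp only [Function.comp_def, chartMul, he]
    rw [chart_symm_one, mul_one]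
    exact (extChartAt 𝓘(ℝ, E) (1 : G)).right_inv hy
  have h4 := (h3.congr_of_eventuallyEq this.symm).unique (hasFDerivAt_id e)
  exact congrArg (fun T : E →L[ℝ] E => T Y) h4

/-- The invariant fields take the values `X` and `Y` at the identity, and their derivatives there
are mixed second derivatives of the multiplication. -/
theorem bracket_eq_snd_fderiv (X Y : E) :
    modelBracket G X Y =
      fderiv ℝ (fderiv ℝ (chartMul (E := E) (G := G)))
        (extChartAt 𝓘(ℝ, E) (1 : G) 1, extChartAt 𝓘(ℝ, E) (1 : G) 1) (X, 0) (0, Y) -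
      fderiv ℝ (fderiv ℝ (chartMul (E := E) (G := G)))
        (extChartAt 𝓘(ℝ, E) (1 : G) 1, extChartAt 𝓘(ℝ, E) (1 : G) 1) (Y, 0) (0, X) := by
  rw [bracket_eq_lieBracket, lieBracket_eq]
  beta_reduce
  rw [(hasFDerivAt_chartField_one (G := G) (Y : E)).fderiv,
    (hasFDerivAt_chartField_one (G := G) (X : E)).fderiv]
  simp only [chartField_one]
  rfl

/-- Presents `Ad` near the identity as a partial derivative of the smooth map `chartConj`, from
which its differentiability follows. -/
theorem Ad_chart_eventuallyEq (Y : E) :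
    (fun x => modelAd ((extChartAt 𝓘(ℝ, E) (1 : G)).symm x) Y)
      =ᶠ[𝓝 (extChartAt 𝓘(ℝ, E) (1 : G) 1)]
    fun x => fderiv ℝ (chartConj (G := G)) (x, extChartAt 𝓘(ℝ, E) (1 : G) 1) (0, Y) := by
  set e := extChartAt 𝓘(ℝ, E) (1 : G) 1 with he
  have h1 : ∀ᶠ z in 𝓝 (e, e), ContDiffAt ℝ 1 (chartConj (G := G)) z :=
    ((contDiffAt_chartConj (G := G)).of_le (by simp)).eventually (by simp)
  have h2 : ∀ᶠ x in 𝓝 e, ContDiffAt ℝ 1 (chartConj (G := G)) (x, e) :=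
    (Continuous.prodMk_left e).continuousAt.eventually h1
  filter_upwards [h2] with x hx
  have h2 : HasFDerivAt (fun y : E => (x, y)) ((0 : E →L[ℝ] E).prod (ContinuousLinearMap.id ℝ E)) e :=
    (hasFDerivAt_const x e).prodMk (hasFDerivAt_id e)
  have h3 := ((hx.differentiableAt (by simp)).hasFDerivAt).comp e h2
  have h4 := h3.fderiv
  simp only [Function.comp_def, chartConj] at h4
  have h5 := (Ad_eq_fderiv ((extChartAt 𝓘(ℝ, E) (1 : G)).symm x)).trans h4
  exact congrArg (fun T : E →L[ℝ] E => T Y) h5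

/-- Differentiates g y = (g y g⁻¹) g in `y` at the identity: a left-invariant field is the right
translate of `Ad g Y`. -/
theorem chartField_eventuallyEq (Y : E) :
    chartField (E := E) (G := G) Y =ᶠ[𝓝 (extChartAt 𝓘(ℝ, E) (1 : G) 1)]
    fun x => fderiv ℝ (chartMul (G := G)) (extChartAt 𝓘(ℝ, E) (1 : G) 1, x)
      (modelAd ((extChartAt 𝓘(ℝ, E) (1 : G)).symm x) Y, 0) := by
  set φ := extChartAt 𝓘(ℝ, E) (1 : G) with hφ
  set e := φ 1 with he
  filter_upwards [extChartAt_target_mem_nhds (I := 𝓘(ℝ, E)) (1 : G)] with x hx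
  set g := φ.symm x with hg
  have hc0 : φ (g * φ.symm e * g⁻¹) = e := by rw [he, chart_symm_one]; simp
  have hm : ContDiffAt ℝ ∞ (chartMul (G := G)) (e, x) := by
    apply contDiffAt_chartMul (mem_extChartAt_target (1 : G)) hx
    rw [chart_symm_one, one_mul]
    exact φ.map_target hx
  have hd : DifferentiableAt ℝ (fun y => φ (g * φ.symm y * g⁻¹)) e := by
    have h1 : ContMDiffAt 𝓘(ℝ, E) 𝓘(ℝ, E) ∞ (fun y => φ (g * φ.symm y * g⁻¹)) e := by
      have h2 : ContMDiffAt 𝓘(ℝ, E) 𝓘(ℝ, E) ∞ (fun y => g * φ.symm y * g⁻¹) e :=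
        (contMDiffAt_const.mul (contMDiffAt_chart_symm (mem_extChartAt_target (1 : G)))).mul
          contMDiffAt_const
      refine ContMDiffAt.comp e (contMDiffAt_chart ?_) h2
      rw [chart_symm_one]
      simp
    exact (contMDiffAt_iff_contDiffAt.1 h1).differentiableAt (by simp)
  have h2 : HasFDerivAt (fun y : E => (φ (g * φ.symm y * g⁻¹), x))
      ((modelAd g).prod (0 : E →L[ℝ] E)) e := by
    refine HasFDerivAt.prodMk ?_ (hasFDerivAt_const x e)
    have := hd.hasFDerivAt
    rwa [← Ad_eq_fderiv] at this
  have hm' : HasFDerivAt (chartMul (G := G)) (fderiv ℝ (chartMul (G := G)) (e, x))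
      (φ (g * φ.symm e * g⁻¹), x) := by
    rw [hc0]
    exact (hm.differentiableAt (by simp)).hasFDerivAt
  have h3 := hm'.comp e h2
  have hev : (chartMul (G := G)) ∘ (fun y : E => (φ (g * φ.symm y * g⁻¹), x)) =ᶠ[𝓝 e]
      fun y => φ (g * φ.symm y) := by
    have hcont : ContinuousAt (fun y => g * φ.symm y * g⁻¹) e :=
      ((contMDiffAt_const.mul (contMDiffAt_chart_symm (mem_extChartAt_target (1 : G)))).mul
          contMDiffAt_const : ContMDiffAt 𝓘(ℝ, E) 𝓘(ℝ, E) ∞ (fun y => g * φ.symm y * g⁻¹) e).continuousAt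
    have hs : φ.source ∈ 𝓝 (g * φ.symm e * g⁻¹) := by
      rw [he, chart_symm_one, mul_one, mul_inv_cancel]
      exact extChartAt_source_mem_nhds (I := 𝓘(ℝ, E)) (1 : G)
    filter_upwards [hcont hs] with y hy
    simp only [Function.comp_def, chartMul]
    rw [← hφ, φ.left_inv hy, ← hg, inv_mul_cancel_right]
  have h4 := hev.fderiv_eq (𝕜 := ℝ)
  rw [h3.fderiv] at h4
  rw [← fderiv_chartMul_snd hx, ← h4]
  rfl

/-- The derivative of the adjoint representation is the bracket. -/
theorem hasFDerivAt_Ad_chart (Y : E) :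
    ∃ L : E →L[ℝ] E, (∀ Z, L Z = modelBracket G Z Y) ∧
      HasFDerivAt (fun x => modelAd ((extChartAt 𝓘(ℝ, E) (1 : G)).symm x) Y) L
        (extChartAt 𝓘(ℝ, E) (1 : G) 1) := by
  set e := extChartAt 𝓘(ℝ, E) (1 : G) 1 with he
  set M := fderiv ℝ (fderiv ℝ (chartMul (E := E) (G := G))) (e, e) with hM
  have hdiff : DifferentiableAt ℝ (fun x => modelAd ((extChartAt 𝓘(ℝ, E) (1 : G)).symm x) Y) e := by
    refine DifferentiableAt.congr_of_eventuallyEq ?_ (Ad_chart_eventuallyEq (Y : E))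
    have h1 : DifferentiableAt ℝ (fderiv ℝ (chartConj (G := G))) (e, e) :=
      ((contDiffAt_chartConj (G := G)).fderiv_right (m := 1) (by norm_cast)).differentiableAt one_ne_zero
    have h2 : HasFDerivAt (fun x : E => (x, e)) (ContinuousLinearMap.inl ℝ E E) e :=
      (hasFDerivAt_id e).prodMk (hasFDerivAt_const e e)
    have h3 := HasFDerivAt.comp (f := fun x : E => (x, e)) e h1.hasFDerivAt h2
    exact (h3.clm_apply (hasFDerivAt_const ((0 : E), (Y : E)) e)).differentiableAt
  obtain ⟨L, hL⟩ := hdiff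
  refine ⟨L, fun Z => ?_, hL⟩
  have h1 : DifferentiableAt ℝ (fderiv ℝ (chartMul (G := G))) (e, e) :=
    ((contDiffAt_chartMul_one (G := G)).fderiv_right (m := 1) (by norm_cast)).differentiableAt one_ne_zero
  have h2 : HasFDerivAt (fun x : E => (e, x)) (ContinuousLinearMap.inr ℝ E E) e :=
    (hasFDerivAt_const e e).prodMk (hasFDerivAt_id e)
  have h3 := (h1.hasFDerivAt).comp e h2
  have h4 := h3.clm_apply (hL.prodMk (hasFDerivAt_const (0 : E) e))
  -- Two derivatives of the same field, with m the multiplication: D²m(Z,0)(0,Y) = D²m(0,Z)(Y,0) + L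
  -- Z. Symmetry of D²m then identifies `L Z` with the bracket.
  have h5 := (h4.congr_of_eventuallyEq (chartField_eventuallyEq (Y : E))).unique
    (hasFDerivAt_chartField_one (G := G) (Y : E))
  have h6 := congrArg (fun T : E →L[ℝ] E => T (Z : E)) h5
  have hone : modelAd ((extChartAt 𝓘(ℝ, E) (1 : G)).symm e) Y = Y := by
    rw [he, chart_symm_one, modelAd, Ad]
    have : (fun x : G => 1 * x * 1⁻¹) = id := by ext; simp
    rw [this]
    exact congrArg (fun T : E →L[ℝ] E => T Y) (mfderiv_id (I := 𝓘(ℝ, E)) (x := (1 : G)))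
  have hsymm : M ((0 : E), (Z : E)) ((Y : E), (0 : E)) = M ((Y : E), (0 : E)) ((0 : E), (Z : E)) :=
    ((contDiffAt_chartMul_one (G := G)).isSymmSndFDerivAt (by simp; norm_cast)) _ _
  have h7 := fderiv_chartMul_inl_one (G := G) (L Z)
  rw [bracket_eq_snd_fderiv, ← he, ← hM, ← hsymm, eq_sub_iff_add_eq]
  rw [hone] at h6
  refine Eq.trans ?_ h6
  refine congrArg₂ (· + ·) ?_ ?_
  · exact h7.symm
  · rfl

end AdjointDerivative

end Soliton

end

/-! ### `Ad` as a representation by Lie algebra maps, and its restriction to the isotropy group -/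

noncomputable section

namespace Soliton

section AdjointRepresentation

open Filter Topology

variable {E : Type*} [NormedAddCommGroup E] [NormedSpace ℝ E]
  {G : Type*} [TopologicalSpace G] [ChartedSpace E G] [Group G]

theorem modelAd_one (X : E) : modelAd (1 : G) X = X := by
  have : (fun x : G => 1 * x * 1⁻¹) = id := by ext; simp
  rw [modelAd, Ad, this]
  exact congrArg (fun T : E →L[ℝ] E => T X) (mfderiv_id (I := 𝓘(ℝ, E)) (x := (1 : G)))

theorem modelBracket_swap (X Y : E) : modelBracket G X Y = -modelBracket G Y X :=
  VectorField.mlieBracket_swap_apply (I := 𝓘(ℝ, E)) (x := (1 : G))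
    (V := mulInvariantVectorField (I := 𝓘(ℝ, E)) (G := G) X)
    (W := mulInvariantVectorField (I := 𝓘(ℝ, E)) (G := G) Y)

variable [LieGroup 𝓘(ℝ, E) ∞ G]

theorem modelAd_mul (g h : G) (X : E) : modelAd (g * h) X = modelAd g (modelAd h X) := by
  have h1 : HasMFDerivAt 𝓘(ℝ, E) 𝓘(ℝ, E) (fun x : G => h * x * h⁻¹) 1 (Ad h) :=
    (mdifferentiable_conj h 1).hasMFDerivAt
  have h2 : HasMFDerivAt 𝓘(ℝ, E) 𝓘(ℝ, E) (fun x : G => g * x * g⁻¹) (h * 1 * h⁻¹) (Ad g) := by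
    have := (mdifferentiable_conj (E := E) g 1).hasMFDerivAt
    rw [mul_one, mul_inv_cancel]
    exact this
  have h3 := (h2.comp (1 : G) h1).mfderiv
  have h4 : (fun x : G => g * x * g⁻¹) ∘ (fun x : G => h * x * h⁻¹) =
      fun x => (g * h) * x * (g * h)⁻¹ := by
    ext x
    simp [mul_assoc]
  rw [h4] at h3
  exact congrArg (fun T : E →L[ℝ] E => T X) h3

theorem hasMFDerivAt_modelAd (Y : E) :
    ∃ L : E →L[ℝ] E, (∀ Z, L Z = modelBracket G Z Y) ∧
      HasMFDerivAt 𝓘(ℝ, E) 𝓘(ℝ, E) (fun g : G => modelAd g Y) 1 L := by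
  obtain ⟨L, hL, hd⟩ := hasFDerivAt_Ad_chart (G := G) Y
  refine ⟨L, hL, ?_, ?_⟩
  · have h1 : ContinuousAt (fun g : G => modelAd ((extChartAt 𝓘(ℝ, E) (1 : G)).symm
        (extChartAt 𝓘(ℝ, E) (1 : G) g)) Y) 1 :=
      ContinuousAt.comp (f := extChartAt 𝓘(ℝ, E) (1 : G)) hd.continuousAt
        (continuousAt_extChartAt (1 : G))
    refine h1.congr ?_
    filter_upwards [extChartAt_source_mem_nhds (I := 𝓘(ℝ, E)) (1 : G)] with g hg
    rw [(extChartAt 𝓘(ℝ, E) (1 : G)).left_inv hg]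
  · exact hd.hasFDerivWithinAt

/-- `Ad g` is a homomorphism of Lie algebras. -/
theorem modelAd_bracket (g : G) (Z Y : E) :
    modelAd g (modelBracket G Z Y) = modelBracket G (modelAd g Z) (modelAd g Y) := by
  obtain ⟨L, hL, hd⟩ := hasMFDerivAt_modelAd (G := G) Y
  obtain ⟨M, hM, hd'⟩ := hasMFDerivAt_modelAd (G := G) (modelAd g Y)
  have h1 : HasMFDerivAt 𝓘(ℝ, E) 𝓘(ℝ, E) (fun x : G => g * x * g⁻¹) 1 (Ad g) :=
    (mdifferentiable_conj g 1).hasMFDerivAt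
  have h2 : HasMFDerivAt 𝓘(ℝ, E) 𝓘(ℝ, E) (fun x : G => modelAd x (modelAd g Y)) (g * 1 * g⁻¹) M := by
    rw [mul_one, mul_inv_cancel]
    exact hd'
  have h3 := h2.comp (1 : G) h1
  have h4 : HasMFDerivAt 𝓘(ℝ, E) 𝓘(ℝ, E) (fun x : G => modelAd g (modelAd x Y)) 1
      ((modelAd g).comp L : E →L[ℝ] E) :=
    HasMFDerivAt.comp (g := (modelAd g : E → E)) (1 : G)
      (modelAd g).hasFDerivAt.hasMFDerivAt hd
  -- The relation Ad g ∘ Ad x = Ad(g x g⁻¹) ∘ Ad g, whose derivative at x = 1 is the claim.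
  have h5 : (fun x : G => modelAd g (modelAd x Y)) =
      (fun x : G => modelAd x (modelAd g Y)) ∘ (fun x : G => g * x * g⁻¹) := by
    ext x
    simp only [Function.comp_apply]
    rw [← modelAd_mul, ← modelAd_mul]
    simp
  rw [h5] at h4
  have h6 := congrArg (fun T : E →L[ℝ] E => T Z) (hasMFDerivAt_unique h4 h3)
  have h7 : modelAd g (L Z) = M (modelAd g Z) := h6
  rwa [hL, hM] at h7

/-- With the second argument fixed, the bracket is the derivative of an orbit map of `Ad`, hence
linear. -/
theorem modelBracket_add_left (X Y Z : E) :
    modelBracket G (X + Y) Z = modelBracket G X Z + modelBracket G Y Z := by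
  obtain ⟨L, hL, -⟩ := hasMFDerivAt_modelAd (G := G) Z
  simpa [hL] using L.map_add X Y

theorem modelBracket_smul_left (c : ℝ) (X Z : E) :
    modelBracket G (c • X) Z = c • modelBracket G X Z := by
  obtain ⟨L, hL, -⟩ := hasMFDerivAt_modelAd (G := G) Z
  simpa [hL] using L.map_smul c X

section Isotropy

variable {F : Type*} [NormedAddCommGroup F] [NormedSpace ℝ F] {K : Subgroup G} [ChartedSpace F K]

variable (E F K) in
/-- The derivative of the inclusion of a subgroup, on the model spaces. -/
def modelInclusion : F →L[ℝ] E := inclusionDeriv E F K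

theorem hasMFDerivAt_modelAd_subgroup (hK : ContMDiff 𝓘(ℝ, F) 𝓘(ℝ, E) ∞ (K.subtype : K → G)) (Y : E) :
    ∃ L : F →L[ℝ] E, (∀ z, L z = modelBracket G (modelInclusion E F K z) Y) ∧
      HasMFDerivAt 𝓘(ℝ, F) 𝓘(ℝ, E) (fun g : K => modelAd (g : G) Y) 1 L := by
  obtain ⟨L, hL, hd⟩ := hasMFDerivAt_modelAd (G := G) Y
  have h1 : HasMFDerivAt 𝓘(ℝ, F) 𝓘(ℝ, E) (K.subtype : K → G) 1 (inclusionDeriv E F K) :=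
    (hK.mdifferentiable (by simp) 1).hasMFDerivAt
  have h2 := HasMFDerivAt.comp (f := (K.subtype : K → G)) (1 : K) hd h1
  exact ⟨_, fun z => hL _, h2⟩

/-- The bracket with elements of the isotropy algebra preserves `Ad(K)`-invariant subspaces. -/
theorem modelBracket_mem (hK : ContMDiff 𝓘(ℝ, F) 𝓘(ℝ, E) ∞ (K.subtype : K → G))
    [FiniteDimensional ℝ E] {p : Submodule ℝ E} {Y : E} (hY : ∀ k : K, modelAd (k : G) Y ∈ p) (z : F) :
    modelBracket G (modelInclusion E F K z) Y ∈ p := by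
  by_contra hcon
  -- A functional that vanishes on `p` but not on the bracket. It is zero along the orbit of `Y`, so
  -- its derivative there is zero too.
  obtain ⟨f, hf, hp⟩ := Submodule.exists_le_ker_of_notMem hcon
  obtain ⟨L, hL, hd⟩ := hasMFDerivAt_modelAd_subgroup hK Y
  let f' : E →L[ℝ] ℝ := LinearMap.toContinuousLinearMap f
  have h2 : HasMFDerivAt 𝓘(ℝ, F) 𝓘(ℝ, ℝ) (fun k : K => f' (modelAd (k : G) Y)) 1 (f'.comp L) :=
    HasMFDerivAt.comp (g := (f' : E → ℝ)) (1 : K) f'.hasFDerivAt.hasMFDerivAt hd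
  have h3 : (fun k : K => f' (modelAd (k : G) Y)) = fun _ => 0 := by
    ext k
    exact hp (hY k)
  rw [h3] at h2
  have h4 := congrArg (fun T : F →L[ℝ] ℝ => T z) (hasMFDerivAt_unique h2 (hasMFDerivAt_const (0 : ℝ) (1 : K)))
  have h5 : f (L z) = 0 := h4
  rw [hL] at h5
  exact hf h5

/-- In a chart the function has zero derivative on a ball, and a ball is convex. -/
theorem locallyConstant_of_hasMFDerivAt_zero {M : Type*} [TopologicalSpace M] [ChartedSpace F M]
    [IsManifold 𝓘(ℝ, F) ∞ M] {f : M → E} 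
    (hf : ∀ x, HasMFDerivAt 𝓘(ℝ, F) 𝓘(ℝ, E) f x (0 : F →L[ℝ] E)) : IsLocallyConstant f := by
  rw [IsLocallyConstant.iff_eventually_eq]
  intro x
  set ψ := extChartAt 𝓘(ℝ, F) x with hψ
  have htop : ψ.target ∈ 𝓝 (ψ x) := extChartAt_target_mem_nhds (I := 𝓘(ℝ, F)) x
  obtain ⟨ε, hε, hball⟩ := Metric.mem_nhds_iff.1 htop
  have hzero : ∀ y ∈ Metric.ball (ψ x) ε, HasFDerivAt (fun y => f (ψ.symm y)) (0 : F →L[ℝ] E) y := by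
    intro y hy
    have h1 : ContMDiffAt 𝓘(ℝ, F) 𝓘(ℝ, F) ∞ ψ.symm y :=
      (contMDiffOn_extChartAt_symm x).contMDiffAt ((isOpen_extChartAt_target x).mem_nhds (hball hy))
    have h2 := (h1.mdifferentiableAt (by simp)).hasMFDerivAt
    have h3 := HasMFDerivAt.comp y (hf (ψ.symm y)) h2
    have h4 := hasMFDerivAt_iff_hasFDerivAt.1 h3
    exact h4.congr_fderiv (by ext; rfl)
  have hconst : ∀ y ∈ Metric.ball (ψ x) ε, f (ψ.symm y) = f (ψ.symm (ψ x)) := by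
    intro y hy
    exact (convex_ball (ψ x) ε).is_const_of_fderivWithin_eq_zero (𝕜 := ℝ)
      (fun z hz => (hzero z hz).differentiableAt.differentiableWithinAt)
      (fun z hz => ((hzero z hz).hasFDerivWithinAt.fderivWithin
        (Metric.isOpen_ball.uniqueDiffWithinAt hz)))
      hy (Metric.mem_ball_self hε)
  have hc : ContinuousAt ψ x := continuousAt_extChartAt x
  filter_upwards [hc (Metric.ball_mem_nhds _ hε), extChartAt_source_mem_nhds (I := 𝓘(ℝ, F)) x]
    with y hy hys
  have := hconst _ hy
  rwa [ψ.left_inv hys, ψ.left_inv (mem_extChartAt_source x)] at this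

/-- A vector that commutes with the Lie algebra of a connected group is fixed by the group. -/
theorem modelAd_eq_self [LieGroup 𝓘(ℝ, F) ∞ K]
    (hK : ContMDiff 𝓘(ℝ, F) 𝓘(ℝ, E) ∞ (K.subtype : K → G))
    (hconn : IsConnected (K : Set G)) {Y : E}
    (hY : ∀ z : F, modelBracket G (modelInclusion E F K z) Y = 0) (k : K) :
    modelAd (k : G) Y = Y := by
  have hc : PreconnectedSpace K := Subtype.preconnectedSpace hconn.isPreconnected
  obtain ⟨L, hL, hd⟩ := hasMFDerivAt_modelAd_subgroup hK Y
  have hL0 : L = 0 := by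
    ext z
    rw [hL, hY, zero_apply]
  have hloc : IsLocallyConstant (fun k : K => modelAd (k : G) Y) := by
    have : IsManifold 𝓘(ℝ, F) ∞ K := inferInstance
    refine locallyConstant_of_hasMFDerivAt_zero (F := F) fun k₀ => ?_
    have h1 : MDifferentiableAt 𝓘(ℝ, F) 𝓘(ℝ, F) (fun k : K => k₀⁻¹ * k) k₀ :=
      (contMDiff_mul_left (I := 𝓘(ℝ, F)) (n := ∞)).mdifferentiable (by simp) k₀
    have h2 : HasMFDerivAt 𝓘(ℝ, F) 𝓘(ℝ, E) (fun g : K => modelAd (g : G) Y) (k₀⁻¹ * k₀)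
        (0 : F →L[ℝ] E) := by
      rw [inv_mul_cancel, ← hL0]
      exact hd
    have h3 := HasMFDerivAt.comp (f := fun k : K => k₀⁻¹ * k) k₀ h2 h1.hasMFDerivAt
    have h4 := HasMFDerivAt.comp (g := (modelAd (k₀ : G) : E → E)) k₀
      (modelAd (k₀ : G)).hasFDerivAt.hasMFDerivAt h3
    -- Ad k = Ad k₀ ∘ Ad(k₀⁻¹ k), so the derivative of the orbit map at `k₀` factors through the one
    -- at the identity, which is zero.
    have h5 : (modelAd (k₀ : G) : E → E) ∘ ((fun g : K => modelAd (g : G) Y) ∘ fun k : K => k₀⁻¹ * k) =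
        fun k : K => modelAd (k : G) Y := by
      ext k
      simp only [Function.comp_apply]
      rw [← modelAd_mul]
      simp
    rw [h5] at h4
    obtain ⟨T, hT0, hT⟩ : ∃ T : F →L[ℝ] E, T = 0 ∧
        HasMFDerivAt 𝓘(ℝ, F) 𝓘(ℝ, E) (fun k : K => modelAd (k : G) Y) k₀ T :=
      ⟨_, ContinuousLinearMap.ext fun z => (modelAd (k₀ : G)).map_zero, h4⟩
    subst hT0
    exact hT
  have := hloc.apply_eq_of_preconnectedSpace k 1
  simpa [modelAd_one] using this

end Isotropy

/-- A bilinear form invariant under `Ad` is invariant under the bracket. -/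
theorem modelBracket_invariant [FiniteDimensional ℝ E] (B : E →ₗ[ℝ] E →ₗ[ℝ] ℝ)
    (hB : ∀ (g : G) X Y, B (modelAd g X) (modelAd g Y) = B X Y) (Z X Y : E) :
    B (modelBracket G Z X) Y = -B X (modelBracket G Z Y) := by
  let B' : E →L[ℝ] E →L[ℝ] ℝ :=
    LinearMap.toContinuousLinearMap
      ((LinearMap.toContinuousLinearMap : (E →ₗ[ℝ] ℝ) ≃ₗ[ℝ] E →L[ℝ] ℝ).toLinearMap.comp B)
  obtain ⟨L, hL, hd⟩ := hasFDerivAt_Ad_chart (G := G) X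
  obtain ⟨M, hM, hd'⟩ := hasFDerivAt_Ad_chart (G := G) Y
  have h1 := B'.hasFDerivAt_of_bilinear hd hd'
  have h2 : (fun y => B' (modelAd ((extChartAt 𝓘(ℝ, E) (1 : G)).symm y) X)
      (modelAd ((extChartAt 𝓘(ℝ, E) (1 : G)).symm y) Y)) = fun _ => B' X Y := by
    ext y
    exact hB _ X Y
  rw [h2] at h1
  have h3 := congrArg (fun T : E →L[ℝ] ℝ => T Z) (h1.unique (hasFDerivAt_const _ _))
  have h4 : B (modelAd ((extChartAt 𝓘(ℝ, E) (1 : G)).symm (extChartAt 𝓘(ℝ, E) (1 : G) 1)) X) (M Z) +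
      B (L Z) (modelAd ((extChartAt 𝓘(ℝ, E) (1 : G)).symm (extChartAt 𝓘(ℝ, E) (1 : G) 1)) Y) = 0 := h3
  rw [chart_symm_one, hL, hM, modelAd_one, modelAd_one] at h4
  linarith

end AdjointRepresentation

end Soliton

end

/-! ### Scalar curvature in a rescaled orthonormal frame -/

noncomputable section

namespace Soliton

section ScalarCurvature

variable {V : Type*} [AddCommGroup V] [Module ℝ V] [Bracket V V] {ι : Type*} [Fintype ι]

/-- The coefficients of the Levi-Civita map in terms of structure constants. -/
def christoffel (c : ι → ι → ι → ℝ) (i j k : ι) : ℝ := (c i j k - c j k i + c k i j) / 2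

variable [DecidableEq ι] (br : V →ₗ[ℝ] V →ₗ[ℝ] V) (hbr : ∀ X Y : V, ⁅X, Y⁆ = br X Y)
  (g : LinearMap.BilinForm ℝ V) (X : ι → V)

include hbr in
omit [DecidableEq ι] in
theorem leviCivita_sum_right (a : ι) (β : ι → ℝ) :
    leviCivita (fun Z W => g Z W) X (X a) (∑ d, β d • X d) =
      ∑ c, (∑ d, β d * christoffel (fun i j k => g (br (X i) (X j)) (X k)) a d c) • X c := by
  unfold leviCivita
  refine Finset.sum_congr rfl fun c _ => ?_
  congr 1
  simp only [hbr, map_sum, map_smul, LinearMap.sum_apply, LinearMap.smul_apply, smul_eq_mul,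
    christoffel]
  rw [← Finset.sum_sub_distrib, ← Finset.sum_add_distrib, Finset.sum_div]
  refine Finset.sum_congr rfl fun d _ => ?_
  ring

include hbr in
omit [DecidableEq ι] in
theorem leviCivita_sum_left (b : ι) (β : ι → ℝ) :
    leviCivita (fun Z W => g Z W) X (∑ d, β d • X d) (X b) =
      ∑ c, (∑ d, β d * christoffel (fun i j k => g (br (X i) (X j)) (X k)) d b c) • X c := by
  unfold leviCivita
  refine Finset.sum_congr rfl fun c _ => ?_
  congr 1
  simp only [hbr, map_sum, map_smul, LinearMap.sum_apply, LinearMap.smul_apply, smul_eq_mul,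
    christoffel]
  rw [← Finset.sum_sub_distrib, ← Finset.sum_add_distrib, Finset.sum_div]
  refine Finset.sum_congr rfl fun d _ => ?_
  ring

include hbr in
theorem scalar_eq_christoffel (hX : ∀ a b, g (X a) (X b) = if a = b then 1 else 0) :
    scalar (fun Z W => g Z W) X = ∑ b, ∑ a,
      ((∑ c, christoffel (fun i j k => g (br (X i) (X j)) (X k)) b b c *
          christoffel (fun i j k => g (br (X i) (X j)) (X k)) a c a)
        - (∑ c, christoffel (fun i j k => g (br (X i) (X j)) (X k)) a b c *
          christoffel (fun i j k => g (br (X i) (X j)) (X k)) b c a)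
        - (∑ c, g (br (X a) (X b)) (X c) *
          christoffel (fun i j k => g (br (X i) (X j)) (X k)) c b a)
        - g (br (br (X a) (X b) - ∑ c, g (br (X a) (X b)) (X c) • X c) (X b)) (X a)) := by
  unfold scalar ricci
  refine Finset.sum_congr rfl fun b _ => Finset.sum_congr rfl fun a _ => ?_
  have hsum : ∀ β : ι → ℝ, g (∑ c, β c • X c) (X a) = β a := by
    intro β
    simp [map_sum, LinearMap.sum_apply, hX]
  have hLC : ∀ i j, leviCivita (fun Z W => g Z W) X (X i) (X j) =
      ∑ c, christoffel (fun i j k => g (br (X i) (X j)) (X k)) i j c • X c := by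
    intro i j
    have := leviCivita_sum_right br hbr g X i (fun d => if d = j then 1 else 0)
    simpa using this
  unfold curvature
  rw [hLC b b, hLC a b, leviCivita_sum_right br hbr, leviCivita_sum_right br hbr]
  unfold horizontal
  rw [leviCivita_sum_left br hbr]
  simp only [map_sub, LinearMap.sub_apply, hsum, hbr]

end ScalarCurvature

section ScaledFrame

variable {V : Type*} [AddCommGroup V] [Module ℝ V] {ι : Type*} [Fintype ι]
  [DecidableEq ι]

/-- The part of `⁅e a, e b⁆` orthogonal to the frame `e`. -/
def verticalBracket (br : V →ₗ[ℝ] V →ₗ[ℝ] V) (Q : LinearMap.BilinForm ℝ V) (e : ι → V) (a b : ι) : V :=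
  br (e a) (e b) - ∑ c, Q (br (e a) (e b)) (e c) • e c

variable {br : V →ₗ[ℝ] V →ₗ[ℝ] V} (hswap : ∀ X Y, br X Y = -br Y X) {Q : LinearMap.BilinForm ℝ V} (hQ : ∀ X Y, Q X Y = Q Y X)
  (hinv : ∀ Z X Y, Q (br Z X) Y = -Q X (br Z Y)) {e : ι → V}
  (he : ∀ a b, Q (e a) (e b) = if a = b then 1 else 0)

include he in
theorem verticalBracket_orthogonal (a b c : ι) : Q (verticalBracket br Q e a b) (e c) = 0 := by
  simp [verticalBracket, he]

include he in
theorem verticalBracket_inner (a b : ι) :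
    Q (verticalBracket br Q e a b) (br (e a) (e b)) =
      Q (verticalBracket br Q e a b) (verticalBracket br Q e a b) := by
  have h : br (e a) (e b) = verticalBracket br Q e a b + ∑ c, Q (br (e a) (e b)) (e c) • e c := by
    rw [verticalBracket, sub_add_cancel]
  conv_lhs => rw [h, map_add, map_sum]
  simp [verticalBracket_orthogonal he]

include hswap in
omit [Fintype ι] [DecidableEq ι] in
theorem structure_swap (a b c : ι) : Q (br (e a) (e b)) (e c) = -Q (br (e b) (e a)) (e c) := by
  rw [hswap, map_neg, LinearMap.neg_apply]

include hswap hQ hinv in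
omit [Fintype ι] [DecidableEq ι] in
-- Each `br Z` is skew for `Q`; together with antisymmetry of the bracket this makes the structure
-- constants totally antisymmetric.
theorem structure_cycle (a b c : ι) : Q (br (e a) (e b)) (e c) = Q (br (e b) (e c)) (e a) := by
  rw [hswap, map_neg, LinearMap.neg_apply, hinv, neg_neg, hQ]

omit [DecidableEq ι] in
theorem sum_cycle (F : ι → ι → ι → ℝ) :
    ∑ b, ∑ a, ∑ c, F a b c = ∑ b, ∑ a, ∑ c, F b c a := by
  calc ∑ b, ∑ a, ∑ c, F a b c = ∑ a, ∑ b, ∑ c, F a b c := Finset.sum_comm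
    _ = ∑ b, ∑ c, ∑ a, F b c a := rfl
    _ = ∑ b, ∑ a, ∑ c, F b c a := Finset.sum_congr rfl fun b _ => Finset.sum_comm

include hswap hQ hinv he in
-- Total antisymmetry of the structure constants of a `Q`-orthonormal frame lets every Christoffel
-- product be written through a single squared structure constant. What is left over cancels under
-- cyclic permutation of the three indices.
theorem scalar_scaledFrame [Bracket V V] (hbr : ∀ X Y : V, ⁅X, Y⁆ = br X Y) (x t : ι → ℝ) (hxt : ∀ a, x a * t a ^ 2 = 1) :
    scalar (fun Z W => ∑ a, x a * (Q (e a) Z * Q (e a) W)) (fun a => t a • e a) =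
      (∑ b, ∑ a, t b ^ 2 * Q (verticalBracket br Q e a b) (verticalBracket br Q e a b)) +
      ∑ b, ∑ a, ∑ c, Q (br (e a) (e b)) (e c) ^ 2 *
        (t c ^ 2 / 2 - x c * t a ^ 2 * t b ^ 2 / 4) := by
  let g : LinearMap.BilinForm ℝ V := ∑ a, x a • LinearMap.BilinForm.linMulLin (Q (e a)) (Q (e a))
  have hg : (fun Z W => ∑ a, x a * (Q (e a) Z * Q (e a) W)) = fun Z W => g Z W := by
    ext Z W
    simp [g, LinearMap.sum_apply]
  have hgX : ∀ Z c, g Z (t c • e c) = x c * t c * Q Z (e c) := by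
    intro Z c
    simp only [g, LinearMap.sum_apply, LinearMap.smul_apply, LinearMap.BilinForm.linMulLin_apply,
      map_smul, smul_eq_mul, he]
    simp [hQ Z]
    ring
  have horth : ∀ a b, g (t a • e a) (t b • e b) = if a = b then 1 else 0 := by
    intro a b
    rw [hgX, map_smul, LinearMap.smul_apply, he]
    by_cases h : a = b
    · subst h
      rw [if_pos rfl, smul_eq_mul, mul_one, ← hxt a]
      ring
    · simp [h]
  set N : ι → ι → ι → ℝ := fun a b c => Q (br (e a) (e b)) (e c) with hN
  have hc : ∀ a b c, g (br (t a • e a) (t b • e b)) (t c • e c) = x c * t c * t a * t b * N a b c := by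
    intro a b c
    rw [hgX]
    simp only [map_smul, LinearMap.smul_apply, smul_eq_mul, hN]
    ring
  have hN1 : ∀ a b c, N a b c = -N b a c := structure_swap hswap
  have hN2 : ∀ a b c, N a b c = N b c a := structure_cycle hswap hQ hinv
  have hN3 : ∀ a c, N a a c = 0 := fun a c => by linarith [hN1 a a c]
  have hN4 : ∀ a c, N a c a = 0 := fun a c => by rw [← hN2, hN3]
  rw [hg, scalar_eq_christoffel br hbr g (fun a => t a • e a) horth]
  have hvert : ∀ a b, g (br (br (t a • e a) (t b • e b) -
      ∑ c, g (br (t a • e a) (t b • e b)) (t c • e c) • (t c • e c)) (t b • e b)) (t a • e a) =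
      -(t b ^ 2 * Q (verticalBracket br Q e a b) (verticalBracket br Q e a b)) := by
    intro a b
    have h1 : br (t a • e a) (t b • e b) -
        ∑ c, g (br (t a • e a) (t b • e b)) (t c • e c) • (t c • e c) =
        (t a * t b) • verticalBracket br Q e a b := by
      rw [verticalBracket, smul_sub, Finset.smul_sum]
      congr 1
      · simp only [map_smul, LinearMap.smul_apply, smul_smul]
        rw [mul_comm]
      · refine Finset.sum_congr rfl fun c _ => ?_
        rw [hc, smul_smul, smul_smul]
        congr 1
        linear_combination (t a * t b * N a b c) * hxt c
    rw [h1, hgX]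
    -- Skewness moves `e b` to the other side, and the vertical part of a bracket pairs with the
    -- whole bracket as it does with itself.
    have h2 : Q (br (verticalBracket br Q e a b) (e b)) (e a) =
        -Q (verticalBracket br Q e a b) (verticalBracket br Q e a b) := by
      rw [hswap, map_neg, LinearMap.neg_apply, hinv, hswap (e b), map_neg,
        verticalBracket_inner he]
      ring
    simp only [map_smul, LinearMap.smul_apply, smul_eq_mul, h2]
    linear_combination (-t b ^ 2 * Q (verticalBracket br Q e a b) (verticalBracket br Q e a b)) * hxt a
  simp only [hvert]
  -- Antisymmetry makes the Levi-Civita map vanish on the diagonal, so this part of the Ricci trace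
  -- drops out.
  have hfirst : ∀ a b c, christoffel (fun i j k => g (br (t i • e i) (t j • e j)) (t k • e k)) b b c *
      christoffel (fun i j k => g (br (t i • e i) (t j • e j)) (t k • e k)) a c a = 0 := by
    intro a b c
    have : christoffel (fun i j k => g (br (t i • e i) (t j • e j)) (t k • e k)) b b c = 0 := by
      simp only [christoffel, hc]
      rw [hN3, hN4, hN2 c b b, hN3]
      ring
    rw [this, zero_mul]
  simp only [hfirst, Finset.sum_const_zero, zero_sub, sub_neg_eq_add]
  simp only [Finset.sum_add_distrib]
  rw [add_comm]
  congr 1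
  simp only [sub_eq_add_neg, ← Finset.sum_neg_distrib, ← Finset.sum_add_distrib]
  have hterm : ∀ b a c, -(christoffel (fun i j k => g (br (t i • e i) (t j • e j)) (t k • e k)) a b c *
        christoffel (fun i j k => g (br (t i • e i) (t j • e j)) (t k • e k)) b c a) +
      -(g (br (t a • e a) (t b • e b)) (t c • e c) *
        christoffel (fun i j k => g (br (t i • e i) (t j • e j)) (t k • e k)) c b a) =
      N a b c ^ 2 * (t a ^ 2 * t b ^ 2 * t c ^ 2) *
        (-(3 / 4) * x c ^ 2 + x a ^ 2 / 4 + x b ^ 2 / 4 - x a * x b / 2 + x c * x a / 2 + x c * x b / 2) := by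
    intro b a c
    have e1 : N b c a = N a b c := (hN2 a b c).symm
    have e2 : N c a b = N a b c := by rw [hN2 c a b]
    have e3 : N c b a = -N a b c := by rw [hN1 c b a, e1]
    have e4 : N b a c = -N a b c := hN1 b a c
    have e5 : N a c b = -N a b c := by rw [hN1 a c b, e2]
    simp only [christoffel, hc, e1, e2, e3, e4, e5]
    ring
  simp only [hterm]
  -- The last summand separates the connection terms from the asserted formula; it vanishes only
  -- after summation.
  have hsplit : ∀ b a c, N a b c ^ 2 * (t a ^ 2 * t b ^ 2 * t c ^ 2) *
        (-(3 / 4) * x c ^ 2 + x a ^ 2 / 4 + x b ^ 2 / 4 - x a * x b / 2 + x c * x a / 2 + x c * x b / 2) =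
      N a b c ^ 2 * (t c ^ 2 / 2 + -(x c * t a ^ 2 * t b ^ 2 / 4)) +
      N a b c ^ 2 * (t a ^ 2 * t b ^ 2 * t c ^ 2) * (x a ^ 2 / 4 + x b ^ 2 / 4 - x c ^ 2 / 2 
        + (x c * x a + x c * x b) / 2 - x a * x b) := by
    intro b a c
    have h1 : t c ^ 2 = t c ^ 2 * (x a * t a ^ 2) * (x b * t b ^ 2) := by rw [hxt, hxt]; ring
    have h2 : x c * t a ^ 2 * t b ^ 2 = x c * t a ^ 2 * t b ^ 2 * (x c * t c ^ 2) := by rw [hxt]; ring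
    rw [h2]
    linear_combination (-N a b c ^ 2 / 2) * h1
  simp only [hsplit, Finset.sum_add_distrib, ← sub_eq_add_neg]
  set M : ι → ι → ι → ℝ := fun a b c => N a b c ^ 2 * (t a ^ 2 * t b ^ 2 * t c ^ 2) with hM
  have hMc : ∀ a b c, M a b c = M b c a := by
    intro a b c
    simp only [hM, hN2 a b c]
    ring
  have hrest : ∑ b, ∑ a, ∑ c, M a b c * (x a ^ 2 / 4 + x b ^ 2 / 4 - x c ^ 2 / 2
        + (x c * x a + x c * x b) / 2 - x a * x b) = 0 := by
    -- Chosen so that the remaining summand is P(b,c,a) + P(c,a,b) - 2P(a,b,c), whose total sum is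
    -- zero.
    set P : ι → ι → ι → ℝ := fun a b c => M a b c * (x c ^ 2 / 4 + x a * x b / 2) with hP
    have h1 := sum_cycle P
    have h2 := sum_cycle fun a b c => P b c a
    have h3 : ∀ b a c, M a b c * (x a ^ 2 / 4 + x b ^ 2 / 4 - x c ^ 2 / 2
        + (x c * x a + x c * x b) / 2 - x a * x b) = P b c a + P c a b - (P a b c + P a b c) := by
      intro b a c
      simp only [hP, ← hMc a b c, ← hMc b c a]
      ring
    simp only [h3, Finset.sum_sub_distrib, Finset.sum_add_distrib]
    linarith
  simp only [hM] at hrest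
  rw [hrest, add_zero]

end ScaledFrame

end Soliton

end

/-! ### Linear independence of exponentials -/

noncomputable section

namespace Soliton

section Exponentials

/-- Dedekind's independence of characters: x ↦ exp(χ_t(x)) are distinct homomorphisms from the
additive group to the multiplicative monoid of the reals. -/
theorem finsupp_eq_zero_of_exp_sum {T M : Type*} [AddCommGroup M] (χ : T → M →+ ℝ)
    (hχ : Function.Injective χ) (F : T →₀ ℝ)
    (hF : ∀ x, (F.sum fun t a => a * Real.exp (χ t x)) = 0) : F = 0 := by
  let ψ : T → (Multiplicative M →* ℝ) := fun t =>
    { toFun := fun x => Real.exp (χ t x.toAdd)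
      map_one' := by simp
      map_mul' := fun x y => by simp [Real.exp_add] }
  have hψ : Function.Injective ψ := by
    intro t t' h
    refine hχ (AddMonoidHom.ext fun x => ?_)
    exact Real.exp_injective (DFunLike.congr_fun h (Multiplicative.ofAdd x))
  have hli := (linearIndependent_monoidHom (Multiplicative M) ℝ).comp ψ hψ
  rw [linearIndependent_iff] at hli
  apply hli
  ext x
  rw [Finsupp.linearCombination_apply, Finsupp.sum_apply']
  simpa [Finsupp.sum, ψ] using hF x.toAdd

variable {r : ℕ}

theorem weightSum_injective : Function.Injective (weightSum (r := r)) := by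
  intro A A' h
  rw [← sub_eq_zero]
  let χ : (Fin r → ℝ) → ((Fin r → ℝ) →+ ℝ) := fun w =>
    { toFun := fun q => ∑ i, w i * q i
      map_zero' := by simp
      map_add' := fun x y => by simp [mul_add, Finset.sum_add_distrib] }
  refine finsupp_eq_zero_of_exp_sum χ ?_ _ fun x => ?_
  · intro w w' hw
    ext i
    simpa [χ, Pi.single_apply] using DFunLike.congr_fun hw (Pi.single i 1)
  · rw [Finsupp.sum_sub_index (by intros; ring)]
    exact sub_eq_zero.2 (congrFun h x)

theorem expSum_injective : Function.Injective (expSum (r := r)) := by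
  intro A A' h
  rw [← sub_eq_zero]
  let χ : Ext r → (Ext r →+ ℝ) := fun w =>
    { toFun := fun q => dot w q
      map_zero' := by simp [dot]
      map_add' := fun x y => by simp [dot, mul_add, Finset.sum_add_distrib]; ring }
  refine finsupp_eq_zero_of_exp_sum χ ?_ _ fun x => ?_
  · intro w w' hw
    refine Prod.ext (funext fun i => ?_) ?_
    · simpa [χ, dot, Pi.single_apply] using DFunLike.congr_fun hw (Pi.single i 1, 0)
    · simpa [χ, dot] using DFunLike.congr_fun hw (0, 1)
  · rw [Finsupp.sum_sub_index (by intros; ring)]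
    exact sub_eq_zero.2 (congrFun h x)

theorem weightSum_add (A A' : (Fin r → ℝ) →₀ ℝ) (q : Fin r → ℝ) :
    weightSum (A + A') q = weightSum A q + weightSum A' q :=
  Finsupp.sum_add_index' (by simp) (by intros; ring)

theorem weightSum_single (w : Fin r → ℝ) (c : ℝ) (q : Fin r → ℝ) :
    weightSum (Finsupp.single w c) q = c * Real.exp (∑ i, w i * q i) :=
  Finsupp.sum_single_index (by simp)

theorem weightSum_sum {κ : Type*} (s : Finset κ) (A : κ → (Fin r → ℝ) →₀ ℝ) (q : Fin r → ℝ) :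
    weightSum (∑ k ∈ s, A k) q = ∑ k ∈ s, weightSum (A k) q := by
  classical
  induction s using Finset.induction_on with
  | empty => simp [weightSum]
  | insert a s ha ih => rw [Finset.sum_insert ha, Finset.sum_insert ha, weightSum_add, ih]

theorem expSum_add (A A' : Ext r →₀ ℝ) (q : Ext r) :
    expSum (A + A') q = expSum A q + expSum A' q :=
  Finsupp.sum_add_index' (by simp) (by intros; ring)

theorem expSum_single (w : Ext r) (c : ℝ) (q : Ext r) :
    expSum (Finsupp.single w c) q = c * Real.exp (dot w q) :=
  Finsupp.sum_single_index (by simp)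

theorem expSum_sum {κ : Type*} (s : Finset κ) (A : κ → Ext r →₀ ℝ) (q : Ext r) :
    expSum (∑ k ∈ s, A k) q = ∑ k ∈ s, expSum (A k) q := by
  classical
  induction s using Finset.induction_on with
  | empty => simp [expSum]
  | insert a s ha ih => rw [Finset.sum_insert ha, Finset.sum_insert ha, expSum_add, ih]

end Exponentials

end Soliton

end

/-! ### The bilinear bracket on the Lie algebra and the invariance of `Q` -/

noncomputable section

namespace Soliton

section SplittingBracket

variable {E : Type*} [NormedAddCommGroup E] [NormedSpace ℝ E]
  {G : Type*} [TopologicalSpace G] [ChartedSpace E G] [Group G] [LieGroup 𝓘(ℝ, E) ∞ G]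

variable (E G) in
/-- The Lie bracket as a bilinear map. -/
def bracketHom : GroupLieAlgebra 𝓘(ℝ, E) G →ₗ[ℝ] GroupLieAlgebra 𝓘(ℝ, E) G →ₗ[ℝ]
    GroupLieAlgebra 𝓘(ℝ, E) G :=
  let m : E →ₗ[ℝ] E →ₗ[ℝ] E :=
    LinearMap.mk₂ ℝ (modelBracket G) modelBracket_add_left modelBracket_smul_left
      (fun X Y Z => by
        rw [modelBracket_swap, modelBracket_add_left, modelBracket_swap Y, modelBracket_swap Z]; abel)
      (fun c X Y => by
        rw [modelBracket_swap, modelBracket_smul_left, modelBracket_swap Y, smul_neg, neg_neg])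
  m

theorem bracketHom_apply (X Y : GroupLieAlgebra 𝓘(ℝ, E) G) : ⁅X, Y⁆ = bracketHom E G X Y := rfl

theorem bracketHom_swap (X Y : GroupLieAlgebra 𝓘(ℝ, E) G) :
    bracketHom E G X Y = -bracketHom E G Y X :=
  modelBracket_swap (E := E) (G := G) X Y

theorem Ad_bracketHom (g : G) (X Y : GroupLieAlgebra 𝓘(ℝ, E) G) :
    Ad g (bracketHom E G X Y) = bracketHom E G (Ad g X) (Ad g Y) :=
  modelAd_bracket (E := E) g X Y

theorem Ad_mul (g h : G) (X : GroupLieAlgebra 𝓘(ℝ, E) G) : Ad (g * h) X = Ad g (Ad h X) :=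
  modelAd_mul (E := E) g h X

omit [LieGroup 𝓘(ℝ, E) ∞ G] in
theorem Ad_one (X : GroupLieAlgebra 𝓘(ℝ, E) G) : Ad (1 : G) X = X :=
  modelAd_one (E := E) (G := G) X

variable {F : Type*} [NormedAddCommGroup F] [NormedSpace ℝ F] {K : Subgroup G} [ChartedSpace F K]
  {r : ℕ}

theorem bracketHom_mem [FiniteDimensional ℝ E]
    (hK : ContMDiff 𝓘(ℝ, F) 𝓘(ℝ, E) ∞ (K.subtype : K → G))
    {p : Submodule ℝ (GroupLieAlgebra 𝓘(ℝ, E) G)} (hp : ∀ k ∈ K, ∀ X ∈ p, Ad k X ∈ p)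
    {Z X : GroupLieAlgebra 𝓘(ℝ, E) G} (hZ : Z ∈ isotropyAlgebra E F K) (hX : X ∈ p) :
    bracketHom E G Z X ∈ p := by
  obtain ⟨z, rfl⟩ := hZ
  exact modelBracket_mem (E := E) hK (p := p) (Y := X) (fun k => hp k k.2 X hX) z

theorem Ad_eq_self [LieGroup 𝓘(ℝ, F) ∞ K]
    (hK : ContMDiff 𝓘(ℝ, F) 𝓘(ℝ, E) ∞ (K.subtype : K → G))
    (hconn : IsConnected (K : Set G)) {X : GroupLieAlgebra 𝓘(ℝ, E) G}
    (hX : ∀ Z ∈ isotropyAlgebra E F K, bracketHom E G Z X = 0) (k : G) (hk : k ∈ K) : Ad k X = X :=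
  modelAd_eq_self (E := E) (F := F) hK hconn (Y := X)
    (fun z => hX _ (LinearMap.mem_range_self _ z)) ⟨k, hk⟩

namespace IsotropySplitting

theorem Q_bracketHom [FiniteDimensional ℝ E] (D : IsotropySplitting E F K r)
    (Z X Y : GroupLieAlgebra 𝓘(ℝ, E) G) :
    D.Q (bracketHom E G Z X) Y = -D.Q X (bracketHom E G Z Y) :=
  modelBracket_invariant (E := E) (G := G) D.Q D.biinvariant Z X Y

end IsotropySplitting

end SplittingBracket

end Soliton

end

/-! ### The scalar curvature as an explicit exponential sum -/

noncomputable section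

namespace Soliton

namespace IsotropySplitting

section Coefficients

variable {E : Type*} [NormedAddCommGroup E] [NormedSpace ℝ E]
  {G : Type*} [TopologicalSpace G] [ChartedSpace E G] [Group G]
  {F : Type*} [NormedAddCommGroup F] [NormedSpace ℝ F] {K : Subgroup G} [ChartedSpace F K]
  {r : ℕ} (D : IsotropySplitting E F K r)

/-- The index type of the frame of `𝔭`. -/
abbrev FrameIndex : Type := Σ i : Fin r, Fin (Module.finrank ℝ (D.p i))

/-- The `Q`-orthonormal frame of `𝔭`. -/
def totalFrame (a : D.FrameIndex) : GroupLieAlgebra 𝓘(ℝ, E) G := D.frame a.1 a.2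

theorem totalFrame_mem (a : D.FrameIndex) : D.totalFrame a ∈ D.p a.1 := (D.frame a.1 a.2).2

theorem totalFrame_orthonormal (a b : D.FrameIndex) :
    D.Q (D.totalFrame a) (D.totalFrame b) = if a = b then 1 else 0 := by
  obtain ⟨i, a⟩ := a
  obtain ⟨j, b⟩ := b
  by_cases h : i = j
  · subst h
    simp [totalFrame, D.orthonormal]
  · rw [if_neg (by simp [h])]
    exact D.orthogonal i j h _ (D.frame i a).2 _ (D.frame j b).2

variable [LieGroup 𝓘(ℝ, E) ∞ G]

/-- The structure constants of the frame of `𝔭`. -/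
def structureConst (a b c : D.FrameIndex) : ℝ :=
  D.Q (bracketHom E G (D.totalFrame a) (D.totalFrame b)) (D.totalFrame c)

/-- The square norm of the component in `𝔨` of a bracket of frame vectors. -/
def verticalNorm (a b : D.FrameIndex) : ℝ :=
  D.Q (verticalBracket (bracketHom E G) D.Q D.totalFrame a b)
    (verticalBracket (bracketHom E G) D.Q D.totalFrame a b)

theorem verticalNorm_nonneg (a b : D.FrameIndex) : 0 ≤ D.verticalNorm a b := by
  unfold verticalNorm
  by_cases h : verticalBracket (bracketHom E G) D.Q D.totalFrame a b = 0
  · rw [h]; simp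
  · exact (D.pos _ h).le

variable [FiniteDimensional ℝ E]

/-- The case x = exp(q_i), t = exp(-q_i/2) of `scalar_scaledFrame`, for the union of the frames of
the summands. -/
theorem scalarCurvature_eq (q : Fin r → ℝ) :
    D.scalarCurvature q =
      (∑ b : D.FrameIndex, ∑ a : D.FrameIndex, Real.exp (-q b.1) * D.verticalNorm a b) +
      ∑ b : D.FrameIndex, ∑ a : D.FrameIndex, ∑ c : D.FrameIndex, D.structureConst a b c ^ 2 *
        (Real.exp (-q c.1) / 2 - Real.exp (q c.1 - q a.1 - q b.1) / 4) := by
  have h := scalar_scaledFrame bracketHom_swap D.symm D.Q_bracketHom D.totalFrame_orthonormal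
    bracketHom_apply (fun a => Real.exp (q a.1)) (fun a => Real.exp (-q a.1 / 2)) (by
      intro a
      rw [← Real.exp_nat_mul, ← Real.exp_add]
      simp; ring)
  have hm : D.metric q = fun Z W => ∑ a : D.FrameIndex, Real.exp (q a.1) *
      (D.Q (D.totalFrame a) Z * D.Q (D.totalFrame a) W) := by
    ext Z W
    rw [metric, Fintype.sum_sigma]
    simp only [Finset.mul_sum]
    rfl
  rw [scalarCurvature, hm]
  refine h.trans ?_
  have hsq : ∀ a : D.FrameIndex, Real.exp (-q a.1 / 2) ^ 2 = Real.exp (-q a.1) := by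
    intro a
    rw [← Real.exp_nat_mul]
    congr 1
    push_cast
    ring
  simp only [hsq]
  congr 1
  refine Finset.sum_congr rfl fun b _ => Finset.sum_congr rfl fun a _ =>
    Finset.sum_congr rfl fun c _ => ?_
  rw [← Real.exp_add, ← Real.exp_add]
  congr 3

/-- The coefficients of the scalar curvature. -/
def coeff : (Fin r → ℝ) →₀ ℝ :=
  (∑ b : D.FrameIndex, ∑ a : D.FrameIndex,
      Finsupp.single (Pi.single b.1 (-1)) (D.verticalNorm a b)) +
    ∑ b : D.FrameIndex, ∑ a : D.FrameIndex, ∑ c : D.FrameIndex,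
      (Finsupp.single (Pi.single c.1 (-1)) (D.structureConst a b c ^ 2 / 2) +
        Finsupp.single (Pi.single c.1 1 - Pi.single a.1 1 - Pi.single b.1 1)
          (-(D.structureConst a b c ^ 2 / 4)))

/-- An exponential sum determines its coefficients, so any presentation of the scalar curvature is
the one by structure constants. -/
theorem eq_coeff {A : (Fin r → ℝ) →₀ ℝ} (hA : ∀ q, D.scalarCurvature q = weightSum A q) :
    A = D.coeff := by
  refine weightSum_injective (funext fun q => ?_)
  rw [← hA, scalarCurvature_eq, coeff]
  simp only [weightSum_add, weightSum_sum, weightSum_single]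
  have h1 : ∀ i : Fin r, ∑ j, (Pi.single i (-1) : Fin r → ℝ) j * q j = -q i := by
    intro i
    simp [Pi.single_apply]
  have h2 : ∀ i j k : Fin r, ∑ l, (Pi.single k 1 - Pi.single i 1 - Pi.single j 1 : Fin r → ℝ) l * q l =
      q k - q i - q j := by
    intro i j k
    simp [Pi.single_apply, sub_mul, Finset.sum_sub_distrib]
  simp only [h1, h2]
  congr 1
  · refine Finset.sum_congr rfl fun b _ => Finset.sum_congr rfl fun a _ => ?_
    ring
  · refine Finset.sum_congr rfl fun b _ => Finset.sum_congr rfl fun a _ =>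
      Finset.sum_congr rfl fun c _ => ?_
    ring

omit [FiniteDimensional ℝ E] in
theorem coeff_apply (w : Fin r → ℝ) :
    D.coeff w = (∑ b : D.FrameIndex, ∑ a : D.FrameIndex,
        if (Pi.single b.1 (-1) : Fin r → ℝ) = w then D.verticalNorm a b else 0) +
      ∑ b : D.FrameIndex, ∑ a : D.FrameIndex, ∑ c : D.FrameIndex,
        ((if (Pi.single c.1 (-1) : Fin r → ℝ) = w then D.structureConst a b c ^ 2 / 2 else 0) +
          if (Pi.single c.1 1 - Pi.single a.1 1 - Pi.single b.1 1 : Fin r → ℝ) = w then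
            -(D.structureConst a b c ^ 2 / 4) else 0) := by
  simp only [coeff, Finsupp.add_apply, Finsupp.finsetSum_apply, Finsupp.single_apply]

theorem structureConst_cycle (a b c : D.FrameIndex) :
    D.structureConst a b c = D.structureConst b c a :=
  structure_cycle bracketHom_swap D.symm D.Q_bracketHom a b c

theorem single_ne_of_pos {i k : Fin r} {w : Fin r → ℝ} (hw : 0 < w k) :
    (Pi.single i (-1) : Fin r → ℝ) ≠ w := by
  intro h
  rw [← h, Pi.single_apply] at hw
  split_ifs at hw <;> linarith

omit [FiniteDimensional ℝ E] in
/-- A weight other than `-1` at one position has the form `e_k - e_i - e_l` with `k ∉ {i, l}`. -/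
theorem coeff_ne_zero {w : Fin r → ℝ} (hw : D.coeff w ≠ 0) :
    (∃ i, w = Pi.single i (-1)) ∨
      ∃ i l k, k ≠ i ∧ k ≠ l ∧ w = Pi.single k 1 - Pi.single i 1 - Pi.single l 1 := by
  by_contra! hcon
  obtain ⟨h1, h2⟩ := hcon
  apply hw
  rw [coeff_apply]
  have h3 : ∀ i : Fin r, (Pi.single i (-1) : Fin r → ℝ) ≠ w := fun i => (h1 i).symm
  have h4 : ∀ i l k : Fin r, (Pi.single k 1 - Pi.single i 1 - Pi.single l 1 : Fin r → ℝ) ≠ w := by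
    intro i l k h
    by_cases hi : k = i
    · subst hi
      apply h3 l
      rw [← h, sub_self, zero_sub, ← Pi.single_neg]
    by_cases hl : k = l
    · subst hl
      apply h3 i
      rw [← h, sub_right_comm, sub_self, zero_sub, ← Pi.single_neg]
    exact h2 i l k hi hl h.symm
  simp [h3, h4]

omit [FiniteDimensional ℝ E] in
-- The vertical terms and the positive structure constant terms sit at the weights -e_i. A weight
-- with a positive entry receives only the terms -N²/4, where N is a structure constant.
theorem coeff_nonpos {w : Fin r → ℝ} {k : Fin r} (hk : 0 < w k) : D.coeff w ≤ 0 := by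
  rw [coeff_apply]
  have h3 : ∀ i : Fin r, (Pi.single i (-1) : Fin r → ℝ) ≠ w := fun i => single_ne_of_pos hk
  simp only [h3, if_false, Finset.sum_const_zero, zero_add]
  refine Finset.sum_nonpos fun b _ => Finset.sum_nonpos fun a _ => Finset.sum_nonpos fun c _ => ?_
  split_ifs
  · have := sq_nonneg (D.structureConst a b c)
    linarith
  · exact le_rfl

/-- The negative terms that fall on the weight -e_j are dominated, after cyclic relabelling, by the
positive ones, so only the vertical part need be kept in a lower bound. -/
theorem verticalNorm_sum_le_coeff (j : Fin r) :
    ∑ b : D.FrameIndex, ∑ a : D.FrameIndex, (if b.1 = j then D.verticalNorm a b else 0) ≤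
      D.coeff (Pi.single j (-1)) := by
  have hinj : ∀ i : Fin r, (Pi.single i (-1) : Fin r → ℝ) = Pi.single j (-1) ↔ i = j := by
    intro i
    constructor
    · intro h
      by_contra hij
      have := congrFun h i
      simp [hij] at this
    · rintro rfl; rfl
  rw [coeff_apply]
  simp only [hinj]
  refine le_add_of_nonneg_right ?_
  set M : D.FrameIndex → D.FrameIndex → D.FrameIndex → ℝ := fun a b c => D.structureConst a b c ^ 2
    with hM
  have hMc : ∀ a b c, M a b c = M b c a := fun a b c => by simp only [hM, D.structureConst_cycle a b c]
  -- Half of the positive term at (a, b, c). Its two cyclic shifts cover the loss -N²/4, which can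
  -- occur at -e_j only if `a` or `b` lies in block `j`; and 2P minus the two shifts sums to zero.
  set P : D.FrameIndex → D.FrameIndex → D.FrameIndex → ℝ :=
    fun a b c => M a b c / 4 * (if c.1 = j then 1 else 0) with hP
  have h1 := sum_cycle P
  have h2 := sum_cycle fun a b c => P b c a
  have h3 : ∑ b, ∑ a, ∑ c, (P a b c + P a b c - P b c a - P c a b) = 0 := by
    simp only [Finset.sum_sub_distrib, Finset.sum_add_distrib]
    linarith
  refine h3.symm.le.trans ?_
  refine Finset.sum_le_sum fun b _ => Finset.sum_le_sum fun a _ => Finset.sum_le_sum fun c _ => ?_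
  have hpos : 0 ≤ M a b c := sq_nonneg _
  have e1 : P b c a = M a b c / 4 * (if a.1 = j then 1 else 0) := by simp only [hP, ← hMc a b c]
  have e2 : P c a b = M a b c / 4 * (if b.1 = j then 1 else 0) := by
    simp only [hP, ← hMc b c a, ← hMc a b c]
  rw [e1, e2]
  change _ ≤ (if c.1 = j then M a b c / 2 else 0) + _
  by_cases hw : (Pi.single c.1 1 - Pi.single a.1 1 - Pi.single b.1 1 : Fin r → ℝ) = Pi.single j (-1)
  · have hab : a.1 = j ∨ b.1 = j := by
      by_contra! hne
      have := congrFun hw j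
      simp only [Pi.sub_apply, Pi.single_apply, hne.1.symm, hne.2.symm, if_false] at this
      split_ifs at this <;> norm_num at this
    rw [if_pos hw]
    simp only [hP]
    change _ ≤ _ + -(M a b c / 4)
    rcases hab with h | h <;> simp only [h, if_true] <;> split_ifs <;> nlinarith
  · rw [if_neg hw]
    simp only [hP]
    split_ifs <;> nlinarith

end Coefficients

end IsotropySplitting

end Soliton

end

/-! ### Consequences of irreducibility, inequivalence and connectedness -/

noncomputable section

namespace Soliton

namespace IsotropySplitting

section Representation

variable {E : Type*} [NormedAddCommGroup E] [NormedSpace ℝ E]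
  {G : Type*} [TopologicalSpace G] [ChartedSpace E G] [Group G]
  {F : Type*} [NormedAddCommGroup F] [NormedSpace ℝ F] {K : Subgroup G} [ChartedSpace F K]
  {r : ℕ} (D : IsotropySplitting E F K r)

/-- Under a trivial action every line is invariant, so irreducibility leaves just one line. -/
theorem finrank_eq_one_of_fixed {j : Fin r} (h : ∀ X ∈ D.p j, ∀ k ∈ K, Ad k X = X) : D.dim j = 1 := by
  obtain ⟨X, hX, hX0⟩ := (Submodule.ne_bot_iff _).1 (D.ne_bot j)
  have hle : Submodule.span ℝ {X} ≤ D.p j := by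
    rw [Submodule.span_singleton_le_iff_mem]; exact hX
  rcases D.irreducible j _ hle (by
    intro k hk Y hY
    rw [h Y (hle hY) k hk]
    exact hY) with h1 | h1
  · rw [Submodule.span_singleton_eq_bot] at h1
    exact absurd h1 hX0
  · rw [dim, ← h1]
    exact finrank_span_singleton hX0

theorem exists_eq_smul_of_dim_one {j : Fin r} (h : D.dim j = 1) {X : GroupLieAlgebra 𝓘(ℝ, E) G}
    (hX : X ∈ D.p j) (hX0 : X ≠ 0) {Y : GroupLieAlgebra 𝓘(ℝ, E) G} (hY : Y ∈ D.p j) :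
    ∃ c : ℝ, c • X = Y := by
  obtain ⟨c, hc⟩ := (finrank_eq_one_iff_of_nonzero' (⟨X, hX⟩ : D.p j) (by simpa using hX0)).1 h ⟨Y, hY⟩
  exact ⟨c, congrArg Subtype.val hc⟩

theorem eq_sum_totalFrame {j : Fin r} {Y : GroupLieAlgebra 𝓘(ℝ, E) G} (hY : Y ∈ D.p j) :
    ∃ v : Fin (Module.finrank ℝ (D.p j)) → ℝ, Y = ∑ a, v a • D.totalFrame ⟨j, a⟩ := by
  refine ⟨(D.frame j).repr ⟨Y, hY⟩, ?_⟩
  have hrepr := (D.frame j).sum_repr ⟨Y, hY⟩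
  conv_lhs => rw [show Y = ((⟨Y, hY⟩ : D.p j) : GroupLieAlgebra 𝓘(ℝ, E) G) from rfl, ← hrepr]
  simp only [Submodule.coe_sum, Submodule.coe_smul]
  rfl

theorem eq_zero_of_orthogonal_frame {j : Fin r} {Y : GroupLieAlgebra 𝓘(ℝ, E) G} (hY : Y ∈ D.p j)
    (h : ∀ a : D.FrameIndex, D.Q Y (D.totalFrame a) = 0) : Y = 0 := by
  by_contra hne
  have hpos := D.pos Y hne
  obtain ⟨v, hv⟩ := D.eq_sum_totalFrame hY
  have h3 : D.Q Y Y = 0 := by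
    nth_rewrite 2 [hv]
    simp [h]
  linarith

variable [LieGroup 𝓘(ℝ, E) ∞ G] [FiniteDimensional ℝ E] [LieGroup 𝓘(ℝ, F) ∞ K]
  (hK : ContMDiff 𝓘(ℝ, F) 𝓘(ℝ, E) ∞ (K.subtype : K → G)) (hconn : IsConnected (K : Set G))

include hK hconn in
-- The isotropy algebra acts on a line by skew scalars, which are zero; since `K` is connected, the
-- group then acts trivially.
theorem fixed_of_dim_one {j : Fin r} (h : D.dim j = 1) : ∀ X ∈ D.p j, ∀ k ∈ K, Ad k X = X := by
  intro X hX k hk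
  by_cases hX0 : X = 0
  · rw [hX0, map_zero]
  refine Ad_eq_self (F := F) hK hconn ?_ k hk
  intro Z hZ
  obtain ⟨c, hc⟩ := D.exists_eq_smul_of_dim_one h hX hX0 (bracketHom_mem hK (D.invariant j) hZ hX)
  have h1 := D.Q_bracketHom Z X X
  rw [← hc, map_smul, LinearMap.smul_apply, map_smul, smul_eq_mul] at h1
  have hpos := D.pos X hX0
  have hc0 : c = 0 := by
    have : c * D.Q X X = 0 := by linarith
    exact (mul_eq_zero.1 this).resolve_right hpos.ne'
  rw [← hc, hc0, zero_smul]

include hK hconn in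
-- Two one-dimensional summands would both be trivial representations, hence equivalent.
theorem dim_one_unique {i j : Fin r} (hi : D.dim i = 1) (hj : D.dim j = 1) : i = j := by
  by_contra hij
  have : FiniteDimensional ℝ (GroupLieAlgebra 𝓘(ℝ, E) G) := inferInstanceAs (FiniteDimensional ℝ E)
  apply D.inequivalent i j hij
  refine ⟨LinearEquiv.ofFinrankEq _ _ (hi.trans hj.symm), fun k hk X => ?_⟩
  rw [D.fixed_of_dim_one hK hconn hj _ (Subtype.coe_prop _) k hk]
  congr 2
  exact Subtype.ext (D.fixed_of_dim_one hK hconn hi _ X.2 k hk)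

include hK hconn in
-- Otherwise all brackets of 𝔭 with 𝔭_j have zero 𝔨-part. By invariance of `Q` the isotropy algebra
-- then annihilates 𝔭_j, so connected `K` acts trivially and the dimension is one.
theorem coeff_pos {j : Fin r} (hj : 2 ≤ D.dim j) : 0 < D.coeff (Pi.single j (-1)) := by
  by_contra! hcon
  have hsum := (D.verticalNorm_sum_le_coeff j).trans hcon
  have hnn : ∀ b a : D.FrameIndex, 0 ≤ if b.1 = j then D.verticalNorm a b else 0 := by
    intro b a
    split_ifs
    · exact D.verticalNorm_nonneg a b
    · exact le_rfl
  have hzero : ∀ (b a : D.FrameIndex), b.1 = j → D.verticalNorm a b = 0 := by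
    intro b a hb
    have h1 := (Finset.sum_eq_zero_iff_of_nonneg (fun b _ => Finset.sum_nonneg fun a _ => hnn b a)).1
      (le_antisymm hsum (Finset.sum_nonneg fun b _ => Finset.sum_nonneg fun a _ => hnn b a)) b
      (Finset.mem_univ _)
    have h2 := (Finset.sum_eq_zero_iff_of_nonneg (fun a _ => hnn b a)).1 h1 a (Finset.mem_univ _)
    rwa [if_pos hb] at h2
  have hvert : ∀ (b a : D.FrameIndex), b.1 = j →
      verticalBracket (bracketHom E G) D.Q D.totalFrame a b = 0 := by
    intro b a hb
    by_contra hne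
    exact (D.pos _ hne).ne' (hzero b a hb)
  have hbr : ∀ Z ∈ isotropyAlgebra E F K, ∀ b : D.FrameIndex, b.1 = j →
      bracketHom E G Z (D.totalFrame b) = 0 := by
    intro Z hZ b hb
    refine D.eq_zero_of_orthogonal_frame (j := b.1)
      (bracketHom_mem hK (D.invariant b.1) hZ (D.totalFrame_mem b)) fun a => ?_
    have h1 : bracketHom E G (D.totalFrame a) (D.totalFrame b) = ∑ c,
        D.Q (bracketHom E G (D.totalFrame a) (D.totalFrame b)) (D.totalFrame c) • D.totalFrame c := by
      have := hvert b a hb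
      rwa [verticalBracket, sub_eq_zero] at this
    rw [bracketHom_swap, map_neg, LinearMap.neg_apply, D.Q_bracketHom, neg_neg, bracketHom_swap,
      map_neg, h1, map_sum, neg_eq_zero]
    refine Finset.sum_eq_zero fun c _ => ?_
    rw [map_smul, D.symm Z, D.orthogonal_isotropy c.1 _ (D.totalFrame_mem c) Z hZ, smul_zero]
  have hfix : ∀ X ∈ D.p j, ∀ k ∈ K, Ad k X = X := by
    intro X hX k hk
    refine Ad_eq_self (F := F) hK hconn (fun Z hZ => ?_) k hk
    obtain ⟨v, h2⟩ := D.eq_sum_totalFrame hX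
    rw [h2, map_sum]
    refine Finset.sum_eq_zero fun a _ => ?_
    rw [map_smul, hbr Z hZ _ rfl, smul_zero]
  have := D.finrank_eq_one_of_fixed hfix
  omega

include hK hconn in
-- A vector of 𝔭_z is fixed by `K`, so the 𝔭_j-part of its adjoint action on 𝔭_j is a skew
-- equivariant map. It is nonzero by the hypothesis on the coefficient, hence injective by
-- irreducibility, and an invertible skew matrix has even size.
theorem even_dim {z j : Fin r} (hz : D.dim z = 1) (hzj : z ≠ j)
    (hA : D.coeff (Pi.single z 1 - Pi.single j 1 - Pi.single j 1) ≠ 0) : Even (D.dim j) := by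
  have hexists : ∃ (a b : Fin (Module.finrank ℝ (D.p j))) (c : D.FrameIndex), c.1 = z ∧
      D.structureConst ⟨j, a⟩ ⟨j, b⟩ c ≠ 0 := by
    by_contra! hcon
    apply hA
    rw [coeff_apply]
    have h3 : ∀ i : Fin r, (Pi.single i (-1) : Fin r → ℝ) ≠
        Pi.single z 1 - Pi.single j 1 - Pi.single j 1 := fun i =>
      single_ne_of_pos (k := z) (by simp [hzj])
    simp only [h3, if_false, Finset.sum_const_zero, zero_add]
    refine Finset.sum_eq_zero fun b _ => Finset.sum_eq_zero fun a _ => Finset.sum_eq_zero fun c _ => ?_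
    split_ifs with h
    · have hcz : c.1 = z := by
        by_contra hne
        have := congrFun h z
        simp only [Pi.sub_apply, Pi.single_apply, Ne.symm hne, hzj, if_false] at this
        split_ifs at this <;> norm_num at this
      have hj2 := congrFun h j
      have haj : a.1 = j := by
        by_contra hne
        simp only [Pi.sub_apply, Pi.single_apply, hcz, hzj.symm, Ne.symm hne, if_false] at hj2
        split_ifs at hj2 <;> norm_num at hj2
      have hbj : b.1 = j := by
        by_contra hne
        simp only [Pi.sub_apply, Pi.single_apply, hcz, hzj.symm, Ne.symm hne, if_false] at hj2
        split_ifs at hj2 <;> norm_num at hj2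
      obtain ⟨ja, a⟩ := a
      obtain ⟨jb, b⟩ := b
      obtain rfl : ja = j := haj
      obtain rfl : jb = ja := hbj
      rw [hcon a b c hcz]
      simp
    · rfl
  obtain ⟨a, b, c, hc, hne⟩ := hexists
  set X := D.totalFrame c with hXdef
  have hXfix : ∀ k ∈ K, Ad k X = X := fun k hk =>
    D.fixed_of_dim_one hK hconn hz X (hc ▸ D.totalFrame_mem c) k hk
  -- The kernel of the 𝔭_j-part of ad X on 𝔭_j.
  let U : Submodule ℝ (GroupLieAlgebra 𝓘(ℝ, E) G) :=
    { carrier := {Y | Y ∈ D.p j ∧ ∀ Y' ∈ D.p j, D.Q (bracketHom E G X Y) Y' = 0}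
      zero_mem' := ⟨zero_mem _, fun Y' _ => by simp⟩
      add_mem' := fun {Y Y'} h h' => ⟨add_mem h.1 h'.1, fun W hW => by
        simp [h.2 W hW, h'.2 W hW]⟩
      smul_mem' := fun c Y h => ⟨Submodule.smul_mem _ _ h.1, fun W hW => by simp [h.2 W hW]⟩ }
  have hUinv : ∀ k ∈ K, ∀ Y ∈ U, Ad k Y ∈ U := by
    intro k hk Y hY
    refine ⟨D.invariant j k hk Y hY.1, fun Y' hY' => ?_⟩
    have h1 : bracketHom E G X (Ad k Y) = Ad k (bracketHom E G X Y) := by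
      rw [Ad_bracketHom, hXfix k hk]
    have h2 : Y' = Ad k (Ad k⁻¹ Y') := by rw [← Ad_mul, mul_inv_cancel, Ad_one]
    rw [h1, h2, D.biinvariant]
    exact hY.2 _ (D.invariant j _ (K.inv_mem hk) Y' hY')
  have hUbot : U = ⊥ := by
    rcases D.irreducible j U (fun Y hY => hY.1) hUinv with h | h
    · exact h
    · exfalso
      have h1 : D.totalFrame ⟨j, a⟩ ∈ U := by rw [h]; exact D.totalFrame_mem ⟨j, a⟩
      have h2 := h1.2 _ (D.totalFrame_mem ⟨j, b⟩)
      apply hne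
      rw [D.structureConst_cycle, D.structureConst_cycle]
      exact h2
  let T : Matrix (Fin (Module.finrank ℝ (D.p j))) (Fin (Module.finrank ℝ (D.p j))) ℝ :=
    Matrix.of fun s t => D.Q (bracketHom E G X (D.totalFrame ⟨j, t⟩)) (D.totalFrame ⟨j, s⟩)
  have hT : T.transpose = -T := by
    ext s t
    simp only [T, Matrix.transpose_apply, Matrix.of_apply, Matrix.neg_apply]
    rw [D.Q_bracketHom, D.symm]
  have hdet : T.det ≠ 0 := by
    intro h0
    obtain ⟨v, hv, hTv⟩ := Matrix.exists_mulVec_eq_zero_iff.2 h0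
    set Y : GroupLieAlgebra 𝓘(ℝ, E) G := ∑ t, v t • D.totalFrame ⟨j, t⟩ with hY
    have hYU : Y ∈ U := by
      have hYj : Y ∈ D.p j := Submodule.sum_mem _ fun t _ => Submodule.smul_mem _ _ (D.totalFrame_mem ⟨j, t⟩)
      refine ⟨hYj, fun Y' hY' => ?_⟩
      have h1 : ∀ s, D.Q (bracketHom E G X Y) (D.totalFrame ⟨j, s⟩) = 0 := by
        intro s
        have := congrFun hTv s
        simp only [Matrix.mulVec, dotProduct, T, Matrix.of_apply, Pi.zero_apply] at this
        rw [hY, map_sum, map_sum, LinearMap.sum_apply, ← this]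
        refine Finset.sum_congr rfl fun t _ => ?_
        simp [mul_comm]
      obtain ⟨v', h2⟩ := D.eq_sum_totalFrame hY'
      rw [h2, map_sum]
      refine Finset.sum_eq_zero fun s _ => ?_
      rw [map_smul, h1, smul_zero]
    rw [hUbot, Submodule.mem_bot] at hYU
    apply hv
    ext s
    have h3 : D.Q Y (D.totalFrame ⟨j, s⟩) = v s := by
      simp [hY, map_sum, LinearMap.sum_apply, D.totalFrame_orthonormal]
    rw [← h3, hYU]
    simp
  by_contra hodd
  rw [Nat.not_even_iff_odd, dim] at hodd
  have h1 := congrArg Matrix.det hT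
  rw [Matrix.det_transpose, Matrix.det_neg, Fintype.card_fin, hodd.neg_one_pow] at h1
  apply hdet
  linarith

end Representation

end IsotropySplitting

end Soliton

end

/-! ### The superpotential equation as equations between coefficients -/

noncomputable section

namespace Soliton

section SuperpotentialEquation

variable {r : ℕ}

/-- The form `J` as a bilinear map. -/
def JHom (d : Fin r → ℕ) : Ext r →ₗ[ℝ] Ext r →ₗ[ℝ] ℝ :=
  LinearMap.mk₂ ℝ (J d)
    (fun p p' q => by
      simp only [J, Prod.fst_add, Prod.snd_add, Pi.add_apply, add_mul, add_div, mul_add,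
        Finset.sum_add_distrib]
      ring)
    (fun c p q => by
      simp only [J, Prod.smul_fst, Prod.smul_snd, Pi.smul_apply, smul_eq_mul, mul_assoc, mul_div_assoc,
        ← Finset.mul_sum]
      ring)
    (fun p p' q => by
      simp only [J, Prod.fst_add, Prod.snd_add, Pi.add_apply, add_mul, add_div, mul_add,
        Finset.sum_add_distrib]
      ring)
    (fun c p q => by
      have h : ∀ i, p.1 i * (c * q.1 i) / (d i : ℝ) = c * (p.1 i * q.1 i / d i) := fun i => by ring
      simp only [J, Prod.smul_fst, Prod.smul_snd, Pi.smul_apply, smul_eq_mul, h, ← Finset.mul_sum]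
      ring)

theorem JHom_apply (d : Fin r → ℕ) (p q : Ext r) : JHom d p q = J d p q := rfl

theorem J_comm (d : Fin r → ℕ) (p q : Ext r) : J d p q = J d q p := by
  simp only [J, mul_comm]
  ring

/-- The pairing `dot c` as a continuous linear map. -/
def dotCLM (c : Ext r) : Ext r →L[ℝ] ℝ :=
  LinearMap.toContinuousLinearMap
    { toFun := dot c
      map_add' := fun x y => by simp [dot, mul_add, Finset.sum_add_distrib]; ring
      map_smul' := fun a x => by
        simp only [dot, Prod.smul_fst, Prod.smul_snd, Pi.smul_apply, smul_eq_mul, mul_left_comm _ a,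
          ← Finset.mul_sum, RingHom.id_apply, mul_add] }

theorem dotCLM_apply (c x : Ext r) : dotCLM c x = dot c x := rfl

theorem dot_add_left (c c' x : Ext r) : dot (c + c') x = dot c x + dot c' x := by
  simp only [dot, Prod.fst_add, Prod.snd_add, Pi.add_apply, add_mul, Finset.sum_add_distrib]
  ring

theorem hasFDerivAt_expSum (f : Ext r →₀ ℝ) (x : Ext r) :
    HasFDerivAt (expSum f) (∑ c ∈ f.support, (f c * Real.exp (dot c x)) • dotCLM c) x := by
  have h : ∀ c ∈ f.support, HasFDerivAt (fun x => f c * Real.exp (dot c x))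
      ((f c * Real.exp (dot c x)) • dotCLM c) x := by
    intro c _
    have := ((dotCLM c).hasFDerivAt (x := x)).exp.const_mul (f c)
    simpa [dotCLM_apply, smul_smul] using this
  exact HasFDerivAt.fun_sum h

theorem grad_expSum (f : Ext r →₀ ℝ) (x : Ext r) :
    grad (expSum f) x = ∑ c ∈ f.support, (f c * Real.exp (dot c x)) • c := by
  have h := (hasFDerivAt_expSum f x).fderiv
  refine Prod.ext (funext fun i => ?_) ?_
  · simp [grad, h, dotCLM_apply, dot, Prod.fst_sum, Finset.sum_apply, Pi.single_apply]
  · simp [grad, h, dotCLM_apply, dot, Prod.snd_sum]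

/-- The exponential coefficients of `J(∇f, ∇f)` for `f = expSum f`. -/
def squareCoeff (d : Fin r → ℕ) (f : Ext r →₀ ℝ) : Ext r →₀ ℝ :=
  ∑ c ∈ f.support, ∑ c' ∈ f.support, Finsupp.single (c + c') (f c * f c' * J d c c')

theorem expSum_squareCoeff (d : Fin r → ℕ) (f : Ext r →₀ ℝ) (x : Ext r) :
    expSum (squareCoeff d f) x = J d (grad (expSum f) x) (grad (expSum f) x) := by
  rw [grad_expSum, ← JHom_apply]
  simp only [map_sum, LinearMap.sum_apply, map_smul, LinearMap.smul_apply, squareCoeff, expSum_sum,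
    expSum_single, dot_add_left, Real.exp_add, smul_eq_mul, JHom_apply]
  rw [Finset.sum_comm]
  refine Finset.sum_congr rfl fun c _ => ?_
  rw [Finset.mul_sum]
  refine Finset.sum_congr rfl fun c' _ => ?_
  ring

theorem squareCoeff_apply (d : Fin r → ℕ) (f : Ext r →₀ ℝ) (b : Ext r) :
    squareCoeff d f b = ∑ c ∈ f.support, f c * f (b - c) * J d c (b - c) := by
  simp only [squareCoeff, Finsupp.finsetSum_apply, Finsupp.single_apply]
  refine Finset.sum_congr rfl fun c _ => ?_
  have h : ∀ c', (c + c' = b) ↔ (c' = b - c) := fun c' => by rw [eq_sub_iff_add_eq']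
  simp only [h, Finset.sum_ite_eq', Finsupp.mem_support_iff]
  split_ifs with h0
  · rfl
  · rw [not_not] at h0
    simp [h0]

/-- The exponential coefficients of `e^{d·q} (E + S)`. -/
def targetCoeff (d : Fin r → ℕ) (A : (Fin r → ℝ) →₀ ℝ) (E : ℝ) : Ext r →₀ ℝ :=
  Finsupp.single (extDim d) E + ∑ w ∈ A.support, Finsupp.single (extDim d + (w, 0)) (A w)

theorem expSum_targetCoeff (d : Fin r → ℕ) (A : (Fin r → ℝ) →₀ ℝ) (E : ℝ) (x : Ext r) :
    expSum (targetCoeff d A E) x = Real.exp (dot (extDim d) x) * (E + weightSum A x.1) := by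
  simp only [targetCoeff, expSum_add, expSum_sum, expSum_single, dot_add_left, Real.exp_add, weightSum,
    Finsupp.sum, mul_add, Finset.mul_sum]
  congr 1
  · ring
  · refine Finset.sum_congr rfl fun w _ => ?_
    simp [dot]
    ring

theorem targetCoeff_apply (d : Fin r → ℕ) (A : (Fin r → ℝ) →₀ ℝ) (E : ℝ) (b : Ext r) :
    targetCoeff d A E b = (if b = extDim d then E else 0) +
      if b.2 = -2 then A (b.1 - (extDim d).1) else 0 := by
  simp only [targetCoeff, Finsupp.add_apply, Finsupp.finsetSum_apply, Finsupp.single_apply]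
  congr 1
  · simp only [eq_comm]
  · by_cases h2 : b.2 = -2
    · have h : ∀ w, (extDim d + (w, 0) = b) ↔ (w = b.1 - (extDim d).1) := by
        intro w
        rw [eq_sub_iff_add_eq', Prod.ext_iff]
        simp [extDim, h2]
      simp only [h, h2, if_true, Finset.sum_ite_eq', Finsupp.mem_support_iff]
      split_ifs with h0
      · rfl
      · rw [not_not] at h0
        exact h0.symm
    · rw [if_neg h2]
      refine Finset.sum_eq_zero fun w _ => if_neg fun h => h2 ?_
      rw [← h]
      simp [extDim]

/-- Clearing the factors exp(∓ d·x/2) from the Hamiltonian leaves an identity of exponential sums,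
which holds exactly when all coefficients agree. -/
theorem isSuperpotential_iff (d : Fin r → ℕ) (A : (Fin r → ℝ) →₀ ℝ) {S : (Fin r → ℝ) → ℝ}
    (hS : ∀ q, S q = weightSum A q) (E : ℝ) (f : Ext r →₀ ℝ) :
    IsSuperpotential d S E (expSum f) ↔
      ∀ b, ∑ c ∈ f.support, f c * f (b - c) * J d c (b - c) = targetCoeff d A E b := by
  have hdiff : Differentiable ℝ (expSum f) := fun x => (hasFDerivAt_expSum f x).differentiableAt
  have hham : ∀ x, hamiltonian d S 0 E (grad (expSum f) x) x = 0 ↔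
      expSum (squareCoeff d f) x = expSum (targetCoeff d A E) x := by
    intro x
    rw [expSum_squareCoeff, expSum_targetCoeff, hamiltonian, hS]
    have h1 : Real.exp (dot (extDim d) x) =
        Real.exp (dot (extDim d) x / 2) * Real.exp (dot (extDim d) x / 2) := by
      rw [← Real.exp_add]; ring_nf
    have h2 : Real.exp (-(dot (extDim d) x) / 2) * Real.exp (dot (extDim d) x / 2) = 1 := by
      rw [← Real.exp_add]; ring_nf; simp
    have h3 := Real.exp_pos (dot (extDim d) x / 2)
    rw [h1]
    constructor
    · intro h
      linear_combination (Real.exp (dot (extDim d) x / 2)) * h -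
        J d (grad (expSum f) x) (grad (expSum f) x) * h2
    · intro h
      rw [h]
      linear_combination (Real.exp (dot (extDim d) x / 2) * (E + weightSum A x.1)) * h2
  constructor
  · rintro ⟨-, h⟩ b
    rw [← squareCoeff_apply]
    exact DFunLike.congr_fun (expSum_injective (funext fun x => (hham x).1 (h x))) b
  · intro h
    refine ⟨hdiff, fun x => (hham x).2 ?_⟩
    have : squareCoeff d f = targetCoeff d A E := by
      ext b
      rw [squareCoeff_apply, h]
    rw [this]

end SuperpotentialEquation

end Soliton

end

/-! ### Extremal arguments for finite sets with the splitting property -/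

noncomputable section

namespace Soliton

section Extremal

variable {V : Type*} [AddCommGroup V]

/-- `C` has the splitting property for the form `Q` and the set `P` of prescribed exponents if a sum
of two elements of `C` not `Q`-orthogonal is either prescribed or can be written differently. -/
def Splitting (C : Finset V) (Q : V → V → ℝ) (P : V → Prop) : Prop :=
  ∀ a ∈ C, ∀ b ∈ C, Q a b ≠ 0 → ¬ P (a + b) → ∃ x ∈ C, ∃ y ∈ C, x + y = a + b ∧ x ≠ a ∧ x ≠ b

/-- If `a + b` had no other decomposition, its coefficient would be 2 f(a) f(b) Q(a, b), or f(a)²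
Q(a, a) when a = b, and could not be zero. -/
theorem splitting_of_sum {C : Finset V} {Q : V → V → ℝ} {P : V → Prop} (f : V → ℝ)
    (hf : ∀ c, f c ≠ 0 ↔ c ∈ C) (hQ : ∀ a b, Q a b = Q b a)
    (h : ∀ v, ¬ P v → ∑ c ∈ C, f c * f (v - c) * Q c (v - c) = 0) : Splitting C Q P := by
  classical
  intro a ha b hb hab hP
  by_contra hno
  push Not at hno
  have hsum := h _ hP
  have hzero : ∀ c ∈ C, c ∉ ({a, b} : Finset V) → f c * f (a + b - c) * Q c (a + b - c) = 0 := by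
    intro c hc hcab
    simp only [Finset.mem_insert, Finset.mem_singleton, not_or] at hcab
    have : a + b - c ∉ C := fun h' => hcab.2 (hno c hc _ h' (by abel) hcab.1)
    rw [not_ne_iff.1 (mt (hf _).1 this)]
    ring
  have hsub : ({a, b} : Finset V) ⊆ C := by
    intro x hx
    simp only [Finset.mem_insert, Finset.mem_singleton] at hx
    rcases hx with rfl | rfl <;> assumption
  rw [← Finset.sum_subset hsub hzero] at hsum
  have hfa := (hf a).2 ha
  have hfb := (hf b).2 hb
  by_cases hne : a = b
  · subst hne
    simp [hfa, hab] at hsum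
  · rw [Finset.sum_pair hne, add_sub_cancel_left, add_sub_cancel_right, hQ b a] at hsum
    have : 2 * (f a * f b * Q a b) = 0 := by linarith
    simp [hfa, hfb, hab] at this

variable [Module ℝ V]

/-- Equality case of the parallelogram law for elements of maximal norm. -/
theorem eq_of_add_eq_two {ip : V →ₗ[ℝ] V →ₗ[ℝ] ℝ} (hs : ∀ x y, ip x y = ip y x) {a x y : V}
    (hx : ip x x ≤ ip a a) (hy : ip y y ≤ ip a a) (hp : x ≠ y → 0 < ip (x - y) (x - y))
    (hxy : x + y = a + a) : x = a := by
  have key : ip (x - y) (x - y) = 2 * ip x x + 2 * ip y y - ip (x + y) (x + y) := by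
    simp only [map_sub, map_add, LinearMap.sub_apply, LinearMap.add_apply, hs y x]
    ring
  have h2 : ip (x + y) (x + y) = 4 * ip a a := by
    rw [hxy]
    simp only [map_add, LinearMap.add_apply]
    ring
  have hxy' : x = y := by
    by_contra hne
    have := hp hne
    linarith
  subst hxy'
  have : (2 : ℝ) • x = (2 : ℝ) • a := by rw [two_smul, two_smul, hxy]
  exact smul_right_injective V two_ne_zero this

/-- A finite nonempty set closed under splitting is a single vector of square norm `τ`. -/
theorem exists_eq_singleton_of_split {ip : V →ₗ[ℝ] V →ₗ[ℝ] ℝ} (hs : ∀ x y, ip x y = ip y x)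
    {T : Finset V} (hT : T.Nonempty) (hp : ∀ x ∈ T, ∀ y ∈ T, x ≠ y → 0 < ip (x - y) (x - y))
    {τ : ℝ} (h : ∀ a ∈ T, ∀ b ∈ T, ip a b ≠ τ → ∃ x ∈ T, ∃ y ∈ T, x + y = a + b ∧ x ≠ a ∧ x ≠ b) :
    ∃ a ∈ T, ip a a = τ ∧ ∀ b ∈ T, b = a := by
  classical
  obtain ⟨a, ha, hmax⟩ := T.exists_max_image (fun x => ip x x) hT
  -- By the parallelogram law an element of maximal norm is not the midpoint of two others.
  have haτ : ip a a = τ := by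
    by_contra hne
    obtain ⟨x, hx, y, hy, hxy, hxa, -⟩ := h a ha a ha hne
    exact hxa (eq_of_add_eq_two hs (hmax x hx) (hmax y hy) (hp x hx y hy) hxy)
  refine ⟨a, ha, haτ, ?_⟩
  by_contra! hb
  have hne : (T.erase a).Nonempty := by
    obtain ⟨b, hb, hba⟩ := hb
    exact ⟨b, Finset.mem_erase.2 ⟨hba, hb⟩⟩
  -- Among the rest, `b` has the largest product with `a`. A second decomposition of a + b would
  -- have two such products adding up to τ + ⟨a, b⟩ > 2⟨a, b⟩.
  obtain ⟨b, hb, hbmax⟩ := (T.erase a).exists_max_image (fun x => ip a x) hne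
  obtain ⟨hba, hbT⟩ := Finset.mem_erase.1 hb
  have hlt : ip a b < τ := by
    have h1 := hp b hbT a ha hba
    have h2 := hmax b hbT
    simp only [map_sub, LinearMap.sub_apply, hs b a] at h1
    linarith
  obtain ⟨x, hx, y, hy, hxy, hxa, hxb⟩ := h a ha b hbT hlt.ne
  have hya : y ≠ a := by
    rintro rfl
    exact hxb (add_right_cancel (hxy.trans (add_comm _ _)))
  have h1 := hbmax x (Finset.mem_erase.2 ⟨hxa, hx⟩)
  have h2 := hbmax y (Finset.mem_erase.2 ⟨hya, hy⟩)
  have h3 : ip a x + ip a y = ip a a + ip a b := by rw [← map_add, hxy, map_add]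
  linarith

/-- The top face, for a linear functional `l`, of a set with the splitting property, when the
prescribed exponents lie below twice its level: it is a single null vector, and it is orthogonal to
all elements of the set that are high enough. -/
theorem exists_unique_top {ip : V →ₗ[ℝ] V →ₗ[ℝ] ℝ} (hs : ∀ x y, ip x y = ip y x) {C : Finset V}
    {Q : V → V → ℝ} {P : V → Prop} (hQ : ∀ a b c x y, x + y = b + c → Q a x + Q a y = Q a b + Q a c)
    (hsplit : Splitting C Q P) (l : V →ₗ[ℝ] ℝ) {t : ℝ} (hP : ∀ v, P v → l v ≤ t) {c₁ : V}
    (hc₁ : c₁ ∈ C) (hmax : ∀ c ∈ C, l c ≤ l c₁) (htop : t < 2 * l c₁) {κ : ℝ}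
    (hface : ∀ a ∈ C, ∀ b ∈ C, l a = l c₁ → l b = l c₁ →
      Q a b = κ - ip a b ∧ (a ≠ b → 0 < ip (a - b) (a - b))) :
    Q c₁ c₁ = 0 ∧ (∀ c ∈ C, l c = l c₁ → c = c₁) ∧ ∀ c ∈ C, t - l c₁ < l c → Q c₁ c = 0 := by
  classical
  obtain ⟨a, ha, haκ, hau⟩ : ∃ a ∈ C.filter (fun c => l c = l c₁), ip a a = κ ∧
      ∀ b ∈ C.filter (fun c => l c = l c₁), b = a := by
    refine exists_eq_singleton_of_split hs ⟨c₁, by simp [hc₁]⟩ ?_ ?_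
    · intro x hx y hy
      simp only [Finset.mem_filter] at hx hy
      exact (hface x hx.1 y hy.1 hx.2 hy.2).2
    · intro x hx y hy hne
      simp only [Finset.mem_filter] at hx hy
      have h1 := (hface x hx.1 y hy.1 hx.2 hy.2).1
      obtain ⟨u, hu, v, hv, huv, hua, hub⟩ := hsplit x hx.1 y hy.1
        (by rw [h1]; exact sub_ne_zero.2 (Ne.symm hne))
        (fun h => by
          have := hP _ h
          rw [map_add] at this
          linarith [hx.2, hy.2])
      have hl : l u + l v = l c₁ + l c₁ := by rw [← map_add, huv, map_add, hx.2, hy.2]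
      have := hmax u hu
      have := hmax v hv
      refine ⟨u, ?_, v, ?_, huv, hua, hub⟩ <;> simp only [Finset.mem_filter]
      · exact ⟨hu, by linarith⟩
      · exact ⟨hv, by linarith⟩
  have hac : c₁ = a := hau c₁ (by simp [hc₁])
  subst hac
  have hnull : Q c₁ c₁ = 0 := by
    rw [(hface c₁ hc₁ c₁ hc₁ rfl rfl).1, haκ, sub_self]
  have huniq : ∀ c ∈ C, l c = l c₁ → c = c₁ := fun c hc h => hau c (by simp [hc, h])
  refine ⟨hnull, huniq, ?_⟩
  by_contra! hbad
  have hne : (C.filter (fun c => t - l c₁ < l c ∧ Q c₁ c ≠ 0)).Nonempty := by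
    obtain ⟨c, hc, h1, h2⟩ := hbad
    exact ⟨c, by simp [hc, h1, h2]⟩
  -- The highest offender. In another decomposition x + y = c₁ + c both parts lie strictly below
  -- `c₁`, hence strictly above `c`, so both are orthogonal to `c₁`; additivity and nullity of `c₁`
  -- contradict Q(c₁, c) ≠ 0.
  obtain ⟨c, hc, hcmax⟩ := Finset.exists_max_image _ l hne
  simp only [Finset.mem_filter] at hc hcmax
  obtain ⟨hc, hlc, hQc⟩ := hc
  obtain ⟨x, hx, y, hy, hxy, hxa, hxc⟩ := hsplit c₁ hc₁ c hc hQc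
    (fun h => by
      have := hP _ h
      rw [map_add] at this
      linarith)
  have hya : y ≠ c₁ := by
    rintro rfl
    exact hxc (add_right_cancel (hxy.trans (add_comm _ _)))
  have hl : l x + l y = l c₁ + l c := by rw [← map_add, hxy, map_add]
  have hxl : l x < l c₁ := lt_of_le_of_ne (hmax x hx) fun h => hxa (huniq x hx h)
  have hyl : l y < l c₁ := lt_of_le_of_ne (hmax y hy) fun h => hya (huniq y hy h)
  have hx0 : Q c₁ x = 0 := by
    by_contra h
    have := hcmax x ⟨hx, by linarith, h⟩
    linarith
  have hy0 : Q c₁ y = 0 := by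
    by_contra h
    have := hcmax y ⟨hy, by linarith, h⟩
    linarith
  have := hQ c₁ c₁ c x y hxy
  rw [hx0, hy0, hnull] at this
  exact hQc (by linarith)

end Extremal

/-! ### The inner product weighted by the inverse dimensions -/

section DimForm

variable {r : ℕ}

/-- The inner product `⟨a, b⟩ = ∑ aᵢ bᵢ / dᵢ`. -/
def dimForm (d : Fin r → ℕ) : (Fin r → ℝ) →ₗ[ℝ] (Fin r → ℝ) →ₗ[ℝ] ℝ :=
  LinearMap.mk₂ ℝ (fun a b => ∑ i, a i * b i / (d i : ℝ))
    (fun a a' b => by simp only [Pi.add_apply, add_mul, add_div, Finset.sum_add_distrib])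
    (fun c a b => by
      simp only [Pi.smul_apply, smul_eq_mul, mul_assoc, mul_div_assoc, ← Finset.mul_sum])
    (fun a b b' => by simp only [Pi.add_apply, mul_add, add_div, Finset.sum_add_distrib])
    (fun c a b => by
      simp only [Pi.smul_apply, smul_eq_mul, Finset.mul_sum]
      exact Finset.sum_congr rfl fun i _ => by ring)

theorem dimForm_apply (d : Fin r → ℕ) (a b : Fin r → ℝ) :
    dimForm d a b = ∑ i, a i * b i / (d i : ℝ) := rfl

theorem dimForm_comm (d : Fin r → ℕ) (a b : Fin r → ℝ) : dimForm d a b = dimForm d b a := by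
  simp only [dimForm_apply, mul_comm]

theorem dimForm_single (d : Fin r → ℕ) (a : Fin r → ℝ) (i : Fin r) (x : ℝ) :
    dimForm d a (Pi.single i x) = a i * x / d i := by
  rw [dimForm_apply, Finset.sum_eq_single i (fun j _ hj => by simp [hj]) (by simp)]
  simp

theorem le_dimForm_self (d : Fin r → ℕ) (a : Fin r → ℝ) (i : Fin r) :
    a i ^ 2 / d i ≤ dimForm d a a := by
  rw [dimForm_apply, sq]
  exact Finset.single_le_sum (f := fun i => a i * a i / (d i : ℝ))
    (fun j _ => div_nonneg (mul_self_nonneg _) (Nat.cast_nonneg _)) (Finset.mem_univ i)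

theorem dimForm_self_nonneg (d : Fin r → ℕ) (a : Fin r → ℝ) : 0 ≤ dimForm d a a :=
  (dimForm_apply d a a).symm ▸
    Finset.sum_nonneg fun _ _ => div_nonneg (mul_self_nonneg _) (Nat.cast_nonneg _)

theorem eq_zero_of_dimForm_self {d : Fin r → ℕ} (hd : ∀ i, 1 ≤ d i) {a : Fin r → ℝ}
    (h : dimForm d a a ≤ 0) : a = 0 := by
  funext i
  have hi := (le_dimForm_self d a i).trans h
  have hpos : (0 : ℝ) < d i := by exact_mod_cast hd i
  rw [div_le_iff₀ hpos, zero_mul] at hi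
  exact pow_eq_zero_iff two_ne_zero |>.1 (le_antisymm hi (sq_nonneg _))

theorem dimForm_self_pos {d : Fin r → ℕ} (hd : ∀ i, 1 ≤ d i) {a : Fin r → ℝ} (h : a ≠ 0) :
    0 < dimForm d a a := by
  by_contra h'
  exact h (eq_zero_of_dimForm_self hd (not_lt.1 h'))

end DimForm

end Soliton

end

/-! ### The exponents lie in the hyperplane u = -1 -/

noncomputable section

namespace Soliton

section Level

variable {r : ℕ} {d : Fin r → ℕ}

/-- The component of `c` that is `J`-orthogonal to `extDim d`. -/
def centre (d : Fin r → ℕ) : Ext r →ₗ[ℝ] (Fin r → ℝ) :=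
  LinearMap.fst ℝ _ _ + ((1 / 2 : ℝ) • LinearMap.snd ℝ _ _).smulRight fun i => (d i : ℝ)

theorem centre_apply (c : Ext r) (i : Fin r) : centre d c i = c.1 i + c.2 / 2 * d i := by
  simp only [centre, LinearMap.add_apply, Pi.add_apply, LinearMap.fst_apply,
    LinearMap.smulRight_apply, LinearMap.smul_apply, LinearMap.snd_apply, Pi.smul_apply, smul_eq_mul]
  ring

theorem centre_extDim : centre d (extDim d) = 0 := by
  funext i
  rw [centre_apply]
  simp [extDim]

/-- Completing the square along 𝐝 exhibits the Lorentzian signature: the level is the timelike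
coordinate and `centre` the spacelike part, which vanishes at 𝐝. -/
theorem J_eq_centre (hd : ∀ i, 1 ≤ d i) (c c' : Ext r) :
    J d c c' = c.2 * c'.2 / 4 - dimForm d (centre d c) (centre d c') := by
  have h : ∀ i, centre d c i * centre d c' i / (d i : ℝ) = c.1 i * c'.1 i / d i
      + c.2 / 2 * c'.1 i + c'.2 / 2 * c.1 i + c.2 * c'.2 / 4 * d i := by
    intro i
    have : (d i : ℝ) ≠ 0 := by exact_mod_cast (Nat.one_le_iff_ne_zero.1 (hd i))
    rw [centre_apply, centre_apply]
    field_simp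
    ring
  simp only [J, dimForm_apply, h, Finset.sum_add_distrib, ← Finset.mul_sum]
  ring

theorem eq_of_centre_eq {c c' : Ext r} (h : centre d c = centre d c') (h2 : c.2 = c'.2) :
    c = c' := by
  refine Prod.ext (funext fun i => ?_) h2
  have := congrFun h i
  rw [centre_apply, centre_apply, h2] at this
  linarith

/-- `exists_unique_top` for the level, upwards (ε = 1) or downwards (ε = -1). The extreme exponent
is null but not orthogonal to 𝐝, so it must take part in any decomposition of 𝐝. -/
theorem exists_extreme (hd : ∀ i, 1 ≤ d i) {C : Finset (Ext r)} (h0 : 0 ∉ C) {P : Ext r → Prop}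
    (hsplit : Splitting C (J d) P) (hP : ∀ v, P v → v.2 = -2)
    (hE : ∃ x ∈ C, ∃ y ∈ C, x + y = extDim d) {ε : ℝ} (h : ∃ c ∈ C, -ε < ε * c.2) :
    ∃ a ∈ C, -ε < ε * a.2 ∧ (∀ c ∈ C, ε * c.2 ≤ ε * a.2) ∧ (∀ c ∈ C, c.2 = a.2 → c = a) ∧
      J d a a = 0 ∧ extDim d - a ∈ C := by
  obtain ⟨c, hc, hlc⟩ := h
  have hε : ε ≠ 0 := by
    rintro rfl
    simp at hlc
  obtain ⟨a, ha, hmax⟩ := C.exists_max_image (fun c => ε * c.2) ⟨c, hc⟩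
  have hla : -ε < ε * a.2 := hlc.trans_le (hmax c hc)
  obtain ⟨hnull, huniq, horth⟩ := exists_unique_top
    (ip := (dimForm d).compl₁₂ (centre d) (centre d)) (fun x y => dimForm_comm d _ _)
    (Q := J d) (fun a b c x y hxy => by
      rw [← JHom_apply, ← JHom_apply, ← JHom_apply, ← JHom_apply, ← map_add, hxy, map_add])
    hsplit (ε • LinearMap.snd ℝ _ _) (t := -2 * ε)
    (fun v hv => by simp [hP v hv]; linarith) ha
    (fun c hc => by simpa using hmax c hc) (by simp; linarith) (κ := a.2 * a.2 / 4)
    (fun x hx y hy hxa hya => by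
      have hx2 : x.2 = a.2 := by simpa [hε] using hxa
      have hy2 : y.2 = a.2 := by simpa [hε] using hya
      refine ⟨by rw [J_eq_centre hd, hx2, hy2]; rfl, fun hne => ?_⟩
      rw [LinearMap.compl₁₂_apply]
      refine dimForm_self_pos hd fun h => hne (eq_of_centre_eq (d := d) ?_ (hx2.trans hy2.symm))
      rwa [map_sub, sub_eq_zero] at h)
  have ha2 : a.2 ≠ 0 := by
    intro ha2
    rw [J_eq_centre hd, ha2] at hnull
    have : centre d a = 0 := eq_zero_of_dimForm_self hd (by linarith)
    have : a = 0 := eq_of_centre_eq (d := d) (by rw [this, map_zero]) (by rw [ha2]; rfl)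
    exact h0 (this ▸ ha)
  refine ⟨a, ha, hla, hmax, fun c hc h => huniq c hc (by simp [h]), hnull, ?_⟩
  obtain ⟨x, hx, y, hy, hxy⟩ := hE
  have hD : J d a x + J d a y ≠ 0 := by
    rw [← JHom_apply, ← JHom_apply, ← map_add, hxy, JHom_apply, J_eq_centre hd, centre_extDim,
      map_zero]
    simpa [extDim] using ha2
  have hl : ε * x.2 + ε * y.2 = -2 * ε := by
    rw [← mul_add, ← Prod.snd_add, hxy]
    simp [extDim]
    ring
  have hx' := hmax x hx
  have hy' := hmax y hy
  -- A summand not orthogonal to `a` cannot lie inside the orthogonality range, so its partner is at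
  -- the extreme level and equals `a`.
  have hside : ∀ u ∈ C, ∀ v ∈ C, u + v = extDim d → ε * u.2 + ε * v.2 = -2 * ε → J d a u ≠ 0 →
      extDim d - a ∈ C := by
    intro u hu v hv huv hl' hne
    have h1 : ¬ (-2 * ε - ε * a.2 < ε * u.2) := fun h => hne (horth u hu (by simpa using h))
    have h2 := hmax v hv
    have : v = a := huniq v hv (by
      change ε * v.2 = ε * a.2
      linarith)
    rw [← huv, this, add_sub_cancel_right]
    exact hu
  by_cases hx0 : J d a x = 0
  · exact hside y hy x hx (by rw [add_comm, hxy]) (by linarith) fun h => hD (by rw [hx0, h, add_zero])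
  · exact hside x hx y hy hxy hl hx0

/-- All exponents of a superpotential lie in the hyperplane through `½ extDim d`. -/
theorem snd_eq_neg_one (hd : ∀ i, 1 ≤ d i) {C : Finset (Ext r)} (h0 : 0 ∉ C) {P : Ext r → Prop}
    (hsplit : Splitting C (J d) P) (hP : ∀ v, P v → v.2 = -2)
    (hE : ∃ x ∈ C, ∃ y ∈ C, x + y = extDim d) : ∀ c ∈ C, c.2 = -1 := by
  have hbelow : ∀ c ∈ C, -1 ≤ c.2 := by
    by_contra! h
    obtain ⟨c, hc, hlt⟩ := h
    obtain ⟨a, ha, hla, hmax, -, hnull, hDa⟩ :=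
      exists_extreme hd h0 hsplit hP hE (ε := -1) ⟨c, hc, by linarith⟩
    have h2 : (extDim d - a).2 = -2 - a.2 := by simp [extDim]
    obtain ⟨b, hb, hlb, hmax', huniq, hnull', hDb⟩ :=
      exists_extreme hd h0 hsplit hP hE (ε := 1) ⟨_, hDa, by rw [h2]; linarith⟩
    have h3 : (extDim d - b).2 = -2 - b.2 := by simp [extDim]
    have h4 := hmax _ hDb
    have h5 := hmax' _ hDa
    rw [h3] at h4
    rw [h2] at h5
    have hb2 : b.2 = -2 - a.2 := by linarith
    have hab := huniq _ hDa (by rw [h2, hb2])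
    -- `a` and 𝐝 - a are both null and have opposite centres, so their levels satisfy a.2² = (2 +
    -- a.2)²; this gives a.2 = -1, against a.2 < -1.
    rw [J_eq_centre hd] at hnull hnull'
    rw [← hab, map_sub, centre_extDim, zero_sub, map_neg, map_neg, LinearMap.neg_apply, h2] at hnull'
    nlinarith
  intro c hc
  refine le_antisymm ?_ (hbelow c hc)
  by_contra! hlt
  obtain ⟨a, ha, hla, -, -, -, hDa⟩ :=
      exists_extreme hd h0 hsplit hP hE (ε := 1) ⟨c, hc, by linarith⟩
  have := hbelow _ hDa
  simp [extDim] at this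
  linarith

end Level

end Soliton

end

/-! ### Arrangements, and their top and bottom faces for the coordinate sum -/

noncomputable section

namespace Soliton

section Arrangement

variable {r : ℕ}

/-- The sum of the coordinates. -/
def total : (Fin r → ℝ) →ₗ[ℝ] ℝ := ∑ i, LinearMap.proj i

theorem total_apply (a : Fin r → ℝ) : total a = ∑ i, a i := by
  simp [total]

theorem total_single (i : Fin r) (x : ℝ) : total (Pi.single i x) = x := by
  rw [total_apply, Finset.sum_pi_single']
  simp

/-- The properties of the weights `W` of the scalar curvature and of the exponents `½(d + b)`,
`b ∈ B`, of a superpotential that determine both. -/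
structure IsArrangement (d : Fin r → ℕ) (W B : Finset (Fin r → ℝ)) : Prop where
  one_le_dim : ∀ i, 1 ≤ d i
  dim_one_unique : ∀ i j, d i = 1 → d j = 1 → i = j
  weight : ∀ w ∈ W, (∃ i, w = Pi.single i (-1)) ∨
    ∃ i l k, k ≠ i ∧ k ≠ l ∧ w = Pi.single k 1 - Pi.single i 1 - Pi.single l 1
  neg_mem : ∀ j, 2 ≤ d j → Pi.single j (-1) ∈ W
  nonvanishing : 2 ≤ r → ∀ i, ∃ w ∈ W, w i ≠ 0
  split : Splitting B (fun a b => 1 - dimForm d a b) fun v => v = 0 ∨ ∃ w ∈ W, v = w + w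
  zero : ∃ a ∈ B, ∃ b ∈ B, a + b = 0
  weight_split : ∀ w ∈ W, ∃ a ∈ B, ∃ b ∈ B, a + b = w + w ∧ dimForm d a b ≠ 1

namespace IsArrangement

variable {d : Fin r → ℕ} {W B : Finset (Fin r → ℝ)} (h : IsArrangement d W B)

include h

theorem total_weight {w : Fin r → ℝ} (hw : w ∈ W) : total w = -1 := by
  rcases h.weight w hw with ⟨i, rfl⟩ | ⟨i, l, k, -, -, rfl⟩
  · rw [total_single]
  · rw [map_sub, map_sub, total_single, total_single, total_single]
    norm_num

theorem exists_split {a b : Fin r → ℝ} (ha : a ∈ B) (hb : b ∈ B) (hab : dimForm d a b ≠ 1)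
    (h0 : a + b ≠ 0) (hw : ∀ w ∈ W, a + b ≠ w + w) :
    ∃ x ∈ B, ∃ y ∈ B, x + y = a + b ∧ x ≠ a ∧ x ≠ b ∧ y ≠ a ∧ y ≠ b := by
  obtain ⟨x, hx, y, hy, hxy, hxa, hxb⟩ := h.split a ha b hb (sub_ne_zero.2 hab.symm) (by
    rintro (h' | ⟨w, hwW, h'⟩)
    exacts [h0 h', hw w hwW h'])
  refine ⟨x, hx, y, hy, hxy, hxa, hxb, ?_, ?_⟩
  · rintro rfl
    exact hxb (add_right_cancel (hxy.trans (add_comm _ _)))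
  · rintro rfl
    exact hxa (add_right_cancel hxy)

/-- A doubled weight has coordinate sum -2, so any other nonzero sum is not prescribed. -/
theorem exists_split_of_total {a b : Fin r → ℝ} (ha : a ∈ B) (hb : b ∈ B) (hab : dimForm d a b ≠ 1)
    (h0 : a + b ≠ 0) (hw : total a + total b ≠ -2) :
    ∃ x ∈ B, ∃ y ∈ B, x + y = a + b ∧ x ≠ a ∧ x ≠ b ∧ y ≠ a ∧ y ≠ b := by
  refine h.exists_split ha hb hab h0 fun w hwW hE => hw ?_
  rw [← map_add, hE, map_add, h.total_weight hwW]
  norm_num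

/-- `exists_unique_top` with threshold 0: prescribed sums have total 0 or -2. Being null for J means
having norm one here, and being orthogonal means having inner product one. -/
theorem top {a : Fin r → ℝ} (ha : a ∈ B) (hmax : ∀ b ∈ B, total b ≤ total a) (hpos : 0 < total a) :
    dimForm d a a = 1 ∧ (∀ b ∈ B, total b = total a → b = a) ∧
      ∀ b ∈ B, -total a < total b → dimForm d a b = 1 := by
  obtain ⟨h1, h2, h3⟩ := exists_unique_top (dimForm_comm d) (Q := fun a b => 1 - dimForm d a b)
    (fun a b c x y hxy => by
      have : dimForm d a x + dimForm d a y = dimForm d a b + dimForm d a c := by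
        rw [← map_add, hxy, map_add]
      linarith)
    h.split total (t := 0)
    (by
      rintro v (rfl | ⟨w, hw, rfl⟩)
      · simp
      · rw [map_add, h.total_weight hw]
        norm_num)
    ha hmax (by linarith) (κ := 1)
    (fun a _ b _ _ _ => ⟨rfl, fun hne => dimForm_self_pos h.one_le_dim (sub_ne_zero.2 hne)⟩)
  exact ⟨by linarith, h2, fun b hb hlt => by linarith [h3 b hb (by linarith)]⟩

/-- The mirror image of `top`, for the negative of the total, with threshold 2. -/
theorem bottom {a : Fin r → ℝ} (ha : a ∈ B) (hmin : ∀ b ∈ B, total a ≤ total b)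
    (hneg : total a < -1) :
    dimForm d a a = 1 ∧ (∀ b ∈ B, total b = total a → b = a) ∧
      ∀ b ∈ B, total b < -2 - total a → dimForm d a b = 1 := by
  obtain ⟨h1, h2, h3⟩ := exists_unique_top (dimForm_comm d) (Q := fun a b => 1 - dimForm d a b)
    (fun a b c x y hxy => by
      have : dimForm d a x + dimForm d a y = dimForm d a b + dimForm d a c := by
        rw [← map_add, hxy, map_add]
      linarith)
    h.split (-total) (t := 2)
    (by
      rintro v (rfl | ⟨w, hw, rfl⟩)
      · simp
      · rw [map_add, LinearMap.neg_apply, h.total_weight hw]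
        norm_num)
    ha (fun b hb => by simpa using hmin b hb) (by rw [LinearMap.neg_apply]; linarith) (κ := 1)
    (fun a _ b _ _ _ => ⟨rfl, fun hne => dimForm_self_pos h.one_le_dim (sub_ne_zero.2 hne)⟩)
  refine ⟨by linarith, fun b hb hE => h2 b hb (by simpa using hE), fun b hb hlt => ?_⟩
  have := h3 b hb (by rw [LinearMap.neg_apply, LinearMap.neg_apply]; linarith)
  linarith

/-- Equality case of the Cauchy–Schwarz inequality. -/
theorem eq_of_dimForm_eq_one {a b : Fin r → ℝ} (ha : dimForm d a a = 1) (hb : dimForm d b b = 1)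
    (hab : dimForm d a b = 1) : a = b := by
  have : dimForm d (a - b) (a - b) ≤ 0 := by
    simp only [map_sub, LinearMap.sub_apply, dimForm_comm d b a, ha, hb, hab]
    norm_num
  exact sub_eq_zero.1 (eq_zero_of_dimForm_self h.one_le_dim this)

omit h in
/-- A unit vector cannot have a nonzero integral inner product with `-eⱼ` if `dⱼ ≥ 2`. -/
theorem apply_eq_zero_of_int {a : Fin r → ℝ} (ha : dimForm d a a = 1) {j : Fin r} (hj : 2 ≤ d j)
    {n : ℤ} (hn : dimForm d a (Pi.single j (-1)) = n) : a j = 0 := by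
  have hpos : (2 : ℝ) ≤ d j := by exact_mod_cast hj
  rw [dimForm_single, div_eq_iff (by linarith)] at hn
  have h1 := le_dimForm_self d a j
  rw [ha, div_le_one (by linarith)] at h1
  by_cases h0 : n = 0
  · rw [h0] at hn
    simp at hn
    exact hn
  · have h2 : (1 : ℝ) ≤ (n : ℝ) ^ 2 := by
      have : 1 ≤ n ^ 2 := by
        have := sq_pos_of_ne_zero (a := n) h0
        omega
      exact_mod_cast this
    -- Then a_j²/d_j = n² d_j ≥ 2, beyond the norm of a unit vector.
    have h3 : a j = -(n * d j) := by linarith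
    rw [h3] at h1
    nlinarith [mul_pos (show (0 : ℝ) < d j by linarith) (show (0 : ℝ) < d j by linarith)]

theorem two_le_dim {z j : Fin r} (hz : d z = 1) (hj : j ≠ z) : 2 ≤ d j := by
  have h1 := h.one_le_dim j
  have : d j ≠ 1 := fun h' => hj (h.dim_one_unique _ _ h' hz)
  omega

theorem eq_single_of_apply_eq_zero {a : Fin r → ℝ} (ha : dimForm d a a = 1)
    (hz : ∀ j, 2 ≤ d j → a j = 0) :
    ∃ z, d z = 1 ∧ a = Pi.single z (a z) ∧ a z ^ 2 = 1 := by
  have hne : a ≠ 0 := by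
    rintro rfl
    simp at ha
  obtain ⟨z, hz0⟩ := Function.ne_iff.1 hne
  have hdz : d z = 1 := by
    have := h.one_le_dim z
    have := mt (hz z) hz0
    omega
  have hs : a = Pi.single z (a z) := by
    funext j
    by_cases hj : j = z
    · subst hj
      simp
    · rw [hz j (h.two_le_dim hdz hj), Pi.single_eq_of_ne hj]
  refine ⟨z, hdz, hs, ?_⟩
  rw [hs, dimForm_single, hdz] at ha
  simp at ha
  rw [sq, ha]

/-- -2e_j is a sum of two exponents, and two odd products add to an even integer, so ⟨a, -e_j⟩ is an
integer; for a unit vector and d_j ≥ 2 it is then zero. -/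
theorem apply_eq_zero_of_odd {a : Fin r → ℝ} (ha : dimForm d a a = 1)
    (hodd : ∀ b ∈ B, ∃ n : ℤ, dimForm d a b = 2 * n + 1) {j : Fin r} (hj : 2 ≤ d j) : a j = 0 := by
  obtain ⟨x, hx, y, hy, hxy, -⟩ := h.weight_split _ (h.neg_mem j hj)
  obtain ⟨n, hn⟩ := hodd x hx
  obtain ⟨k, hk⟩ := hodd y hy
  refine apply_eq_zero_of_int ha hj (n := n + k + 1) ?_
  have := congrArg (dimForm d a) hxy
  rw [map_add, map_add, hn, hk] at this
  push_cast
  linarith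

/-- If some exponent has positive total, there is a summand `𝔭_z` of dimension one and the top and
bottom exponents are `±e_z`. -/
theorem exists_single_of_pos (hpos : ∃ b ∈ B, 0 < total b) :
    ∃ z, d z = 1 ∧ Pi.single z 1 ∈ B ∧ Pi.single z (-1) ∈ B ∧
      ∀ b ∈ B, b = Pi.single z (-1) ∨ (b z = 1 ∧ -1 ≤ total b) := by
  classical
  obtain ⟨b₀, hb₀, hb₀pos⟩ := hpos
  obtain ⟨a, ha, hmax⟩ := B.exists_max_image total ⟨b₀, hb₀⟩
  have hapos : 0 < total a := hb₀pos.trans_le (hmax _ hb₀)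
  obtain ⟨hnorm, huniq, horth⟩ := h.top ha hmax hapos
  -- In a decomposition 0 = x + y not both parts can lie above level -total a, since their products
  -- with `a` would then add to 2; the partner of the low part is at the top, hence equals `a`.
  have hneg : -a ∈ B := by
    obtain ⟨x, hx, y, hy, hxy⟩ := h.zero
    have hl : total x + total y = 0 := by rw [← map_add, hxy, map_zero]
    have hside : ∀ u ∈ B, ∀ v ∈ B, u + v = 0 → total u ≤ -total a → -a ∈ B := by
      intro u hu v hv huv hul
      have hl' : total u + total v = 0 := by rw [← map_add, huv, map_zero]
      have : v = a := huniq v hv (le_antisymm (hmax v hv) (by linarith))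
      rw [this] at huv
      rw [← eq_neg_of_add_eq_zero_left huv]
      exact hu
    by_cases hx' : total x ≤ -total a
    · exact hside x hx y hy hxy hx'
    by_cases hy' : total y ≤ -total a
    · exact hside y hy x hx (by rw [add_comm, hxy]) hy'
    have h1 := horth x hx (not_le.1 hx')
    have h2 := horth y hy (not_le.1 hy')
    have h3 := congrArg (dimForm d a) hxy
    rw [map_add, h1, h2, map_zero] at h3
    norm_num at h3
  -- Extends the orthogonality relation to the boundary level: another decomposition of a + b has
  -- both parts strictly between the extreme levels.
  have hlevel : ∀ b ∈ B, b ≠ -a → -total a ≤ total b → dimForm d a b = 1 := by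
    intro b hb hba hle
    rcases hle.lt_or_eq with hlt | heq
    · exact horth b hb hlt
    by_contra hne
    obtain ⟨x, hx, y, hy, hxy, hxa, -, hya, -⟩ := h.exists_split_of_total ha hb hne
      (fun h' => hba (eq_neg_of_add_eq_zero_right h')) (by linarith)
    have hxl := lt_of_le_of_ne (hmax x hx) fun h' => hxa (huniq x hx h')
    have hyl := lt_of_le_of_ne (hmax y hy) fun h' => hya (huniq y hy h')
    have hl := congrArg total hxy
    rw [map_add, map_add] at hl
    have h3 := congrArg (dimForm d a) hxy
    rw [map_add, map_add, horth x hx (by linarith), horth y hy (by linarith), hnorm] at h3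
    exact hne (by linarith)
  obtain ⟨a', ha', hmin⟩ := B.exists_min_image total ⟨b₀, hb₀⟩
  have hle : total a' ≤ -total a := by simpa using hmin _ hneg
  -- A bottom exponent this low has norm one and product one with the unit vector `-a`, so it would
  -- be `-a`.
  have hcontra : total a' < -total a → ¬ total a' < total a - 2 := by
    intro hlt hlt'
    obtain ⟨hnorm', -, horth'⟩ := h.bottom ha' hmin (by linarith)
    have h1 := horth' _ hneg (by rw [map_neg]; linarith)
    have h2 := h.eq_of_dimForm_eq_one hnorm' (by simpa using hnorm) h1
    rw [h2, map_neg] at hlt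
    exact lt_irrefl _ hlt
  -- Downward induction on the total. The bound keeps total a + total b above -2, so for the highest
  -- offender b the sum a + b splits into exponents strictly above b. Their odd products with a give
  -- ⟨a, b⟩ = odd + odd - 1.
  have hodd : -2 - total a < total a' → ∀ b ∈ B, ∃ n : ℤ, dimForm d a b = 2 * n + 1 := by
    intro hlow
    by_contra hbad
    have hne : (B.filter fun b => ¬ ∃ n : ℤ, dimForm d a b = 2 * n + 1).Nonempty := by
      push Not at hbad
      obtain ⟨b, hb, hb'⟩ := hbad
      exact ⟨b, by simpa using ⟨hb, hb'⟩⟩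
    obtain ⟨b, hb, hbmax⟩ := Finset.exists_max_image _ total hne
    simp only [Finset.mem_filter] at hb hbmax
    obtain ⟨hbB, hbodd⟩ := hb
    have hba : b ≠ -a := by
      rintro rfl
      exact hbodd ⟨-1, by rw [map_neg, hnorm]; norm_num⟩
    have hb1 : dimForm d a b ≠ 1 := fun h' => hbodd ⟨0, by simpa using h'⟩
    obtain ⟨x, hx, y, hy, hxy, hxa, -, hya, -⟩ := h.exists_split_of_total ha hbB hb1
      (fun h' => hba (eq_neg_of_add_eq_zero_right h')) (by linarith [hmin b hbB])
    have hxl := lt_of_le_of_ne (hmax x hx) fun h' => hxa (huniq x hx h')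
    have hyl := lt_of_le_of_ne (hmax y hy) fun h' => hya (huniq y hy h')
    have hl := congrArg total hxy
    rw [map_add, map_add] at hl
    have hx' : ∃ n : ℤ, dimForm d a x = 2 * n + 1 := by
      by_contra hc
      linarith [hbmax x ⟨hx, hc⟩]
    have hy' : ∃ n : ℤ, dimForm d a y = 2 * n + 1 := by
      by_contra hc
      linarith [hbmax y ⟨hy, hc⟩]
    obtain ⟨n, hn⟩ := hx'
    obtain ⟨k, hk⟩ := hy'
    refine hbodd ⟨n + k, ?_⟩
    have h3 := congrArg (dimForm d a) hxy
    rw [map_add, map_add, hn, hk, hnorm] at h3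
    push_cast
    linarith
  have hlow : -2 - total a < total a' := by
    by_contra hlow
    exact hcontra (by linarith) (by linarith)
  obtain ⟨z, hz, hsingle, hsq⟩ := h.eq_single_of_apply_eq_zero hnorm
    fun j hj => h.apply_eq_zero_of_odd hnorm (hodd hlow) hj
  have hta : total a = a z := by
    conv_lhs => rw [hsingle, total_single]
  have haz : a z = 1 := by
    rw [hta] at hapos
    nlinarith
  rw [haz] at hsingle
  rw [haz] at hta
  have hmin1 : ∀ b ∈ B, -1 ≤ total b := by
    intro b hb
    have h1 := hmin b hb
    by_contra! hlt
    exact hcontra (by linarith) (by linarith)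
  have hnega : -a = Pi.single z (-1) := by rw [hsingle, ← Pi.single_neg]
  refine ⟨z, hz, hsingle ▸ ha, hnega ▸ hneg, fun b hb => ?_⟩
  by_cases hb' : b = -a
  · exact Or.inl (hb'.trans hnega)
  · have h1 := hlevel b hb hb' (by rw [hta]; exact hmin1 b hb)
    rw [dimForm_comm, hsingle, dimForm_single, hz] at h1
    exact Or.inr ⟨by simpa using h1, hmin1 b hb⟩

end IsArrangement

end Arrangement

end Soliton

end

/-! ### Some exponent has positive total: the Calabi arrangement -/

noncomputable section

namespace Soliton

section Calabi

variable {r : ℕ}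

theorem eq_of_add_self_eq {a b : Fin r → ℝ} (h : a + a = b + b) : a = b := by
  funext i
  have := congrFun h i
  simp only [Pi.add_apply] at this
  linarith

theorem add_le_dimForm_self (d : Fin r → ℕ) (a : Fin r → ℝ) {i j : Fin r} (hij : i ≠ j) :
    a i ^ 2 / d i + a j ^ 2 / d j ≤ dimForm d a a := by
  rw [dimForm_apply, sq, sq, ← Finset.sum_pair (f := fun i => a i * a i / (d i : ℝ)) hij]
  exact Finset.sum_le_sum_of_subset_of_nonneg (Finset.subset_univ _)
    fun j _ _ => div_nonneg (mul_self_nonneg _) (Nat.cast_nonneg _)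

namespace IsArrangement

variable {d : Fin r → ℕ} {W B : Finset (Fin r → ℝ)} (h : IsArrangement d W B)

include h

theorem weight_le_one {w : Fin r → ℝ} (hw : w ∈ W) (k : Fin r) : w k ≤ 1 := by
  rcases h.weight w hw with ⟨i, rfl⟩ | ⟨i, l, m, -, -, rfl⟩
  · simp only [Pi.single_apply]
    split_ifs <;> norm_num
  · simp only [Pi.sub_apply, Pi.single_apply]
    split_ifs <;> norm_num

/-- The Bérard Bergery–Calabi arrangement, which for `r = 1` is the two-dimensional Bryant soliton. -/
theorem calabi_of_pos (hpos : ∃ b ∈ B, 0 < total b) :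
    ∃ z, d z = 1 ∧
      (∀ b, b ∈ B ↔ b = Pi.single z (-1) ∨ b = Pi.single z 1 ∨
        ∃ j, j ≠ z ∧ b = Pi.single z 1 + Pi.single j (-2)) ∧
      ∀ w, w ∈ W ↔ ∃ j, j ≠ z ∧ (w = Pi.single j (-1) ∨ w = Pi.single z 1 + Pi.single j (-2)) := by
  classical
  obtain ⟨z, hz, hzB, hzB', hB⟩ := h.exists_single_of_pos hpos
  have hzval : ∀ b ∈ B, b z = 1 ∨ b z = -1 := by
    intro b hb
    rcases hB b hb with rfl | ⟨h1, -⟩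
    · right; simp
    · left; exact h1
  have hz1 : ∀ b ∈ B, ∀ c ∈ B, b z + c z = 2 → b z = 1 ∧ c z = 1 := by
    intro b hb c hc hE
    rcases hzval b hb with h1 | h1 <;> rcases hzval c hc with h2 | h2 <;>
      first | exact ⟨h1, h2⟩ | (exfalso; linarith)
  -- Pair b with -e_z: any other decomposition avoids -e_z and has z-coordinate 2 instead of 0, so b
  -- - e_z is a doubled weight.
  have hshape : ∀ b ∈ B, b ≠ Pi.single z (-1) → b ≠ Pi.single z 1 →
      ∃ w ∈ W, w z = 0 ∧ b = Pi.single z 1 + (w + w) := by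
    intro b hb hb1 hb2
    have hbz : b z = 1 := ((hB b hb).resolve_left hb1).1
    by_contra hno
    push Not at hno
    obtain ⟨x, hx, y, hy, hxy, hxa, -, hya, -⟩ := h.exists_split hzB' hb
      (by
        rw [dimForm_comm, dimForm_single, hbz, hz]
        norm_num)
      (fun h0 => hb2 (by
        rw [eq_neg_of_add_eq_zero_right h0, ← Pi.single_neg, neg_neg]))
      (fun w hw hE => by
        refine hno w hw ?_ ?_
        · have := congrFun hE z
          simp [hbz] at this
          linarith
        · rw [← hE, ← add_assoc, ← Pi.single_add]
          simp)
    have h1 := ((hB x hx).resolve_left hxa).1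
    have h2 := ((hB y hy).resolve_left hya).1
    have := congrFun hxy z
    simp [h1, h2, hbz] at this
  -- The z-coordinates ±1 of the two parts of -2e_j cancel, so one part is -e_z and the other is
  -- forced.
  have hmem : ∀ j, j ≠ z → Pi.single z 1 + Pi.single j (-2) ∈ B := by
    intro j hj
    obtain ⟨x, hx, y, hy, hxy, -⟩ := h.weight_split _ (h.neg_mem j (h.two_le_dim hz hj))
    have hxyz := congrFun hxy z
    simp only [Pi.add_apply, Pi.single_eq_of_ne' hj] at hxyz
    have hside : ∀ u ∈ B, ∀ v ∈ B, u + v = Pi.single j (-1) + Pi.single j (-1) → u z = -1 →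
        Pi.single z 1 + Pi.single j (-2) ∈ B := by
      intro u hu v hv huv huz
      have hu' : u = Pi.single z (-1) := (hB u hu).resolve_right fun h' => by linarith [h'.1]
      have : v = Pi.single z 1 + Pi.single j (-2) := by
        have hv' : v = Pi.single j (-1) + Pi.single j (-1) - u := by rw [← huv]; abel
        rw [hv', hu', ← Pi.single_add, sub_eq_add_neg, ← Pi.single_neg, add_comm]
        norm_num
      exact this ▸ hv
    rcases hzval x hx with h1 | h1
    · exact hside y hy x hx (by rw [add_comm, hxy]) (by linarith)
    · exact hside x hx y hy hxy h1
  have hBiff : ∀ b, b ∈ B ↔ b = Pi.single z (-1) ∨ b = Pi.single z 1 ∨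
        ∃ j, j ≠ z ∧ b = Pi.single z 1 + Pi.single j (-2) := by
    intro b
    constructor
    · intro hb
      by_cases hb1 : b = Pi.single z (-1)
      · exact Or.inl hb1
      by_cases hb2 : b = Pi.single z 1
      · exact Or.inr (Or.inl hb2)
      obtain ⟨w, hw, hwz, hbw⟩ := hshape b hb hb1 hb2
      rcases h.weight w hw with ⟨i, rfl⟩ | ⟨i, l, k, hki, hkl, rfl⟩
      · refine Or.inr (Or.inr ⟨i, ?_, ?_⟩)
        · rintro rfl
          simp at hwz
        · rw [hbw, ← Pi.single_add]
          norm_num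
      · exfalso
        have hkz : k ≠ z := by
          rintro rfl
          simp [hki, hkl] at hwz
        have hbz : b z = 1 := ((hB b hb).resolve_left hb1).1
        have hbk : b k = 2 := by
          rw [hbw]
          simp [hki, hkl, hkz]
          norm_num
        -- Largest `k`-coordinate, then largest norm. The double of such an exponent cannot split by
        -- the parallelogram law, and an entry of at least 2 excludes it from the weights.
        obtain ⟨b₁, hb₁, hmax₁⟩ := (B.filter fun b => b z = 1).exists_max_image (fun b => b k)
          ⟨b, by simp [hb, hbz]⟩
        simp only [Finset.mem_filter] at hb₁ hmax₁
        obtain ⟨b₂, hb₂, hmax₂⟩ := (B.filter fun b => b z = 1 ∧ b k = b₁ k).exists_max_image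
          (fun b => dimForm d b b) ⟨b₁, by simp [hb₁]⟩
        simp only [Finset.mem_filter] at hb₂ hmax₂
        obtain ⟨hb₂B, hb₂z, hb₂k⟩ := hb₂
        have hk2 : 2 ≤ b₂ k := by
          rw [hb₂k, ← hbk]
          exact hmax₁ b ⟨hb, hbz⟩
        have hnorm : dimForm d b₂ b₂ ≠ 1 := by
          have h1 := add_le_dimForm_self d b₂ (Ne.symm hkz)
          have h2 : 0 < b₂ k ^ 2 / d k :=
            div_pos (by positivity) (by exact_mod_cast h.one_le_dim k)
          rw [hb₂z, hz] at h1
          norm_num at h1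
          linarith
        obtain ⟨x, hx, y, hy, hxy, hxb, -⟩ := h.exists_split hb₂B hb₂B hnorm
          (fun h0 => by
            have := congrFun h0 z
            simp [hb₂z] at this)
          (fun w hw hE => by
            have := h.weight_le_one hw k
            rw [← eq_of_add_self_eq hE] at this
            linarith)
        have hsum := fun i => congrFun hxy i
        simp only [Pi.add_apply] at hsum
        obtain ⟨hxz, hyz⟩ := hz1 x hx y hy (by rw [hsum z, hb₂z]; norm_num)
        have hxk := hmax₁ x ⟨hx, hxz⟩
        have hyk := hmax₁ y ⟨hy, hyz⟩
        have hk := hsum k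
        rw [hb₂k] at hk
        exact hxb (eq_of_add_eq_two (dimForm_comm d) (hmax₂ x ⟨hx, hxz, by linarith⟩)
          (hmax₂ y ⟨hy, hyz, by linarith⟩)
          (fun hne => dimForm_self_pos h.one_le_dim (sub_ne_zero.2 hne)) hxy)
    · rintro (rfl | rfl | ⟨j, hj, rfl⟩)
      exacts [hzB', hzB, hmem j hj]
  refine ⟨z, hz, hBiff, fun w => ⟨fun hw => ?_, ?_⟩⟩
  · obtain ⟨x, hx, y, hy, hxy, hne⟩ := h.weight_split w hw
    have hl := congrArg total hxy
    rw [map_add, map_add, h.total_weight hw] at hl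
    have hmix : ∀ j, j ≠ z → Pi.single z (-1) + (Pi.single z 1 + Pi.single j (-2)) = w + w →
        w = Pi.single j (-1) := by
      intro j hj hE
      refine (eq_of_add_self_eq ?_).symm
      rw [← hE, ← add_assoc, ← Pi.single_add, ← Pi.single_add]
      norm_num
    rcases (hBiff x).1 hx with rfl | rfl | ⟨j, hj, rfl⟩ <;>
      rcases (hBiff y).1 hy with rfl | rfl | ⟨k, hk, rfl⟩ <;>
      simp only [map_add, total_single] at hl
    · rw [dimForm_single, hz] at hne
      simp at hne
    · norm_num at hl
    · exact ⟨k, hk, Or.inl (hmix k hk hxy)⟩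
    · norm_num at hl
    · norm_num at hl
    · norm_num at hl
    · exact ⟨j, hj, Or.inl (hmix j hj (by rw [add_comm, hxy]))⟩
    · norm_num at hl
    · by_cases hjk : j = k
      · subst hjk
        exact ⟨j, hj, Or.inr (eq_of_add_self_eq hxy).symm⟩
      · exfalso
        apply hne
        rw [map_add, dimForm_single, dimForm_single, hz]
        simp [hk, Ne.symm hjk, Ne.symm hj]
  · rintro ⟨j, hj, rfl | rfl⟩
    · exact h.neg_mem j (h.two_le_dim hz hj)
    -- The exponent e_z - 2e_j has norm above one and is the only one with negative j-coordinate.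
    -- Its double has no other decomposition, so it must be a doubled weight.
    · by_contra hno
      have hb := hmem j hj
      obtain ⟨x, hx, y, hy, hxy, hxb, -, hyb, -⟩ := h.exists_split hb hb
        (by
          intro hE
          have h1 := add_le_dimForm_self d (Pi.single z 1 + Pi.single j (-2)) hj
          rw [hE] at h1
          have h2 : (0 : ℝ) < 4 / d j := div_pos (by norm_num) (by exact_mod_cast h.one_le_dim j)
          simp [hj, Ne.symm hj, hz] at h1
          norm_num at h1
          linarith)
        (fun h0 => by
          have := congrFun h0 z
          simp [Ne.symm hj] at this)
        (fun w hw hE => hno (by rw [eq_of_add_self_eq hE]; exact hw))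
      have hval : ∀ u ∈ B, u ≠ Pi.single z 1 + Pi.single j (-2) → 0 ≤ u j := by
        intro u hu hne
        rcases (hBiff u).1 hu with rfl | rfl | ⟨k, hk, rfl⟩
        · simp [hj]
        · simp [hj]
        · have : j ≠ k := by
            rintro rfl
            exact hne rfl
          simp [hj, this]
      have h1 := hval x hx hxb
      have h2 := hval y hy hyb
      have := congrFun hxy j
      simp [hj] at this
      linarith

end IsArrangement

end Calabi

end Soliton

end

/-! ### No positive totals: the zero face, and the Bryant arrangements -/

noncomputable section

namespace Soliton

namespace IsArrangement

variable {r : ℕ} {d : Fin r → ℕ} {W B : Finset (Fin r → ℝ)} (h : IsArrangement d W B)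

include h

/-- The face of exponents of total zero, if there are none of positive total. -/
theorem zero_face (hnp : ∀ b ∈ B, total b ≤ 0) :
    (0 ∈ B ∧ ∀ b ∈ B, total b = 0 → b = 0) ∨
      ∃ a ∈ B, -a ∈ B ∧ dimForm d a a = 1 ∧ total a = 0 ∧
        ∀ b ∈ B, total b = 0 → b = a ∨ b = -a := by
  classical
  obtain ⟨x₀, hx₀, y₀, hy₀, hxy₀⟩ := h.zero
  have hface : ∀ x ∈ B, ∀ y ∈ B, total x + total y = 0 → total x = 0 ∧ total y = 0 := by
    intro x hx y hy hE
    have := hnp x hx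
    have := hnp y hy
    constructor <;> linarith
  obtain ⟨hx₀t, hy₀t⟩ := hface x₀ hx₀ y₀ hy₀ (by rw [← map_add, hxy₀, map_zero])
  obtain ⟨a, ha, hmax⟩ := (B.filter fun b => total b = 0).exists_max_image (fun b => dimForm d b b)
    ⟨x₀, by simp [hx₀, hx₀t]⟩
  simp only [Finset.mem_filter] at ha hmax
  obtain ⟨ha, hat⟩ := ha
  by_cases ha0 : a = 0
  · subst ha0
    refine Or.inl ⟨ha, fun b hb hbt => eq_zero_of_dimForm_self h.one_le_dim ?_⟩
    simpa using hmax b ⟨hb, hbt⟩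
  refine Or.inr ?_
  have hsplit : ∀ b ∈ B, total b = 0 → dimForm d a b ≠ 1 → a + b ≠ 0 →
      ∃ x ∈ B, ∃ y ∈ B, x + y = a + b ∧ x ≠ a ∧ y ≠ a ∧ total x = 0 ∧ total y = 0 := by
    intro b hb hbt hne h0
    obtain ⟨x, hx, y, hy, hxy, hxa, -, hya, -⟩ := h.exists_split_of_total ha hb hne h0
      (by rw [hat, hbt]; norm_num)
    obtain ⟨hxt, hyt⟩ := hface x hx y hy (by rw [← map_add, hxy, map_add, hat, hbt, add_zero])
    exact ⟨x, hx, y, hy, hxy, hxa, hya, hxt, hyt⟩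
  have hnorm : dimForm d a a = 1 := by
    by_contra hne
    obtain ⟨x, hx, y, hy, hxy, hxa, -, hxt, hyt⟩ := hsplit a ha hat hne fun h0 => ha0
      (eq_of_add_self_eq (by rw [h0, add_zero]))
    exact hxa (eq_of_add_eq_two (dimForm_comm d) (hmax x ⟨hx, hxt⟩) (hmax y ⟨hy, hyt⟩)
      (fun hne => dimForm_self_pos h.one_le_dim (sub_ne_zero.2 hne)) hxy)
  have hlt : ∀ b ∈ B, total b = 0 → b ≠ a → dimForm d a b < 1 := by
    intro b hb hbt hba
    have h1 := dimForm_self_pos h.one_le_dim (sub_ne_zero.2 hba)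
    have h2 := hmax b ⟨hb, hbt⟩
    simp only [map_sub, LinearMap.sub_apply, dimForm_comm d b a] at h1
    linarith
  have hgt : ∀ b ∈ B, total b = 0 → -1 ≤ dimForm d a b := by
    intro b hb hbt
    have h1 := dimForm_self_nonneg d (a + b)
    have h2 := hmax b ⟨hb, hbt⟩
    simp only [map_add, LinearMap.add_apply, dimForm_comm d b a] at h1
    linarith
  -- For an offender b with maximal product, a + b splits inside the face. Neither part is -a, as
  -- the other would have product 2 + ⟨a, b⟩ ≥ 1 with a; so both products are at most ⟨a, b⟩, which
  -- is too small.
  have hall : ∀ b ∈ B, total b = 0 → b = a ∨ b = -a := by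
    by_contra! hbad
    have hne : (B.filter fun b => total b = 0 ∧ b ≠ a ∧ b ≠ -a).Nonempty := by
      obtain ⟨b, hb, h1, h2⟩ := hbad
      exact ⟨b, by simp [hb, h1, h2]⟩
    obtain ⟨b, hb, hbmax⟩ := Finset.exists_max_image _ (fun b => dimForm d a b) hne
    simp only [Finset.mem_filter] at hb hbmax
    obtain ⟨hbB, hbt, hba, hbna⟩ := hb
    have hb1 := hlt b hbB hbt hba
    obtain ⟨x, hx, y, hy, hxy, hxa, hya, hxt, hyt⟩ := hsplit b hbB hbt hb1.ne
      fun h0 => hbna (eq_neg_of_add_eq_zero_right h0)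
    have hsum := congrArg (dimForm d a) hxy
    rw [map_add, map_add, hnorm] at hsum
    have hx1 := hlt x hx hxt hxa
    have hy1 := hlt y hy hyt hya
    have hb2 := hgt b hbB hbt
    have hxna : x ≠ -a := by
      rintro rfl
      rw [map_neg, hnorm] at hsum
      linarith
    have hyna : y ≠ -a := by
      rintro rfl
      rw [map_neg, hnorm] at hsum
      linarith
    have := hbmax x ⟨hx, hxt, hxa, hxna⟩
    have := hbmax y ⟨hy, hyt, hya, hyna⟩
    linarith
  refine ⟨a, ha, ?_, hnorm, hat, hall⟩
  rcases hall x₀ hx₀ hx₀t with rfl | rfl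
  · rw [← eq_neg_of_add_eq_zero_right hxy₀]
    exact hy₀
  · exact hx₀

/-- The trivial arrangement and that of the five-dimensional Bryant soliton. -/
theorem bryant_of_zero (hr : 1 ≤ r) (h0 : 0 ∈ B) (hnp : ∀ b ∈ B, total b ≤ 0)
    (hzero : ∀ b ∈ B, total b = 0 → b = 0) :
    ∃ i, (∀ j, j = i) ∧
      ((d i = 1 ∧ (∀ w, w ∉ W) ∧ ∀ b, b ∈ B ↔ b = 0) ∨
        (d i = 4 ∧ (∀ w, w ∈ W ↔ w = Pi.single i (-1)) ∧
          ∀ b, b ∈ B ↔ b = 0 ∨ b = Pi.single i (-2))) := by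
  classical
  by_cases hall : ∀ b ∈ B, b = 0
  · have hW : ∀ w, w ∉ W := by
      intro w hw
      obtain ⟨x, hx, y, hy, hxy, -⟩ := h.weight_split w hw
      have := congrArg total hxy
      rw [hall x hx, hall y hy, map_add, map_add, map_zero, h.total_weight hw] at this
      norm_num at this
    obtain rfl : r = 1 := by
      by_contra hne
      obtain ⟨w, hw, -⟩ := h.nonvanishing (by omega) ⟨0, hr⟩
      exact hW w hw
    refine ⟨0, fun j => Subsingleton.elim _ _, Or.inl ⟨?_, hW, fun b => ⟨hall b, ?_⟩⟩⟩
    · have h1 := h.one_le_dim 0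
      have h2 := mt (h.neg_mem 0) (hW _)
      omega
    · rintro rfl
      exact h0
  push Not at hall
  obtain ⟨b₀, hb₀, hb₀0⟩ := hall
  obtain ⟨b, hb, hbmax⟩ := (B.erase 0).exists_max_image total ⟨b₀, by simp [hb₀, hb₀0]⟩
  obtain ⟨hb0, hbB⟩ := Finset.mem_erase.1 hb
  have hbneg : total b < 0 := lt_of_le_of_ne (hnp b hbB) fun h' => hb0 (hzero b hbB h')
  -- `b` is highest among the nonzero exponents, and two of those have totals adding to at most 2
  -- total b < total b. So 0 + b does not split and is prescribed.
  obtain ⟨w₀, hw₀, hbw₀⟩ : ∃ w ∈ W, b = w + w := by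
    by_contra! hno
    obtain ⟨x, hx, y, hy, hxy, hx0, -, hy0, -⟩ := h.exists_split h0 hbB (by simp) (by simpa using hb0)
      (fun w hw => by simpa using hno w hw)
    have h1 := hbmax x (Finset.mem_erase.2 ⟨hx0, hx⟩)
    have h2 := hbmax y (Finset.mem_erase.2 ⟨hy0, hy⟩)
    have h3 := congrArg total hxy
    rw [zero_add, map_add] at h3
    linarith
  have hbt : total b = -2 := by
    rw [hbw₀, map_add, h.total_weight hw₀]
    norm_num
  obtain ⟨a, ha, hmin⟩ := B.exists_min_image total ⟨0, h0⟩
  obtain ⟨hnorm, huniq, horth⟩ := h.bottom ha hmin (by linarith [hmin b hbB])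
  -- If the bottom were lower, the exponent 0 would have product one with it.
  have hat : total a = -2 := by
    refine le_antisymm (hbt ▸ hmin b hbB) ?_
    by_contra! hlt
    have := horth 0 h0 (by rw [map_zero]; linarith)
    simp at this
  have hB : ∀ c ∈ B, c = 0 ∨ c = a := by
    intro c hc
    by_cases hc0 : c = 0
    · exact Or.inl hc0
    · refine Or.inr (huniq c hc (le_antisymm ?_ (hmin c hc)))
      rw [hat, ← hbt]
      exact hbmax c (Finset.mem_erase.2 ⟨hc0, hc⟩)
  have hW : ∀ w ∈ W, w = w₀ := by
    intro w hw
    obtain ⟨x, hx, y, hy, hxy, -⟩ := h.weight_split w hw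
    have hba : b = a := huniq b hbB (by rw [hbt, hat])
    have hl := congrArg total hxy
    rw [map_add, map_add, h.total_weight hw] at hl
    refine eq_of_add_self_eq ?_
    rw [← hxy, ← hbw₀, hba]
    rcases hB x hx with rfl | rfl <;> rcases hB y hy with rfl | rfl
    · norm_num at hl
    · rw [zero_add]
    · rw [add_zero]
    · rw [hat] at hl
      norm_num at hl
  -- A second summand would make one of the dimensions at least two; the only weight is then -e_j,
  -- which vanishes at the other position.
  obtain rfl : r = 1 := by
    by_contra hne
    have hr2 : 2 ≤ r := by omega
    obtain ⟨i, j, hij⟩ : ∃ i j : Fin r, i ≠ j := ⟨⟨0, hr⟩, ⟨1, hr2⟩, by simp⟩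
    have key : ∀ i j : Fin r, i ≠ j → ¬ 2 ≤ d j := by
      intro i j hij hj
      obtain ⟨w, hw, hwi⟩ := h.nonvanishing hr2 i
      rw [hW w hw, ← hW _ (h.neg_mem j hj)] at hwi
      exact hwi (by simp [hij])
    have h1 := key i j hij
    have h2 := key j i hij.symm
    have h3 := h.one_le_dim i
    have h4 := h.one_le_dim j
    exact hij (h.dim_one_unique i j (by omega) (by omega))
  have hw₀' : w₀ = Pi.single 0 (-1) := by
    rcases h.weight w₀ hw₀ with ⟨i, rfl⟩ | ⟨i, l, k, hki, -, -⟩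
    · rw [Subsingleton.elim i 0]
    · exact absurd (Subsingleton.elim k i) hki
  have hba : a = Pi.single 0 (-2) := by
    rw [← huniq b hbB (by rw [hbt, hat]), hbw₀, hw₀', ← Pi.single_add]
    norm_num
  refine ⟨0, fun j => Subsingleton.elim _ _, Or.inr ⟨?_, fun w => ⟨fun hw => ?_, ?_⟩, fun c => ⟨?_, ?_⟩⟩⟩
  · rw [hba, dimForm_single, div_eq_one_iff_eq (by
      exact_mod_cast (Nat.one_le_iff_ne_zero.1 (h.one_le_dim 0)))] at hnorm
    simp at hnorm
    norm_num at hnorm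
    exact_mod_cast hnorm.symm
  · rw [hW w hw, hw₀']
  · rintro rfl
    rw [← hw₀']
    exact hw₀
  · intro hc
    rw [← hba]
    exact hB c hc
  · rintro (rfl | rfl)
    · exact h0
    · rw [← hba]
      exact ha

end IsArrangement

end Soliton

end

/-! ### The zero face is {a, -a} -/

noncomputable section

namespace Soliton

namespace IsArrangement

variable {r : ℕ} {d : Fin r → ℕ} {W B : Finset (Fin r → ℝ)} (h : IsArrangement d W B)

include h

/-- Parity by downward induction on the total, with ties broken by the product with `a`: the sum of
a and an even or nonintegral b splits again, and at least one part would be a worse offender. -/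
theorem odd_of_face {a : Fin r → ℝ} (ha : a ∈ B) (hnorm : dimForm d a a = 1) (hat : total a = 0)
    (hnp : ∀ b ∈ B, total b ≤ 0) (hface : ∀ b ∈ B, total b = 0 → b = a ∨ b = -a) :
    ∀ b ∈ B, -2 < total b → ∃ n : ℤ, dimForm d a b = 2 * n + 1 := by
  classical
  by_contra hbad
  have hne : (B.filter fun b => -2 < total b ∧ ¬ ∃ n : ℤ, dimForm d a b = 2 * n + 1).Nonempty := by
    push Not at hbad
    obtain ⟨b, hb, h1, h2⟩ := hbad
    exact ⟨b, by simpa using ⟨hb, h1, h2⟩⟩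
  obtain ⟨b₁, hb₁, hmax₁⟩ := Finset.exists_max_image _ total hne
  simp only [Finset.mem_filter] at hb₁ hmax₁
  obtain ⟨b, hb, hmax⟩ := (B.filter fun b => total b = total b₁ ∧
    ¬ ∃ n : ℤ, dimForm d a b = 2 * n + 1).exists_max_image (fun b => dimForm d a b)
    ⟨b₁, Finset.mem_filter.2 ⟨hb₁.1, rfl, hb₁.2.2⟩⟩
  simp only [Finset.mem_filter] at hb hmax
  obtain ⟨hbB, hbt, hbodd⟩ := hb
  obtain ⟨-, hlow, -⟩ := hb₁
  have hba : b ≠ a := by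
    rintro rfl
    exact hbodd ⟨0, by rw [hnorm]; norm_num⟩
  have hbna : b ≠ -a := by
    rintro rfl
    exact hbodd ⟨-1, by rw [map_neg, hnorm]; norm_num⟩
  have hb1 : dimForm d a b ≠ 1 := fun h' => hbodd ⟨0, by simpa using h'⟩
  have hbneg : total b < 0 := lt_of_le_of_ne (hnp b hbB) fun h' =>
    (hface b hbB h').elim hba hbna
  obtain ⟨x, hx, y, hy, hxy, hxa, -, hya, -⟩ := h.exists_split_of_total ha hbB hb1
      (fun h' => hbna (eq_neg_of_add_eq_zero_right h')) (by rw [hat, hbt]; linarith)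
  have hl := congrArg total hxy
  rw [map_add, map_add, hat] at hl
  have hsum := congrArg (dimForm d a) hxy
  rw [map_add, map_add, hnorm] at hsum
  have hodd : ∀ u ∈ B, ∀ v ∈ B, u ≠ a → v ≠ a → total u + total v = 0 + total b →
      dimForm d a u + dimForm d a v = 1 + dimForm d a b → ∃ n : ℤ, dimForm d a u = 2 * n + 1 := by
    intro u hu v hv hua hva hl' hs
    by_contra hc
    have huna : u ≠ -a := by
      rintro rfl
      exact hc ⟨-1, by rw [map_neg, hnorm]; norm_num⟩
    have h1 := hmax₁ u ⟨hu, by linarith [hnp v hv], hc⟩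
    -- `u` is no higher than the offender, so `v` is on the top face and equals `-a`; then ⟨a, u⟩ =
    -- 2 + ⟨a, b⟩ contradicts the tie-break.
    have hvt : total v = 0 := le_antisymm (hnp v hv) (by linarith)
    have hv' : v = -a := (hface v hv hvt).resolve_left hva
    have h2 := hmax u ⟨hu, by linarith, hc⟩
    rw [hv', map_neg, hnorm] at hs
    linarith
  obtain ⟨n, hn⟩ := hodd x hx y hy hxa hya hl hsum
  obtain ⟨k, hk⟩ := hodd y hy x hx hya hxa (by linarith) (by linarith)
  refine hbodd ⟨n + k, ?_⟩
  rw [hn, hk] at hsum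
  push_cast
  linarith

/-- If the exponents of total zero are `±a` with `a ≠ 0`, the isotropy representation has exactly two
summands of dimension at least two, and their dimension is two. -/
theorem exists_pair_of_face {a : Fin r → ℝ} (ha : a ∈ B) (hna : -a ∈ B) (hnorm : dimForm d a a = 1)
    (hat : total a = 0) (hnp : ∀ b ∈ B, total b ≤ 0)
    (hface : ∀ b ∈ B, total b = 0 → b = a ∨ b = -a) :
    ∃ j k, j ≠ k ∧ d j = 2 ∧ d k = 2 ∧ (∀ i, i = j ∨ i = k ∨ d i = 1) ∧
      Pi.single j (-1) + Pi.single k (-1) ∈ B ∧ Pi.single j (-1) + Pi.single k 1 ∈ B ∧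
      Pi.single j 1 + Pi.single k (-1) ∈ B ∧
      ∀ b ∈ B, b = Pi.single j (-1) + Pi.single k (-1) ∨ b = Pi.single j (-1) + Pi.single k 1 ∨
        b = Pi.single j 1 + Pi.single k (-1) ∨
        (-2 < total b ∧ total b < 0 ∧ b j + b k = -2 ∧ ∃ n : ℤ, b k - b j = 2 * (2 * n + 1)) := by
  classical
  have hodd := h.odd_of_face ha hnorm hat hnp hface
  obtain ⟨c, hc, hmin⟩ := B.exists_min_image total ⟨a, ha⟩
  -- A lower bottom would have product one with both a and -a. A higher one would make all products
  -- with a odd, so a = ±e_z, whose total is not zero.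
  have hct : total c = -2 := by
    rcases lt_trichotomy (total c) (-2) with hlt | heq | hgt
    · exfalso
      obtain ⟨-, -, horth⟩ := h.bottom hc hmin (by linarith)
      have h1 := horth a ha (by rw [hat]; linarith)
      have h2 := horth _ hna (by rw [map_neg, hat]; linarith)
      rw [map_neg, h1] at h2
      norm_num at h2
    · exact heq
    · exfalso
      obtain ⟨z, hz, hs, hsq⟩ := h.eq_single_of_apply_eq_zero hnorm fun j hj =>
        h.apply_eq_zero_of_odd hnorm (fun b hb => hodd b hb (hgt.trans_le (hmin b hb))) hj
      rw [hs, total_single] at hat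
      rw [hat] at hsq
      norm_num at hsq
  obtain ⟨hcnorm, huniq, horth⟩ := h.bottom hc hmin (by linarith)
  rw [hct] at hmin huniq horth
  -- If neither part of -2e_j lies on the zero face, both have product one with c; then c_j = -d_j,
  -- too large for a unit vector.
  have hneg : ∀ j, 2 ≤ d j → c + a = Pi.single j (-2) ∨ c - a = Pi.single j (-2) := by
    intro j hj
    obtain ⟨x, hx, y, hy, hxy, -⟩ := h.weight_split _ (h.neg_mem j hj)
    have hl := congrArg total hxy
    rw [map_add, map_add, total_single] at hl
    have hE : (Pi.single j (-1) + Pi.single j (-1) : Fin r → ℝ) = Pi.single j (-2) := by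
      rw [← Pi.single_add]
      norm_num
    rw [hE] at hxy
    have hside : ∀ u ∈ B, ∀ v ∈ B, u + v = Pi.single j (-2) → total u = 0 → total v = -2 →
        c + a = Pi.single j (-2) ∨ c - a = Pi.single j (-2) := by
      intro u hu v hv huv hut hvt
      rw [huniq v hv hvt] at huv
      rcases hface u hu hut with rfl | rfl
      · left
        rw [add_comm, huv]
      · right
        rw [← huv]
        abel
    by_cases hx0 : total x = 0
    · exact hside x hx y hy hxy hx0 (by linarith)
    by_cases hy0 : total y = 0
    · exact hside y hy x hx (by rw [add_comm, hxy]) hy0 (by linarith)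
    exfalso
    have h1 := horth x hx (by linarith [lt_of_le_of_ne (hnp x hx) hx0])
    have h2 := horth y hy (by linarith [lt_of_le_of_ne (hnp y hy) hy0])
    have h3 := congrArg (dimForm d c) hxy
    have hj' : (2 : ℝ) ≤ d j := by exact_mod_cast hj
    rw [map_add, h1, h2, dimForm_single, eq_div_iff (by linarith)] at h3
    have h4 := le_dimForm_self d c j
    rw [hcnorm, div_le_one (by linarith)] at h4
    have : c j = -d j := by linarith
    rw [this] at h4
    nlinarith
  obtain ⟨j, hj⟩ : ∃ j, 2 ≤ d j := by
    by_contra! hno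
    obtain ⟨z, hz, hs, hsq⟩ := h.eq_single_of_apply_eq_zero hnorm
      fun j hj => absurd hj (not_le.2 (hno j))
    rw [hs, total_single] at hat
    rw [hat] at hsq
    norm_num at hsq
  -- The sign of `a` is normalised so that c + a₁ = -2e_j.
  obtain ⟨a₁, ha₁, hna₁, hnorm₁, hat₁, hface₁, hneg₁, hodd₁, hca₁⟩ : ∃ a₁, a₁ ∈ B ∧ -a₁ ∈ B ∧
      dimForm d a₁ a₁ = 1 ∧ total a₁ = 0 ∧ (∀ b ∈ B, total b = 0 → b = a₁ ∨ b = -a₁) ∧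
      (∀ j, 2 ≤ d j → c + a₁ = Pi.single j (-2) ∨ c - a₁ = Pi.single j (-2)) ∧
      (∀ b ∈ B, -2 < total b → ∃ n : ℤ, dimForm d a₁ b = 2 * n + 1) ∧
      c + a₁ = Pi.single j (-2) := by
    rcases hneg j hj with h1 | h1
    · exact ⟨a, ha, hna, hnorm, hat, hface, hneg, hodd, h1⟩
    · refine ⟨-a, hna, by rwa [neg_neg], by simpa using hnorm, by simpa using hat, ?_, ?_, ?_,
        by rw [← sub_eq_add_neg, h1]⟩
      · intro b hb hbt
        rw [neg_neg]
        exact (hface b hb hbt).symm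
      · intro j hj
        rw [sub_neg_eq_add, ← sub_eq_add_neg]
        exact (hneg j hj).symm
      · intro b hb hbt
        obtain ⟨n, hn⟩ := hodd b hb hbt
        refine ⟨-n - 1, ?_⟩
        rw [map_neg, LinearMap.neg_apply, hn]
        push_cast
        ring
  have hjpos : (2 : ℝ) ≤ d j := by exact_mod_cast hj
  -- Compares the unit norms of a₁ and of c = -2e_j - a₁.
  have haj : a₁ j = -1 := by
    have hc' : c = Pi.single j (-2) - a₁ := by rw [← hca₁]; abel
    rw [hc'] at hcnorm
    simp only [map_sub, LinearMap.sub_apply, dimForm_single, hnorm₁,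
      dimForm_comm d (Pi.single j (-2)) a₁, Pi.single_eq_same] at hcnorm
    field_simp at hcnorm
    linarith
  -- Otherwise there is at most one further summand, one-dimensional. Total zero requires it and
  -- gives the entry 1 there, so the norm of a₁ would be at least 1 + 1/d_j.
  obtain ⟨k, hkj, hk⟩ : ∃ k, k ≠ j ∧ 2 ≤ d k := by
    by_contra! hno
    have hone : ∀ i, i ≠ j → d i = 1 := by
      intro i hi
      have := hno i hi
      have := h.one_le_dim i
      omega
    by_cases hex : ∃ k, k ≠ j
    · obtain ⟨k, hk⟩ := hex
      have htot : total a₁ = a₁ j + a₁ k := by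
        rw [total_apply]
        refine Fintype.sum_eq_add j k hk.symm fun i hi => ?_
        exact absurd (h.dim_one_unique i k (hone i hi.1) (hone k hk)) hi.2
      have h1 := add_le_dimForm_self d a₁ hk.symm
      have h2 : a₁ k = 1 := by linarith
      rw [hnorm₁, h2, haj, hone k hk] at h1
      have h3 : (0 : ℝ) < 1 / d j := by positivity
      norm_num at h1
      linarith
    · push Not at hex
      have htot : total a₁ = a₁ j := by
        rw [total_apply]
        exact Fintype.sum_eq_single j fun i hi => absurd (hex i) hi
      linarith
  have hneg_eq : ∀ l, 2 ≤ d l → l ≠ j → c - a₁ = Pi.single l (-2) := by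
    intro l hl hlj
    refine (hneg₁ l hl).resolve_left fun h' => ?_
    rw [hca₁] at h'
    have := congrFun h' j
    simp [hlj.symm] at this
  have hck := hneg_eq k hk hkj
  have hother : ∀ i, i = j ∨ i = k ∨ d i = 1 := by
    intro i
    by_cases hij : i = j
    · exact Or.inl hij
    by_cases hik : i = k
    · exact Or.inr (Or.inl hik)
    refine Or.inr (Or.inr ?_)
    have h1 := h.one_le_dim i
    by_contra hne
    have h2 := hneg_eq i (by omega) hij
    rw [hck] at h2
    have := congrFun h2 i
    simp [hik] at this
  have hc_eq : c = Pi.single j (-1) + Pi.single k (-1) := by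
    funext i
    have h1 := congrFun hca₁ i
    have h2 := congrFun hck i
    simp only [Pi.add_apply, Pi.sub_apply, Pi.single_apply] at h1 h2 ⊢
    split_ifs at h1 h2 ⊢ <;> linarith
  have ha_eq : a₁ = Pi.single j (-1) + Pi.single k 1 := by
    funext i
    have h1 := congrFun hca₁ i
    have h2 := congrFun hck i
    simp only [Pi.add_apply, Pi.sub_apply, Pi.single_apply] at h1 h2 ⊢
    split_ifs at h1 h2 ⊢ <;> linarith
  have hna_eq : -a₁ = Pi.single j 1 + Pi.single k (-1) := by
    rw [ha_eq, neg_add, ← Pi.single_neg, ← Pi.single_neg, neg_neg]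
  -- The unit norm reads 1/d_j + 1/d_k = 1 with both dimensions at least two.
  have hdims : d j = 2 ∧ d k = 2 := by
    have h1 := hnorm₁
    rw [ha_eq, map_add, dimForm_single, dimForm_single] at h1
    simp [hkj, hkj.symm] at h1
    have hkpos : (2 : ℝ) ≤ d k := by exact_mod_cast hk
    have h2 : (d j : ℝ)⁻¹ ≤ 2⁻¹ := inv_anti₀ (by norm_num) hjpos
    have h3 : (d k : ℝ)⁻¹ ≤ 2⁻¹ := inv_anti₀ (by norm_num) hkpos
    have h4 : (d j : ℝ)⁻¹ = 2⁻¹ := by linarith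
    have h5 : (d k : ℝ)⁻¹ = 2⁻¹ := by linarith
    exact ⟨by exact_mod_cast inv_injective h4, by exact_mod_cast inv_injective h5⟩
  refine ⟨j, k, hkj.symm, hdims.1, hdims.2, hother, hc_eq ▸ hc, ha_eq ▸ ha₁, hna_eq ▸ hna₁, ?_⟩
  intro b hb
  rw [← hc_eq, ← ha_eq, ← hna_eq]
  by_cases hb0 : total b = 0
  · rcases hface₁ b hb hb0 with h' | h' <;> simp [h']
  by_cases hb2 : total b = -2
  · exact Or.inl (huniq b hb hb2)
  refine Or.inr (Or.inr (Or.inr ?_))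
  have hlow : -2 < total b := lt_of_le_of_ne (hmin b hb) (Ne.symm hb2)
  have hup : total b < 0 := lt_of_le_of_ne (hnp b hb) hb0
  obtain ⟨n, hn⟩ := hodd₁ b hb hlow
  have h1 := horth b hb (by linarith)
  rw [dimForm_comm, hc_eq, map_add, dimForm_single, dimForm_single, hdims.1, hdims.2] at h1
  rw [dimForm_comm, ha_eq, map_add, dimForm_single, dimForm_single, hdims.1, hdims.2] at hn
  push_cast at h1 hn
  exact ⟨hlow, hup, by linarith, n, by linarith⟩

end IsArrangement

end Soliton

end

/-! ### Two surfaces, without or with an additional circle direction -/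

noncomputable section

namespace Soliton

namespace IsArrangement

variable {r : ℕ} {d : Fin r → ℕ} {W B : Finset (Fin r → ℝ)} (h : IsArrangement d W B)

include h

/-- The arrangement of the warped product of two surfaces. -/
theorem warped_of_pair {j k : Fin r} (hjk : j ≠ k) (hdj : d j = 2) (hdk : d k = 2)
    (hall : ∀ i, i = j ∨ i = k) (hc : Pi.single j (-1) + Pi.single k (-1) ∈ B)
    (ha : Pi.single j (-1) + Pi.single k 1 ∈ B) (hna : Pi.single j 1 + Pi.single k (-1) ∈ B)
    (hB : ∀ b ∈ B, b = Pi.single j (-1) + Pi.single k (-1) ∨ b = Pi.single j (-1) + Pi.single k 1 ∨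
        b = Pi.single j 1 + Pi.single k (-1) ∨
        (-2 < total b ∧ total b < 0 ∧ b j + b k = -2 ∧ ∃ n : ℤ, b k - b j = 2 * (2 * n + 1))) :
    (∀ b, b ∈ B ↔ b = Pi.single j (-1) + Pi.single k (-1) ∨ b = Pi.single j (-1) + Pi.single k 1 ∨
        b = Pi.single j 1 + Pi.single k (-1)) ∧
      ∀ w, w ∈ W ↔ w = Pi.single j (-1) ∨ w = Pi.single k (-1) := by
  have htot : ∀ b : Fin r → ℝ, total b = b j + b k := fun b => by
    rw [total_apply]
    exact Fintype.sum_eq_add j k hjk fun i hi => absurd (hall i) (not_or.2 hi)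
  have hBiff : ∀ b, b ∈ B ↔ b = Pi.single j (-1) + Pi.single k (-1) ∨
      b = Pi.single j (-1) + Pi.single k 1 ∨ b = Pi.single j 1 + Pi.single k (-1) := by
    intro b
    constructor
    · intro hb
      rcases hB b hb with h' | h' | h' | ⟨h1, -, h2, -⟩
      · exact Or.inl h'
      · exact Or.inr (Or.inl h')
      · exact Or.inr (Or.inr h')
      -- Without a third summand the total is b_j + b_k = -2, which the strict lower bound excludes.
      · rw [htot, h2] at h1
        exact absurd h1 (lt_irrefl _)
    · rintro (rfl | rfl | rfl) <;> assumption
  refine ⟨hBiff, fun w => ⟨fun hw => ?_, ?_⟩⟩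
  · obtain ⟨x, hx, y, hy, hxy, -⟩ := h.weight_split w hw
    have hl := congrArg total hxy
    rw [map_add, map_add, h.total_weight hw] at hl
    have hext : ∀ v : Fin r → ℝ, w j = v j → w k = v k → w = v := by
      intro v h1 h2
      funext i
      rcases hall i with rfl | rfl
      exacts [h1, h2]
    have h1 := congrFun hxy j
    have h2 := congrFun hxy k
    simp only [Pi.add_apply] at h1 h2
    rcases (hBiff x).1 hx with rfl | rfl | rfl <;> rcases (hBiff y).1 hy with rfl | rfl | rfl <;>
      simp [hjk, hjk.symm] at h1 h2 <;> simp only [map_add, total_single] at hl <;>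
      first
        | (exfalso; norm_num at hl; done)
        | exact Or.inl (hext _ (by simp; linarith) (by simp [hjk.symm]; linarith))
        | exact Or.inr (hext _ (by simp [hjk]; linarith) (by simp; linarith))
  · rintro (rfl | rfl)
    · exact h.neg_mem j hdj.ge
    · exact h.neg_mem k hdk.ge

/-- The arrangement of the additional superpotential of the Bérard Bergery–Calabi ansatz. -/
theorem calabiNew_of_pair {z j k : Fin r} (hjk : j ≠ k) (hzj : z ≠ j) (hzk : z ≠ k) (hdj : d j = 2)
    (hdk : d k = 2) (hdz : d z = 1) (hall : ∀ i, i = j ∨ i = k ∨ d i = 1)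
    (hc : Pi.single j (-1) + Pi.single k (-1) ∈ B)
    (ha : Pi.single j (-1) + Pi.single k 1 ∈ B) (hna : Pi.single j 1 + Pi.single k (-1) ∈ B)
    (hB : ∀ b ∈ B, b = Pi.single j (-1) + Pi.single k (-1) ∨ b = Pi.single j (-1) + Pi.single k 1 ∨
        b = Pi.single j 1 + Pi.single k (-1) ∨
        (-2 < total b ∧ total b < 0 ∧ b j + b k = -2 ∧ ∃ n : ℤ, b k - b j = 2 * (2 * n + 1))) :
    (∀ b, b ∈ B ↔ b = Pi.single j (-1) + Pi.single k (-1) ∨ b = Pi.single j (-1) + Pi.single k 1 ∨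
        b = Pi.single j 1 + Pi.single k (-1) ∨ b = Pi.single z 1 + Pi.single j (-2) ∨
        b = Pi.single z 1 + Pi.single k (-2)) ∧
      ∀ w, w ∈ W ↔ w = Pi.single j (-1) ∨ w = Pi.single k (-1) ∨
        w = Pi.single z 1 + Pi.single j (-2) ∨ w = Pi.single z 1 + Pi.single k (-2) := by
  classical
  have hall' : ∀ i, i = z ∨ i = j ∨ i = k := by
    intro i
    rcases hall i with rfl | rfl | hi
    · simp
    · simp
    · exact Or.inl (h.dim_one_unique i z hi hdz)
  have htot : ∀ b : Fin r → ℝ, total b = b z + (b j + b k) := fun b => by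
    rw [total_apply, ← Finset.sum_pair (f := b) hjk,
      ← Finset.sum_insert (f := b) (a := z) (by simp [hzj, hzk])]
    exact (Finset.sum_subset (Finset.subset_univ _) fun i _ hi => absurd (hall' i) (by simpa using hi)).symm
  have hform : ∀ b b' : Fin r → ℝ, dimForm d b b' = b z * b' z + (b j * b' j + b k * b' k) / 2 := by
    intro b b'
    have : dimForm d b b' = total fun i => b i * b' i / (d i : ℝ) := by
      rw [dimForm_apply, total_apply]
    rw [this, htot, hdz, hdj, hdk]
    push_cast
    ring
  have hext : ∀ u v : Fin r → ℝ, u z = v z → u j = v j → u k = v k → u = v := by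
    intro u v h1 h2 h3
    funext i
    rcases hall' i with rfl | rfl | rfl
    exacts [h1, h2, h3]
  -- For the undetermined exponents, b_j + b_k = -2 and b_k - b_j = 2(2n + 1) give b_k = 2n, and the
  -- bounds on the total become 0 < b_z < 2.
  have hBz : ∀ b ∈ B, (b z = 0 ∧ (b = Pi.single j (-1) + Pi.single k (-1) ∨ total b = 0)) ∨
      (0 < b z ∧ b z < 2 ∧ b j + b k = -2 ∧ ∃ n : ℤ, b k = 2 * n) := by
    intro b hb
    rcases hB b hb with rfl | rfl | rfl | ⟨h1, h2, h3, n, hn⟩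
    · simp [hzj, hzk]
    · simp [hzj, hzk, total_single]
    · simp [hzj, hzk, total_single]
    · rw [htot] at h1 h2
      exact Or.inr ⟨by linarith, by linarith, h3, n, by linarith⟩
  have hpos : ∀ b ∈ B, 0 < b z → b z < 2 ∧ b j + b k = -2 ∧ ∃ n : ℤ, b k = 2 * n := by
    intro b hb hbz
    rcases hBz b hb with ⟨h1, -⟩ | ⟨-, h1⟩
    · linarith
    · exact h1
  have hnonneg : ∀ b ∈ B, 0 ≤ b z := by
    intro b hb
    rcases hBz b hb with ⟨h1, -⟩ | ⟨h1, -⟩ <;> linarith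
  have hlow : ∀ b ∈ B, -2 ≤ total b := by
    intro b hb
    rcases hBz b hb with ⟨-, rfl | h1⟩ | ⟨h1, -, h2, -⟩
    · simp [total_single]
      norm_num
    · linarith
    · rw [htot]
      linarith
  have hnorm : ∀ b ∈ B, 0 < b z → dimForm d b b ≠ 1 := by
    intro b hb hbz
    obtain ⟨-, h1, -⟩ := hpos b hb hbz
    have h2 : b j = -2 - b k := by linarith
    rw [hform, h2]
    nlinarith [sq_nonneg (b k + 1), mul_pos hbz hbz]
  have hpd : ∀ x y : Fin r → ℝ, x ≠ y → 0 < dimForm d (x - y) (x - y) := fun x y hne =>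
    dimForm_self_pos h.one_le_dim (sub_ne_zero.2 hne)
  have hsz : ∀ x y b : Fin r → ℝ, x + y = b + b → ∀ i, x i + y i = b i + b i :=
    fun x y b hE i => congrFun hE i
  -- Some weight is nonzero at `z`, and its double is a sum of two exponents, whose z-coordinates
  -- are nonnegative.
  obtain ⟨b₀, hb₀, hb₀z⟩ : ∃ b ∈ B, 0 < b z := by
    by_contra! hno
    have hr2 : 2 ≤ r := by
      have h1 : j.val ≠ k.val := fun h' => hjk (Fin.ext h')
      have := j.isLt
      have := k.isLt
      omega
    obtain ⟨w, hw, hwz⟩ := h.nonvanishing hr2 z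
    obtain ⟨x, hx, y, hy, hxy, -⟩ := h.weight_split w hw
    have h1 := hsz x y w hxy z
    have := hno x hx
    have := hno y hy
    have := hnonneg x hx
    have := hnonneg y hy
    exact hwz (by linarith)
  -- the exponents with largest and with smallest positive `z`-coordinate have `z`-coordinate one
  have hle : ∀ b ∈ B, b z ≤ 1 := by
    obtain ⟨b₁, hb₁, hmax₁⟩ := B.exists_max_image (fun b => b z) ⟨b₀, hb₀⟩
    obtain ⟨b₂, hb₂, hmax₂⟩ := (B.filter fun b => b z = b₁ z).exists_max_image
      (fun b => dimForm d b b) ⟨b₁, by simp [hb₁]⟩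
    simp only [Finset.mem_filter] at hb₂ hmax₂
    obtain ⟨hb₂, hb₂z⟩ := hb₂
    have hz₁ : 0 < b₁ z := hb₀z.trans_le (hmax₁ b₀ hb₀)
    obtain ⟨-, hb₂s, -⟩ := hpos b₂ hb₂ (hb₂z ▸ hz₁)
    have h1 : b₁ z = 1 := by
      by_contra hne
      obtain ⟨x, hx, y, hy, hxy, hxb, -⟩ := h.exists_split_of_total hb₂ hb₂
        (hnorm b₂ hb₂ (hb₂z ▸ hz₁))
        (fun h0 => by
          have := congrFun h0 z
          simp only [Pi.add_apply, Pi.zero_apply] at this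
          linarith)
        (fun hE => by
          rw [htot] at hE
          exact hne (by linarith))
      have hs := hsz x y b₂ hxy z
      have hx₁ := hmax₁ x hx
      have hy₁ := hmax₁ y hy
      exact hxb (eq_of_add_eq_two (dimForm_comm d) (hmax₂ x ⟨hx, by linarith⟩)
        (hmax₂ y ⟨hy, by linarith⟩) (hpd x y) hxy)
    intro b hb
    rw [← h1]
    exact hmax₁ b hb
  have hge : ∀ b ∈ B, 0 < b z → 1 ≤ b z := by
    obtain ⟨b₁, hb₁, hmin₁⟩ := (B.filter fun b => 0 < b z).exists_min_image (fun b => b z)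
      ⟨b₀, by simp [hb₀, hb₀z]⟩
    simp only [Finset.mem_filter] at hb₁ hmin₁
    obtain ⟨b₂, hb₂, hmax₂⟩ := (B.filter fun b => b z = b₁ z).exists_max_image
      (fun b => dimForm d b b) ⟨b₁, by simp [hb₁]⟩
    simp only [Finset.mem_filter] at hb₂ hmax₂
    obtain ⟨hb₂, hb₂z⟩ := hb₂
    obtain ⟨hb₁, hz₁⟩ := hb₁
    have hz₂ : 0 < b₂ z := hb₂z ▸ hz₁
    obtain ⟨-, hb₂s, n, hn⟩ := hpos b₂ hb₂ hz₂
    have h1 : 1 ≤ b₁ z := by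
      by_contra! hlt
      obtain ⟨x, hx, y, hy, hxy, hxb, -⟩ := h.exists_split_of_total hb₂ hb₂ (hnorm b₂ hb₂ hz₂)
        (fun h0 => by
          have := congrFun h0 z
          simp only [Pi.add_apply, Pi.zero_apply] at this
          linarith)
        (fun hE => by
          rw [htot] at hE
          linarith)
      have hs := hsz x y b₂ hxy
      have hl := congrArg total hxy
      rw [map_add, map_add, htot b₂] at hl
      -- A part with z-coordinate zero is impossible: -e_j - e_k would give its partner an odd
      -- k-coordinate, and a part of total zero would push its partner's total below -2.
      have hside : ∀ u ∈ B, ∀ v ∈ B, (∀ i, u i + v i = b₂ i + b₂ i) →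
          total u + total v = b₂ z + (b₂ j + b₂ k) + (b₂ z + (b₂ j + b₂ k)) → 0 < u z := by
        intro u hu v hv huv hl'
        rcases hBz u hu with ⟨hu0, rfl | hu1⟩ | ⟨hu0, -⟩
        · exfalso
          have h1 := huv z
          have h2 := huv k
          rw [hu0] at h1
          obtain ⟨-, -, m, hm⟩ := hpos v hv (by linarith)
          simp [hjk.symm, hm, hn] at h2
          have : (-1 : ℤ) + 2 * m = 2 * n + 2 * n := by exact_mod_cast h2
          omega
        · exfalso
          have := hlow v hv
          linarith
        · exact hu0
      have hxz := hside x hx y hy hs hl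
      have hyz := hside y hy x hx (fun i => by rw [add_comm, hs i]) (by rw [add_comm, hl])
      have h2 := hmin₁ x ⟨hx, hxz⟩
      have h3 := hmin₁ y ⟨hy, hyz⟩
      have h4 := hs z
      exact hxb (eq_of_add_eq_two (dimForm_comm d) (hmax₂ x ⟨hx, by linarith⟩)
        (hmax₂ y ⟨hy, by linarith⟩) (hpd x y) hxy)
    intro b hb hbz
    exact h1.trans (hmin₁ b ⟨hb, hbz⟩)
  have hone : ∀ b ∈ B, 0 < b z → b z = 1 := fun b hb hbz => le_antisymm (hle b hb) (hge b hb hbz)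
  -- On the segment b_z = 1, b_j + b_k = -2 the k-coordinate determines the exponent, so an end
  -- point is not a midpoint and its double must be prescribed.
  have hvertex : ∀ b ∈ B, b z = 1 →
      (∀ x ∈ B, ∀ y ∈ B, x z = 1 → y z = 1 → x k + y k = b k + b k → x k = b k) → b ∈ W := by
    intro b hb hbz hext_k
    by_contra hno
    obtain ⟨x, hx, y, hy, hxy, hxb, -⟩ := h.exists_split hb hb (hnorm b hb (by linarith))
        (fun h0 => by
          have := congrFun h0 z
          simp only [Pi.add_apply, Pi.zero_apply] at this
          linarith)
        (fun w hw hE => hno (by rw [eq_of_add_self_eq hE]; exact hw))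
    have hs := hsz x y b hxy
    have h1 := hle x hx
    have h2 := hle y hy
    have h3 := hs z
    have hxz : x z = 1 := by linarith
    have hxk := hext_k x hx y hy hxz (by linarith) (hs k)
    obtain ⟨-, h4, -⟩ := hpos x hx (by linarith)
    obtain ⟨-, h5, -⟩ := hpos b hb (by linarith)
    exact hxb (hext x b (by linarith) (by linarith) hxk)
  have hweight : ∀ w ∈ W, w z = 1 → -2 ≤ w k ∧ w k ≤ 0 := by
    intro w hw hwz
    rcases h.weight w hw with ⟨i, rfl⟩ | ⟨i, l, m, hmi, hml, rfl⟩
    · simp only [Pi.single_apply] at hwz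
      split_ifs at hwz <;> norm_num at hwz
    · have hm : m = z := by
        by_contra hne
        simp only [Pi.sub_apply, Pi.single_apply, if_neg (Ne.symm hne)] at hwz
        split_ifs at hwz <;> norm_num at hwz
      subst hm
      simp only [Pi.sub_apply, Pi.single_apply, if_neg hzk.symm]
      split_ifs <;> norm_num
  have hshape : ∀ b ∈ B, 0 < b z →
      b = Pi.single z 1 + Pi.single j (-2) ∨ b = Pi.single z 1 + Pi.single k (-2) := by
    have hup : ∀ b ∈ B, 0 < b z → b k ≤ 0 := by
      obtain ⟨b₁, hb₁, hmax₁⟩ := (B.filter fun b => 0 < b z).exists_max_image (fun b => b k)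
        ⟨b₀, by simp [hb₀, hb₀z]⟩
      simp only [Finset.mem_filter] at hb₁ hmax₁
      have h1 : b₁ ∈ W := hvertex b₁ hb₁.1 (hone b₁ hb₁.1 hb₁.2) fun x hx y hy hxz hyz hE => by
        have := hmax₁ x ⟨hx, by linarith⟩
        have := hmax₁ y ⟨hy, by linarith⟩
        linarith
      intro b hb hbz
      exact (hmax₁ b ⟨hb, hbz⟩).trans (hweight b₁ h1 (hone b₁ hb₁.1 hb₁.2)).2
    have hdown : ∀ b ∈ B, 0 < b z → -2 ≤ b k := by
      obtain ⟨b₁, hb₁, hmin₁⟩ := (B.filter fun b => 0 < b z).exists_min_image (fun b => b k)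
        ⟨b₀, by simp [hb₀, hb₀z]⟩
      simp only [Finset.mem_filter] at hb₁ hmin₁
      have h1 : b₁ ∈ W := hvertex b₁ hb₁.1 (hone b₁ hb₁.1 hb₁.2) fun x hx y hy hxz hyz hE => by
        have := hmin₁ x ⟨hx, by linarith⟩
        have := hmin₁ y ⟨hy, by linarith⟩
        linarith
      intro b hb hbz
      exact (hweight b₁ h1 (hone b₁ hb₁.1 hb₁.2)).1.trans (hmin₁ b ⟨hb, hbz⟩)
    intro b hb hbz
    obtain ⟨-, h1, n, hn⟩ := hpos b hb hbz
    have h2 := hup b hb hbz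
    have h3 := hdown b hb hbz
    have h4 := hone b hb hbz
    rw [hn] at h2 h3
    have h2' : 2 * n ≤ 0 := by exact_mod_cast h2
    have h3' : -2 ≤ 2 * n := by exact_mod_cast h3
    obtain rfl | rfl : n = 0 ∨ n = -1 := by omega
    · left
      norm_num at hn
      exact hext _ _ (by simp [hzj, h4]) (by simp [hzj.symm]; linarith)
        (by simp [hzk.symm, hjk.symm, hn])
    · right
      norm_num at hn
      exact hext _ _ (by simp [hzk, h4]) (by simp [hzj.symm, hjk]; linarith)
        (by simp [hzk.symm, hn])
  -- The two vectors have product -1 and their sum e_z - e_j - e_k is not prescribed. A second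
  -- decomposition needs a different exponent with positive z-coordinate.
  have hu_of : Pi.single z 1 + Pi.single k (-2) ∈ B → Pi.single z 1 + Pi.single j (-2) ∈ B := by
    intro hu
    obtain ⟨x, hx, y, hy, hxy, -, hxu, -, hyu⟩ := h.exists_split_of_total ha hu
      (by
        rw [hform]
        simp [hzj, hzk, hzj.symm, hzk.symm, hjk, hjk.symm]
        norm_num)
      (fun h0 => by
        have := congrFun h0 z
        simp [hzj, hzk] at this)
      (by simp [total_single])
    have hs := congrFun hxy z
    simp [hzj, hzk] at hs
    by_cases hxz : 0 < x z
    · exact (hshape x hx hxz).resolve_right hxu ▸ hx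
    · exact (hshape y hy (by linarith)).resolve_right hyu ▸ hy
  have hv_of : Pi.single z 1 + Pi.single j (-2) ∈ B → Pi.single z 1 + Pi.single k (-2) ∈ B := by
    intro hv
    obtain ⟨x, hx, y, hy, hxy, -, hxu, -, hyu⟩ := h.exists_split_of_total hna hv
      (by
        rw [hform]
        simp [hzj, hzk, hzj.symm, hzk.symm, hjk, hjk.symm]
        norm_num)
      (fun h0 => by
        have := congrFun h0 z
        simp [hzj, hzk] at this)
      (by simp [total_single])
    have hs := congrFun hxy z
    simp [hzj, hzk] at hs
    by_cases hxz : 0 < x z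
    · exact (hshape x hx hxz).resolve_left hxu ▸ hx
    · exact (hshape y hy (by linarith)).resolve_left hyu ▸ hy
  have huv : Pi.single z 1 + Pi.single j (-2) ∈ B ∧ Pi.single z 1 + Pi.single k (-2) ∈ B := by
    rcases hshape b₀ hb₀ hb₀z with rfl | rfl
    · exact ⟨hb₀, hv_of hb₀⟩
    · exact ⟨hu_of hb₀, hb₀⟩
  have hBiff : ∀ b, b ∈ B ↔ b = Pi.single j (-1) + Pi.single k (-1) ∨
      b = Pi.single j (-1) + Pi.single k 1 ∨ b = Pi.single j 1 + Pi.single k (-1) ∨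
      b = Pi.single z 1 + Pi.single j (-2) ∨ b = Pi.single z 1 + Pi.single k (-2) := by
    intro b
    constructor
    · intro hb
      rcases hB b hb with h' | h' | h' | ⟨h1, -, h2, -⟩
      · exact Or.inl h'
      · exact Or.inr (Or.inl h')
      · exact Or.inr (Or.inr (Or.inl h'))
      · rw [htot] at h1
        exact Or.inr (Or.inr (Or.inr (hshape b hb (by linarith))))
    · rintro (rfl | rfl | rfl | rfl | rfl)
      exacts [hc, ha, hna, huv.1, huv.2]
  have hk_val : ∀ x ∈ B, x z = 1 → x k = 0 ∨ x k = -2 := by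
    intro x hx hxz
    rcases hshape x hx (by linarith) with rfl | rfl
    · left
      simp [hzk.symm, hjk.symm]
    · right
      simp [hzk.symm]
  refine ⟨hBiff, fun w => ⟨fun hw => ?_, ?_⟩⟩
  · obtain ⟨x, hx, y, hy, hxy, hne⟩ := h.weight_split w hw
    have hl := congrArg total hxy
    rw [map_add, map_add, h.total_weight hw] at hl
    have h1 := hsz x y w hxy j
    have h2 := hsz x y w hxy k
    have h3 := hsz x y w hxy z
    rw [hform] at hne
    rcases (hBiff x).1 hx with rfl | rfl | rfl | rfl | rfl <;>
      rcases (hBiff y).1 hy with rfl | rfl | rfl | rfl | rfl <;>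
      simp only [map_add, total_single] at hl <;>
      first
        | (exfalso; norm_num at hl; done)
        | (simp [hjk, hjk.symm, hzj, hzk, hzj.symm, hzk.symm] at h1 h2 h3 hne
           first
            | exact Or.inl (hext _ _ (by simp [hzj]; linarith) (by simp; linarith)
                (by simp [hjk.symm]; linarith))
            | exact Or.inr (Or.inl (hext _ _ (by simp [hzk]; linarith) (by simp [hjk]; linarith)
                (by simp; linarith)))
            | exact Or.inr (Or.inr (Or.inl (eq_of_add_self_eq hxy).symm))
            | exact Or.inr (Or.inr (Or.inr (eq_of_add_self_eq hxy).symm)))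
        | (exfalso; simp [hjk, hjk.symm, hzj, hzk, hzj.symm, hzk.symm] at hne)
  · rintro (rfl | rfl | rfl | rfl)
    · exact h.neg_mem j hdj.ge
    · exact h.neg_mem k hdk.ge
    · refine hvertex _ huv.1 (by simp [hzj]) fun x hx y hy hxz hyz hE => ?_
      simp [hzk.symm, hjk.symm] at hE ⊢
      rcases hk_val x hx hxz with h1 | h1 <;> rcases hk_val y hy hyz with h2 | h2 <;> linarith
    · refine hvertex _ huv.2 (by simp [hzk]) fun x hx y hy hxz hyz hE => ?_
      simp [hzk.symm] at hE ⊢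
      rcases hk_val x hx hxz with h1 | h1 <;> rcases hk_val y hy hyz with h2 | h2 <;> linarith

end IsArrangement

end Soliton

end

/-! ### From superpotentials to arrangements and coefficient equations -/

noncomputable section

namespace Soliton

section Reduction

variable {r : ℕ}

/-- The exponent `½(d + (b, 0))`. -/
def halfVec (d : Fin r → ℕ) (b : Fin r → ℝ) : Ext r := (1 / 2 : ℝ) • (extDim d + (b, 0))

theorem halfShift_eq (d : Fin r → ℕ) (B : Set (Fin r → ℝ)) : halfShift d B = halfVec d '' B := rfl

theorem halfVec_fst (d : Fin r → ℕ) (b : Fin r → ℝ) (i : Fin r) :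
    (halfVec d b).1 i = (d i + b i) / 2 := by
  simp [halfVec, extDim]
  ring

theorem halfVec_snd (d : Fin r → ℕ) (b : Fin r → ℝ) : (halfVec d b).2 = -1 := by
  simp [halfVec, extDim]

theorem halfVec_injective (d : Fin r → ℕ) : Function.Injective (halfVec d) := by
  intro a b h
  funext i
  have := congrFun (congrArg Prod.fst h) i
  rw [halfVec_fst, halfVec_fst] at this
  linarith

theorem exists_halfVec_eq (d : Fin r → ℕ) {c : Ext r} (hc : c.2 = -1) : ∃ b, halfVec d b = c := by
  refine ⟨fun i => 2 * c.1 i - d i, Prod.ext (funext fun i => ?_) ?_⟩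
  · rw [halfVec_fst]
    ring
  · rw [halfVec_snd, hc]

/-- The exponent `d + (½ v, 0)`. -/
def fullVec (d : Fin r → ℕ) (v : Fin r → ℝ) : Ext r := extDim d + ((1 / 2 : ℝ) • v, 0)

theorem halfVec_add (d : Fin r → ℕ) (a b : Fin r → ℝ) :
    halfVec d a + halfVec d b = fullVec d (a + b) := by
  refine Prod.ext (funext fun i => ?_) ?_
  · simp [halfVec, fullVec, extDim]
    ring
  · simp [halfVec, fullVec, extDim]
    norm_num

theorem fullVec_injective (d : Fin r → ℕ) : Function.Injective (fullVec d) := by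
  intro a b h
  have := congrArg Prod.fst h
  simp only [fullVec, Prod.fst_add, add_right_inj] at this
  exact smul_right_injective _ (by norm_num) this

theorem fullVec_zero (d : Fin r → ℕ) : fullVec d 0 = extDim d := by
  refine Prod.ext (funext fun i => ?_) ?_ <;> simp [fullVec]

theorem fullVec_add_self (d : Fin r → ℕ) (w : Fin r → ℝ) :
    fullVec d (w + w) = extDim d + (w, 0) := by
  refine Prod.ext (funext fun i => ?_) ?_
  · simp [fullVec]
    ring
  · simp [fullVec]

theorem J_halfVec {d : Fin r → ℕ} (hd : ∀ i, 1 ≤ d i) (a b : Fin r → ℝ) :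
    J d (halfVec d a) (halfVec d b) = (1 - dimForm d a b) / 4 := by
  have h : ∀ a, centre d (halfVec d a) = (1 / 2 : ℝ) • a := by
    intro a
    funext i
    rw [centre_apply, halfVec_fst, halfVec_snd]
    simp
    ring
  rw [J_eq_centre hd, h, h, halfVec_snd, halfVec_snd, map_smul, map_smul, LinearMap.smul_apply]
  simp only [smul_eq_mul]
  ring

/-- The equations on the coefficients `γ` of a superpotential with exponents `½(d + (β, 0))`. -/
def CoeffEq {ι : Type*} [Fintype ι] (d : Fin r → ℕ) (A : (Fin r → ℝ) →₀ ℝ) (E : ℝ)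
    (β : ι → Fin r → ℝ) (γ : ι → ℝ) : Prop :=
  ∑ i, ∑ j, Finsupp.single (β i + β j) (γ i * γ j * (1 - dimForm d (β i) (β j))) =
    Finsupp.single 0 (4 * E) + ∑ w ∈ A.support, Finsupp.single (w + w) (4 * A w)

theorem isSuperpotential_iff_squareCoeff (d : Fin r → ℕ) (A : (Fin r → ℝ) →₀ ℝ)
    {S : (Fin r → ℝ) → ℝ} (hS : ∀ q, S q = weightSum A q) (E : ℝ) (f : Ext r →₀ ℝ) :
    IsSuperpotential d S E (expSum f) ↔ squareCoeff d f = targetCoeff d A E := by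
  rw [isSuperpotential_iff d A hS]
  simp only [← squareCoeff_apply]
  exact ⟨Finsupp.ext, fun h b => by rw [h]⟩

/-- Both sides of the equation are supported in the image of the injective map `fullVec`, so the
identity can be pulled back along it; the factor 1/4 from `J_halfVec` is absorbed in `CoeffEq`. -/
theorem admitsSuperpotential_iff_coeffEq {d : Fin r → ℕ} (hd : ∀ i, 1 ≤ d i)
    (A : (Fin r → ℝ) →₀ ℝ) {S : (Fin r → ℝ) → ℝ} (hS : ∀ q, S q = weightSum A q) (E : ℝ)
    {C : Finset (Ext r)} {ι : Type*} [Fintype ι] {β : ι → Fin r → ℝ} (hβ : Function.Injective β)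
    (hC : (C : Set (Ext r)) = halfShift d (Set.range β)) :
    AdmitsSuperpotential d S E C ↔ ∃ γ : ι → ℝ, (∀ i, γ i ≠ 0) ∧ CoeffEq d A E β γ := by
  classical
  have hinj : Function.Injective fun i => halfVec d (β i) := (halfVec_injective d).comp hβ
  have hCeq : C = Finset.univ.map ⟨_, hinj⟩ := by
    rw [← Finset.coe_inj, hC, halfShift_eq, ← Set.range_comp]
    simp [Function.comp_def]
  have hiff : ∀ f : Ext r →₀ ℝ, f.support = C →
      (IsSuperpotential d S E (expSum f) ↔ CoeffEq d A E β fun i => f (halfVec d (β i))) := by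
    intro f hf
    rw [isSuperpotential_iff_squareCoeff d A hS, CoeffEq]
    have hsq : squareCoeff d f = Finsupp.mapDomain (fullVec d) ((1 / 4 : ℝ) • ∑ i, ∑ j,
        Finsupp.single (β i + β j) (f (halfVec d (β i)) * f (halfVec d (β j)) *
          (1 - dimForm d (β i) (β j)))) := by
      rw [squareCoeff, hf, hCeq]
      simp only [Finset.sum_map, Function.Embedding.coeFn_mk, Finset.smul_sum, Finsupp.smul_single,
        Finsupp.mapDomain_finsetSum, Finsupp.mapDomain_single, halfVec_add, J_halfVec hd]
      refine Finset.sum_congr rfl fun i _ => Finset.sum_congr rfl fun j _ => ?_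
      congr 1
      simp only [smul_eq_mul]
      ring
    have htarget : targetCoeff d A E = Finsupp.mapDomain (fullVec d) ((1 / 4 : ℝ) •
        (Finsupp.single 0 (4 * E) + ∑ w ∈ A.support, Finsupp.single (w + w) (4 * A w))) := by
      simp only [targetCoeff, smul_add, Finset.smul_sum, Finsupp.smul_single, Finsupp.mapDomain_add,
        Finsupp.mapDomain_finsetSum, Finsupp.mapDomain_single, fullVec_zero, fullVec_add_self,
        smul_eq_mul, one_div, inv_mul_cancel_left₀ (four_ne_zero : (4 : ℝ) ≠ 0)]
    rw [hsq, htarget, (Finsupp.mapDomain_injective (fullVec_injective d)).eq_iff]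
    exact (smul_right_injective _ (by norm_num : (1 / 4 : ℝ) ≠ 0)).eq_iff
  constructor
  · rintro ⟨-, f, hf, hsup⟩
    refine ⟨_, fun i => ?_, (hiff f hf).1 hsup⟩
    rw [← Finsupp.mem_support_iff, hf, hCeq]
    simp
  · rintro ⟨γ, hγ, hE⟩
    refine ⟨?_, (Finsupp.equivFunOnFinite.symm γ).embDomain ⟨_, hinj⟩, ?_, ?_⟩
    · rw [hCeq]
      simp only [Finset.mem_map, Finset.mem_univ, true_and, Function.Embedding.coeFn_mk, not_exists]
      intro i h0
      have := congrArg Prod.snd h0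
      rw [halfVec_snd] at this
      norm_num at this
    · rw [Finsupp.support_embDomain, hCeq]
      congr 1
      ext i
      simp [hγ i]
    · rw [hiff]
      · convert hE using 2 with i
        exact Finsupp.embDomain_apply_self ⟨fun i => halfVec d (β i), hinj⟩ _ i
      · rw [Finsupp.support_embDomain, hCeq]
        congr 1
        ext i
        simp [hγ i]

/-- The exponents of a superpotential form an arrangement. -/
theorem exists_isArrangement {d : Fin r → ℕ} (hd : ∀ i, 1 ≤ d i)
    (hdim : ∀ i j, d i = 1 → d j = 1 → i = j) {A : (Fin r → ℝ) →₀ ℝ}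
    (hweight : ∀ w ∈ A.support, (∃ i, w = Pi.single i (-1)) ∨
      ∃ i l k, k ≠ i ∧ k ≠ l ∧ w = Pi.single k 1 - Pi.single i 1 - Pi.single l 1)
    (hneg : ∀ j, 2 ≤ d j → Pi.single j (-1) ∈ A.support)
    (hW : 2 ≤ r → ∀ i, ∃ w ∈ A.support, w i ≠ 0) {S : (Fin r → ℝ) → ℝ}
    (hS : ∀ q, S q = weightSum A q) {E : ℝ} (hE : E ≠ 0) {C : Finset (Ext r)}
    (hC : AdmitsSuperpotential d S E C) :
    ∃ B : Finset (Fin r → ℝ), (C : Set (Ext r)) = halfShift d B ∧ IsArrangement d A.support B := by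
  classical
  obtain ⟨h0, f, hf, hsup⟩ := hC
  rw [isSuperpotential_iff d A hS, hf] at hsup
  -- All weights have coordinate sum -1, so the curvature cannot interfere with E at the exponent 𝐝.
  have hA0 : A 0 = 0 := by
    by_contra hne
    have h1 : total (0 : Fin r → ℝ) = -1 := by
      rcases hweight 0 (Finsupp.mem_support_iff.2 hne) with ⟨i, hi⟩ | ⟨i, l, k, -, -, hi⟩
      · rw [hi, total_single]
      · rw [hi, map_sub, map_sub, total_single, total_single, total_single]
        norm_num
    rw [map_zero] at h1
    norm_num at h1
  have hfull : ∀ v, targetCoeff d A E (fullVec d v) =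
      (if v = 0 then E else 0) + A ((1 / 2 : ℝ) • v) := by
    intro v
    have h1 : fullVec d v = extDim d ↔ v = 0 := by
      rw [← fullVec_zero, (fullVec_injective d).eq_iff]
    have h2 : (fullVec d v).2 = -2 := by simp [fullVec, extDim]
    simp only [targetCoeff_apply, h1, h2, if_true]
    simp [fullVec]
  have hex : ∀ v, targetCoeff d A E v ≠ 0 → ∃ x ∈ C, ∃ y ∈ C, x + y = v ∧ J d x y ≠ 0 := by
    intro v hv
    rw [← hsup] at hv
    obtain ⟨c, hc, hne⟩ := Finset.exists_ne_zero_of_sum_ne_zero hv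
    refine ⟨c, hc, v - c, ?_, by abel, right_ne_zero_of_mul hne⟩
    rw [← hf, Finsupp.mem_support_iff]
    exact right_ne_zero_of_mul (left_ne_zero_of_mul hne)
  have hsplit : Splitting C (J d) fun v => targetCoeff d A E v ≠ 0 :=
    splitting_of_sum f (fun c => by rw [← hf, Finsupp.mem_support_iff]) (J_comm d)
      fun v hv => by rw [hsup v, not_not.1 hv]
  have hsnd := snd_eq_neg_one hd h0 hsplit
    (fun v hv => by
      by_contra hne
      refine hv ?_
      rw [targetCoeff_apply, if_neg hne, if_neg, add_zero]
      rintro rfl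
      exact hne rfl)
    (by
      obtain ⟨x, hx, y, hy, hxy, -⟩ := hex (fullVec d 0) (by
        rw [hfull, smul_zero, hA0]
        simpa using hE)
      exact ⟨x, hx, y, hy, by rw [hxy, fullVec_zero]⟩)
  refine ⟨C.preimage (halfVec d) (halfVec_injective d).injOn, ?_, ?_⟩
  · rw [halfShift_eq, Finset.coe_preimage, Set.image_preimage_eq_inter_range]
    refine (Set.inter_eq_left.2 fun c hc => ?_).symm
    exact exists_halfVec_eq d (hsnd c hc)
  have hlift : ∀ v, targetCoeff d A E (fullVec d v) ≠ 0 → ∃ a, halfVec d a ∈ C ∧ ∃ b, halfVec d b ∈ C ∧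
      a + b = v ∧ dimForm d a b ≠ 1 := by
    intro v hv
    obtain ⟨x, hx, y, hy, hxy, hne⟩ := hex _ hv
    obtain ⟨a, rfl⟩ := exists_halfVec_eq d (hsnd x hx)
    obtain ⟨b, rfl⟩ := exists_halfVec_eq d (hsnd y hy)
    rw [halfVec_add] at hxy
    refine ⟨a, hx, b, hy, fullVec_injective d hxy, fun h' => hne ?_⟩
    rw [J_halfVec hd, h']
    norm_num
  have hhalf : ∀ w : Fin r → ℝ, (1 / 2 : ℝ) • (w + w) = w := fun w => by
    rw [← two_smul ℝ w, smul_smul]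
    norm_num
  refine ⟨hd, hdim, hweight, hneg, hW, ?_, ?_, ?_⟩
  · intro a ha b hb hab hP
    rw [Finset.mem_preimage] at ha hb
    obtain ⟨x, hx, y, hy, hxy, hxa, hxb⟩ := hsplit _ ha _ hb
      (by
        rw [J_halfVec hd]
        exact div_ne_zero hab (by norm_num))
      (by
        push Not at hP ⊢
        rw [halfVec_add, hfull, if_neg hP.1, zero_add]
        by_contra hne
        refine hP.2 _ (Finsupp.mem_support_iff.2 hne) ?_
        rw [← smul_add, hhalf])
    obtain ⟨x, rfl⟩ := exists_halfVec_eq d (hsnd x hx)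
    obtain ⟨y, rfl⟩ := exists_halfVec_eq d (hsnd y hy)
    rw [halfVec_add, halfVec_add] at hxy
    exact ⟨x, Finset.mem_preimage.2 hx, y, Finset.mem_preimage.2 hy, fullVec_injective d hxy,
      fun h' => hxa (by rw [h']), fun h' => hxb (by rw [h'])⟩
  · obtain ⟨a, ha, b, hb, hab, -⟩ := hlift 0 (by
      rw [hfull, smul_zero, hA0]
      simpa using hE)
    exact ⟨a, Finset.mem_preimage.2 ha, b, Finset.mem_preimage.2 hb, hab⟩
  · intro w hw
    obtain ⟨a, ha, b, hb, hab⟩ := hlift (w + w) (by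
      rw [hfull, hhalf, if_neg, zero_add]
      · exact Finsupp.mem_support_iff.1 hw
      · intro h0
        have : w = 0 := eq_of_add_self_eq (by rw [h0, add_zero])
        rw [this] at hw
        exact Finsupp.mem_support_iff.1 hw hA0)
    exact ⟨a, Finset.mem_preimage.2 ha, b, Finset.mem_preimage.2 hb, hab⟩

end Reduction

end Soliton

end

/-! ### Invariance under renumbering of the summands -/

noncomputable section

namespace Soliton

section Renumbering

variable {r s : ℕ} (e : Fin r ≃ Fin s)

theorem permVec_apply (v : Fin r → ℝ) (i : Fin s) : permVec e v i = v (e.symm i) := rfl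

theorem permVec_single (i : Fin r) (x : ℝ) :
    permVec e (Pi.single i x) = Pi.single (e i) x := by
  funext j
  simp only [permVec_apply, Pi.single_apply, Equiv.symm_apply_eq]

theorem permVec_add (v w : Fin r → ℝ) : permVec e (v + w) = permVec e v + permVec e w := rfl

theorem permVec_zero : permVec e 0 = 0 := rfl

theorem permCoeff_apply (A : (Fin r → ℝ) →₀ ℝ) (v : Fin r → ℝ) :
    permCoeff e A (permVec e v) = A v := by
  rw [permCoeff, Finsupp.equivMapDomain_apply, Equiv.symm_apply_apply]

theorem support_permCoeff (A : (Fin r → ℝ) →₀ ℝ) :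
    (permCoeff e A).support = A.support.map (permVec e).toEmbedding := rfl

theorem coe_permExp (C : Finset (Ext r)) :
    (permExp e C : Set (Ext s)) = (permVec e).prodCongr (Equiv.refl ℝ) '' C := by
  rw [permExp, Finset.coe_map]
  rfl

theorem image_halfShift (d : Fin r → ℕ) (B : Set (Fin r → ℝ)) :
    (permVec e).prodCongr (Equiv.refl ℝ) '' halfShift d B =
      halfShift (permDim e d) (permVec e '' B) := by
  rw [halfShift_eq, halfShift_eq, Set.image_image, Set.image_image]
  refine Set.image_congr fun b _ => ?_
  refine Prod.ext (funext fun i => ?_) ?_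
  · simp [halfVec, extDim, permDim, permVec_apply]
  · simp [halfVec, extDim]

theorem eq_halfShift_of_permExp {d : Fin r → ℕ} {C : Finset (Ext r)} {B : Set (Fin s → ℝ)}
    (h : (permExp e C : Set (Ext s)) = halfShift (permDim e d) B) :
    (C : Set (Ext r)) = halfShift d ((permVec e).symm '' B) := by
  refine ((permVec e).prodCongr (Equiv.refl ℝ)).injective.image_injective ?_
  rw [← coe_permExp, h, image_halfShift, Equiv.image_symm_image]

theorem dimForm_permVec (d : Fin r → ℕ) (a b : Fin r → ℝ) :
    dimForm (permDim e d) (permVec e a) (permVec e b) = dimForm d a b := by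
  rw [dimForm_apply, dimForm_apply]
  exact e.symm.sum_comp fun i => a i * b i / (d i : ℝ)

/-- The two systems correspond under the injective pushforward along `permVec`, which preserves the
inner products. -/
theorem coeffEq_perm {ι : Type*} [Fintype ι] (d : Fin r → ℕ) (A : (Fin r → ℝ) →₀ ℝ) (E : ℝ)
    (β : ι → Fin r → ℝ) (γ : ι → ℝ) :
    CoeffEq (permDim e d) (permCoeff e A) E (fun i => permVec e (β i)) γ ↔ CoeffEq d A E β γ := by
  rw [CoeffEq, CoeffEq, ← (Finsupp.mapDomain_injective (permVec e).injective).eq_iff]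
  simp only [Finsupp.mapDomain_add, Finsupp.mapDomain_finsetSum, Finsupp.mapDomain_single,
    permVec_add, permVec_zero, support_permCoeff, Finset.sum_map, Equiv.coe_toEmbedding,
    permCoeff_apply, dimForm_permVec]

theorem admitsSuperpotential_iff_perm {d : Fin r → ℕ} (hd : ∀ i, 1 ≤ d i)
    (A : (Fin r → ℝ) →₀ ℝ) {S : (Fin r → ℝ) → ℝ} (hS : ∀ q, S q = weightSum A q) (E : ℝ)
    {C : Finset (Ext r)} {ι : Type*} [Fintype ι] {β : ι → Fin s → ℝ} (hβ : Function.Injective β)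
    (hC : (permExp e C : Set (Ext s)) = halfShift (permDim e d) (Set.range β)) :
    AdmitsSuperpotential d S E C ↔
      ∃ γ : ι → ℝ, (∀ i, γ i ≠ 0) ∧ CoeffEq (permDim e d) (permCoeff e A) E β γ := by
  have h1 := eq_halfShift_of_permExp e hC
  rw [← Set.range_comp] at h1
  rw [admitsSuperpotential_iff_coeffEq hd A hS E ((permVec e).symm.injective.comp hβ) h1]
  refine exists_congr fun γ => and_congr_right fun _ => ?_
  rw [← coeffEq_perm e]
  simp

end Renumbering

end Soliton

end

/-! ### Coefficient equations for the arrangements of fixed rank -/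

noncomputable section

namespace Soliton

section LowRank

theorem coeffEq_trivial {A : (Fin 1 → ℝ) →₀ ℝ} (hA : (A.support : Set (Fin 1 → ℝ)) = ∅) {E : ℝ}
    (γ : Fin 1 → ℝ) : CoeffEq ![1] A E ![![0]] γ ↔ γ 0 ^ 2 = 4 * E := by
  rw [Finset.coe_eq_empty] at hA
  have h0 : (![0] : Fin 1 → ℝ) = 0 := by simp
  simp only [CoeffEq, hA, Finset.univ_unique, Fin.default_eq_zero, Finset.sum_singleton,
    Matrix.cons_val_zero, h0, add_zero, map_zero, sub_zero, mul_one, Finset.sum_empty, ← sq]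
  exact (Finsupp.single_injective 0).eq_iff

theorem coeffEq_bryant2 {A : (Fin 1 → ℝ) →₀ ℝ} (hA : (A.support : Set (Fin 1 → ℝ)) = ∅)
    (γ : Fin 2 → ℝ) : CoeffEq ![1] A (γ 0 * γ 1) ![![1], ![-1]] γ := by
  rw [Finset.coe_eq_empty] at hA
  have h0 : (![0] : Fin 1 → ℝ) = 0 := by simp
  simp [CoeffEq, hA, dimForm_apply, Fin.sum_univ_two, -Finsupp.single_mul, -Finsupp.single_sub,
    -Finsupp.single_neg, -Finsupp.single_add]
  rw [h0, ← Finsupp.single_add]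
  congr 1
  ring

/-- In dimension 4 the vector (-2) has norm one, so its square term drops out and only the exponents
0 and (-2) carry equations. -/
theorem coeffEq_bryant5 {A : (Fin 1 → ℝ) →₀ ℝ} (hA : (A.support : Set (Fin 1 → ℝ)) = {![-1]})
    {E : ℝ} (γ : Fin 2 → ℝ) :
    CoeffEq ![4] A E ![![0], ![-2]] γ ↔ γ 0 ^ 2 = 4 * E ∧ γ 0 * γ 1 = 2 * A ![-1] := by
  rw [Finset.coe_eq_singleton] at hA
  have h0 : (![0] : Fin 1 → ℝ) = 0 := by simp
  simp [CoeffEq, hA, dimForm_apply, Fin.sum_univ_two, -Finsupp.single_mul, -Finsupp.single_sub,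
    -Finsupp.single_neg, -Finsupp.single_add]
  norm_num [-Finsupp.single_mul, -Finsupp.single_sub, -Finsupp.single_neg, -Finsupp.single_add]
  rw [h0]
  constructor
  · intro h
    have h1 := DFunLike.congr_fun h 0
    have h2 := DFunLike.congr_fun h ![-2]
    simp [-Finsupp.single_mul] at h1 h2
    exact ⟨by linarith, by linarith⟩
  · rintro ⟨h1, h2⟩
    rw [← h1, show 4 * A ![-1] = γ 0 * γ 1 + γ 1 * γ 0 by linarith, Finsupp.single_add, ← sq]
    abel

theorem coeffEq_warped {A : (Fin 2 → ℝ) →₀ ℝ}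
    (hA : (A.support : Set (Fin 2 → ℝ)) = {![-1, 0], ![0, -1]}) {E : ℝ} (γ : Fin 3 → ℝ) :
    CoeffEq ![2, 2] A E ![![-1, -1], ![-1, 1], ![1, -1]] γ ↔
      γ 1 * γ 2 = E ∧ γ 0 * γ 1 = 2 * A ![-1, 0] ∧ γ 0 * γ 2 = 2 * A ![0, -1] := by
  have hA' : A.support = {![-1, 0], ![0, -1]} := by exact_mod_cast hA
  have hne : (![-1, 0] : Fin 2 → ℝ) ∉ ({![0, -1]} : Finset (Fin 2 → ℝ)) := by simp
  have h0 : (![0, 0] : Fin 2 → ℝ) = 0 := by simp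
  rw [CoeffEq, hA', Finset.sum_insert hne]
  simp [dimForm_apply, Fin.sum_univ_three, -Finsupp.single_mul, -Finsupp.single_sub,
    -Finsupp.single_neg, -Finsupp.single_add]
  norm_num [-Finsupp.single_mul, -Finsupp.single_sub, -Finsupp.single_neg, -Finsupp.single_add]
  rw [h0]
  constructor
  · intro h
    have h1 := DFunLike.congr_fun h 0
    have h2 := DFunLike.congr_fun h ![-2, 0]
    have h3 := DFunLike.congr_fun h ![0, -2]
    simp [-Finsupp.single_mul] at h1 h2 h3
    exact ⟨by linarith, by linarith, by linarith⟩
  · rintro ⟨h1, h2, h3⟩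
    rw [show 4 * E = γ 1 * γ 2 * 2 + γ 2 * γ 1 * 2 by linarith,
      show 4 * A ![-1, 0] = γ 0 * γ 1 + γ 1 * γ 0 by linarith,
      show 4 * A ![0, -1] = γ 0 * γ 2 + γ 2 * γ 0 by linarith, Finsupp.single_add,
      Finsupp.single_add, Finsupp.single_add]
    abel

/-- Unit norms and unit products remove all but the listed terms. The one sum that is not
prescribed, (1, -1, -1), comes from two pairs of exponents, which must cancel: this is the last
equation. -/
theorem coeffEq_calabiNew {A : (Fin 3 → ℝ) →₀ ℝ}
    (hA : (A.support : Set (Fin 3 → ℝ)) = {![0, -1, 0], ![0, 0, -1], ![1, -2, 0], ![1, 0, -2]})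
    {E : ℝ} (γ : Fin 5 → ℝ) :
    CoeffEq ![1, 2, 2] A E
        ![![0, -1, -1], ![0, 1, -1], ![0, -1, 1], ![1, 0, -2], ![1, -2, 0]] γ ↔
      γ 1 * γ 2 = E ∧ γ 0 * γ 2 = 2 * A ![0, -1, 0] ∧ γ 0 * γ 1 = 2 * A ![0, 0, -1] ∧
        γ 4 ^ 2 = -2 * A ![1, -2, 0] ∧ γ 3 ^ 2 = -2 * A ![1, 0, -2] ∧
        γ 1 * γ 4 + γ 2 * γ 3 = 0 := by
  have hA' : A.support = {![0, -1, 0], ![0, 0, -1], ![1, -2, 0], ![1, 0, -2]} := by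
    rw [← Finset.coe_inj, hA]
    simp
  have h0 : (![0, 0, 0] : Fin 3 → ℝ) = 0 := by simp
  rw [CoeffEq, hA', Finset.sum_insert (by simp), Finset.sum_insert (by simp),
    Finset.sum_insert (by simp)]
  simp [dimForm_apply, Fin.sum_univ_three, Fin.sum_univ_five, -Finsupp.single_mul,
    -Finsupp.single_sub, -Finsupp.single_neg, -Finsupp.single_add]
  norm_num [-Finsupp.single_mul, -Finsupp.single_sub, -Finsupp.single_neg, -Finsupp.single_add]
  rw [h0]
  constructor
  · intro h
    have h1 := DFunLike.congr_fun h 0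
    have h2 := DFunLike.congr_fun h ![0, -2, 0]
    have h3 := DFunLike.congr_fun h ![0, 0, -2]
    have h4 := DFunLike.congr_fun h ![2, -4, 0]
    have h5 := DFunLike.congr_fun h ![2, 0, -4]
    have h6 := DFunLike.congr_fun h ![1, -1, -1]
    simp [-Finsupp.single_mul] at h1 h2 h3 h4 h5 h6
    exact ⟨by linarith, by linarith, by linarith, by linarith, by linarith, by linarith⟩
  · rintro ⟨h1, h2, h3, h4, h5, h6⟩
    rw [show 4 * E = γ 1 * γ 2 * 2 + γ 2 * γ 1 * 2 by linarith,
      show 4 * A ![0, -1, 0] = γ 0 * γ 2 + γ 2 * γ 0 by linarith,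
      show 4 * A ![0, 0, -1] = γ 0 * γ 1 + γ 1 * γ 0 by linarith,
      show 4 * A ![1, -2, 0] = -(γ 4 * γ 4 * 2) by linarith,
      show 4 * A ![1, 0, -2] = -(γ 3 * γ 3 * 2) by linarith,
      show γ 2 * γ 3 * 2 = -(γ 1 * γ 4 * 2) by linarith,
      show γ 3 * γ 2 * 2 = -(γ 4 * γ 1 * 2) by linarith, Finsupp.single_add,
      Finsupp.single_add, Finsupp.single_add, Finsupp.single_neg _ (γ 1 * γ 4 * 2),
      Finsupp.single_neg _ (γ 4 * γ 1 * 2)]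
    abel

/-- x²E = (xy)(xz) = 4ab. -/
theorem pos_of_mul_eq {x y z a b E : ℝ} (hx : x ≠ 0) (hE : y * z = E) (hy : x * y = 2 * a)
    (hz : x * z = 2 * b) (ha : 0 < a) (hb : 0 < b) : 0 < E := by
  have h1 : x ^ 2 * E = 4 * (a * b) := by
    rw [← hE]
    linear_combination (x * z) * hy + 2 * a * hz
  have h2 : 0 < x ^ 2 := by positivity
  have h3 := mul_pos ha hb
  by_contra h
  nlinarith

theorem exists_mul_eq {a b E : ℝ} (hE : 0 < E) (ha : 0 < a) (hb : 0 < b) :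
    ∃ x y z : ℝ, 0 < x ∧ 0 < y ∧ 0 < z ∧ y * z = E ∧ x * y = 2 * a ∧ x * z = 2 * b := by
  have hpos : 0 < 4 * (a * b) / E := by positivity
  -- x² = 4ab/E is forced by the three equations; `y` and `z` are then quotients.
  have hx := Real.sqrt_pos.2 hpos
  have hsq := Real.mul_self_sqrt hpos.le
  set x := Real.sqrt (4 * (a * b) / E) with hxdef
  refine ⟨x, 2 * a / x, 2 * b / x, hx, by positivity, by positivity, ?_, ?_, ?_⟩
  · rw [div_mul_div_comm, hsq]
    field_simp
    ring
  · field_simp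
  · field_simp

end LowRank

end Soliton

end

/-! ### Coefficient equations for the Calabi arrangement -/

noncomputable section

namespace Soliton

section CalabiCoefficients

variable {m : ℕ}

/-- The exponents of the Bérard Bergery–Calabi superpotential. -/
def calabiVec (m : ℕ) : Fin 2 ⊕ Fin m → Fin (m + 1) → ℝ :=
  Sum.elim ![Pi.single 0 (-1), Pi.single 0 1] fun i => Pi.single 0 1 + Pi.single i.succ (-2)

theorem range_calabiVec : Set.range (calabiVec m) = {Pi.single 0 (-1), Pi.single 0 1} ∪
    Set.range (fun i : Fin m => (Pi.single 0 1 + Pi.single i.succ (-2) : Fin (m + 1) → ℝ)) := by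
  rw [calabiVec, Set.Sum.elim_range]
  simp [Set.pair_comm]

theorem calabiVec_injective : Function.Injective (calabiVec m) := by
  have hz : ∀ i : Fin m, calabiVec m (Sum.inr i) 0 = 1 := fun i => by simp [calabiVec]
  have hi : ∀ i : Fin m, calabiVec m (Sum.inr i) i.succ = -2 := fun i => by simp [calabiVec]
  have hl : ∀ (a : Fin 2) (i : Fin m), calabiVec m (Sum.inl a) i.succ = 0 := fun a i => by
    fin_cases a <;> simp [calabiVec]
  rintro (a | i) (b | j) h
  · have h0 := congrFun h 0
    fin_cases a <;> fin_cases b <;> simp [calabiVec] at h0 ⊢ <;> norm_num at h0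
  · have := congrFun h j.succ
    rw [hl, hi] at this
    norm_num at this
  · have := congrFun h i.succ
    rw [hl, hi] at this
    norm_num at this
  · by_cases hij : i = j
    · rw [hij]
    · have := congrFun h i.succ
      rw [hi] at this
      simp [calabiVec, hij] at this

/-- The vectors ±e_0 have norm one, and e_0 has product one with each e_0 - 2e_i. So only the pairs
with -e_0 and the squares of the e_0 - 2e_i, of norm 1 + 4/d_i, contribute. -/
theorem coeffEq_calabi {d : Fin (m + 1) → ℕ} (hd : ∀ i, 1 ≤ d i) (hd0 : d 0 = 1)
    {A : (Fin (m + 1) → ℝ) →₀ ℝ}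
    (hA : (A.support : Set (Fin (m + 1) → ℝ)) =
      Set.range (fun i : Fin m => Pi.single i.succ (-1)) ∪
        Set.range (fun i : Fin m => Pi.single 0 1 + Pi.single i.succ (-2)))
    {E : ℝ} (γ : Fin 2 ⊕ Fin m → ℝ) :
    CoeffEq d A E (calabiVec m) γ ↔ γ (Sum.inl 0) * γ (Sum.inl 1) = E ∧
      (∀ i, γ (Sum.inl 0) * γ (Sum.inr i) = A (Pi.single i.succ (-1))) ∧
      ∀ i, γ (Sum.inr i) ^ 2 = -(d i.succ * A (Pi.single 0 1 + Pi.single i.succ (-2))) := by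
  classical
  have hinj₁ : Function.Injective fun i : Fin m => (Pi.single i.succ (-1) : Fin (m + 1) → ℝ) := by
    intro i j h
    by_contra hij
    have := congrFun h i.succ
    simp [hij] at this
  have hinj₂ : Function.Injective
      fun i : Fin m => (Pi.single 0 1 + Pi.single i.succ (-2) : Fin (m + 1) → ℝ) := by
    intro i j h
    by_contra hij
    have := congrFun h i.succ
    simp [hij] at this
  have hsupp : A.support = Finset.univ.image (fun i : Fin m => Pi.single i.succ (-1)) ∪
      Finset.univ.image (fun i : Fin m => Pi.single 0 1 + Pi.single i.succ (-2)) := by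
    rw [← Finset.coe_inj, hA]
    simp
  have hdisj : Disjoint
      (Finset.univ.image (fun i : Fin m => (Pi.single i.succ (-1) : Fin (m + 1) → ℝ)))
      (Finset.univ.image (fun i : Fin m => Pi.single 0 1 + Pi.single i.succ (-2))) := by
    rw [Finset.disjoint_left]
    intro w h1 h2
    simp only [Finset.mem_image, Finset.mem_univ, true_and] at h1 h2
    obtain ⟨i, rfl⟩ := h1
    obtain ⟨j, hj⟩ := h2
    have := congrFun hj 0
    simp at this
  have hrhs : ∑ w ∈ A.support, Finsupp.single (w + w) (4 * A w) =
      ∑ i : Fin m, Finsupp.single (Pi.single i.succ (-2)) (4 * A (Pi.single i.succ (-1))) +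
      ∑ i : Fin m, Finsupp.single (Pi.single 0 2 + Pi.single i.succ (-4))
        (4 * A (Pi.single 0 1 + Pi.single i.succ (-2))) := by
    rw [hsupp, Finset.sum_union hdisj, Finset.sum_image hinj₁.injOn, Finset.sum_image hinj₂.injOn]
    congr 1
    · refine Finset.sum_congr rfl fun i _ => ?_
      rw [← Pi.single_add]
      norm_num [-Finsupp.single_mul]
    · refine Finset.sum_congr rfl fun i _ => ?_
      rw [add_add_add_comm, ← Pi.single_add, ← Pi.single_add]
      norm_num [-Finsupp.single_mul]
  have hlhs : ∑ a, ∑ b, Finsupp.single (calabiVec m a + calabiVec m b)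
        (γ a * γ b * (1 - dimForm d (calabiVec m a) (calabiVec m b))) =
      Finsupp.single 0 (4 * (γ (Sum.inl 0) * γ (Sum.inl 1))) +
      (∑ i : Fin m, Finsupp.single (Pi.single i.succ (-2))
        (4 * (γ (Sum.inl 0) * γ (Sum.inr i))) +
      ∑ i : Fin m, Finsupp.single (Pi.single 0 2 + Pi.single i.succ (-4))
        (-4 * (γ (Sum.inr i) ^ 2 / d i.succ))) := by
    have hadd₁ : (Pi.single 0 (-1) + Pi.single 0 1 : Fin (m + 1) → ℝ) = 0 := by
      rw [← Pi.single_add]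
      simp
    have hadd₂ : ∀ i : Fin m, (Pi.single 0 (-1) + (Pi.single 0 1 + Pi.single i.succ (-2)) :
        Fin (m + 1) → ℝ) = Pi.single i.succ (-2) := fun i => by
      rw [← add_assoc, hadd₁, zero_add]
    have hadd₃ : ∀ i : Fin m, (Pi.single 0 1 + Pi.single i.succ (-2) +
        (Pi.single 0 1 + Pi.single i.succ (-2)) : Fin (m + 1) → ℝ) =
        Pi.single 0 2 + Pi.single i.succ (-4) := fun i => by
      rw [add_add_add_comm, ← Pi.single_add, ← Pi.single_add]
      norm_num
    have hQ : ∀ i j : Fin m, dimForm d (Pi.single 0 1 + Pi.single i.succ (-2))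
        (Pi.single 0 1 + Pi.single j.succ (-2)) = 1 + if i = j then 4 / (d i.succ : ℝ) else 0 := by
      intro i j
      rw [map_add, dimForm_single, dimForm_single, hd0]
      by_cases hij : i = j
      · subst hij
        simp
        norm_num
      · simp [hij, Ne.symm hij]
    have hQ₀ : ∀ (i : Fin m) (x : ℝ), dimForm d (Pi.single 0 1 + Pi.single i.succ (-2))
        (Pi.single 0 x) = x := by
      intro i x
      rw [dimForm_single, hd0]
      simp
    have hQ₁ : ∀ x y : ℝ, dimForm d (Pi.single 0 x) (Pi.single 0 y) = x * y := by
      intro x y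
      rw [dimForm_single, hd0]
      simp
    -- Distinct vectors e_0 - 2e_i and e_0 - 2e_j have product one, so just the diagonal survives.
    have hinner : ∀ i : Fin m, ∑ j : Fin m, Finsupp.single
        (Pi.single 0 1 + Pi.single i.succ (-2) + (Pi.single 0 1 + Pi.single j.succ (-2)) :
          Fin (m + 1) → ℝ)
        (γ (Sum.inr i) * γ (Sum.inr j) * (1 - (1 + if i = j then 4 / (d i.succ : ℝ) else 0))) =
        Finsupp.single (Pi.single 0 2 + Pi.single i.succ (-4))
          (-4 * (γ (Sum.inr i) ^ 2 / d i.succ)) := by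
      intro i
      rw [Finset.sum_eq_single i]
      · rw [hadd₃, if_pos rfl]
        congr 1
        ring
      · intro j _ hj
        rw [if_neg (Ne.symm hj)]
        simp
      · simp
    simp only [Fintype.sum_sum_type, Fin.sum_univ_two, calabiVec, Sum.elim_inl, Sum.elim_inr,
      Matrix.cons_val_zero, Matrix.cons_val_one, hQ, hQ₀, hQ₁, hinner,
      dimForm_comm d (Pi.single 0 _) (Pi.single 0 1 + Pi.single _ _), hadd₁, hadd₂,
      add_comm (Pi.single 0 1 : Fin (m + 1) → ℝ) (Pi.single 0 (-1)),
      add_comm (Pi.single 0 1 + Pi.single (Fin.succ _) _ : Fin (m + 1) → ℝ) (Pi.single 0 (-1)),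
      Finset.sum_add_distrib]
    norm_num [-Finsupp.single_mul, -Finsupp.single_neg]
    have hsum : ∀ i : Fin m, Finsupp.single (Pi.single i.succ (-2) : Fin (m + 1) → ℝ)
        (4 * (γ (Sum.inl 0) * γ (Sum.inr i))) =
        Finsupp.single (Pi.single i.succ (-2)) (γ (Sum.inr i) * γ (Sum.inl 0) * 2) +
        Finsupp.single (Pi.single i.succ (-2)) (γ (Sum.inl 0) * γ (Sum.inr i) * 2) := fun i => by
      rw [← Finsupp.single_add]
      congr 1
      ring
    rw [show 4 * (γ (Sum.inl 0) * γ (Sum.inl 1)) =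
      γ (Sum.inl 1) * γ (Sum.inl 0) * 2 + γ (Sum.inl 0) * γ (Sum.inl 1) * 2 by ring,
      Finsupp.single_add]
    simp only [hsum, Finset.sum_add_distrib]
    abel
  rw [CoeffEq, hlhs, hrhs]
  constructor
  · intro h
    have hev : ∀ (j : Fin m) (x : Fin m → ℝ), (∑ i : Fin m, Finsupp.single
        (Pi.single i.succ (-2) : Fin (m + 1) → ℝ) (x i)) (Pi.single j.succ (-2)) = x j := by
      intro j x
      rw [Finsupp.finsetSum_apply, Finset.sum_eq_single j]
      · simp
      · intro i _ hij
        refine Finsupp.single_eq_of_ne fun h' => ?_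
        have := congrFun h' i.succ
        simp [hij] at this
      · simp
    have hev' : ∀ (j : Fin m) (x : Fin m → ℝ), (∑ i : Fin m, Finsupp.single
        (Pi.single 0 2 + Pi.single i.succ (-4) : Fin (m + 1) → ℝ) (x i))
        (Pi.single 0 2 + Pi.single j.succ (-4)) = x j := by
      intro j x
      rw [Finsupp.finsetSum_apply, Finset.sum_eq_single j]
      · simp
      · intro i _ hij
        refine Finsupp.single_eq_of_ne fun h' => ?_
        have := congrFun h' i.succ
        simp [hij] at this
      · simp
    have hz : ∀ (v : Fin (m + 1) → ℝ) (x : Fin m → ℝ), v 0 ≠ 0 ∨ v = 0 → (∑ i : Fin m, Finsupp.single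
        (Pi.single i.succ (-2) : Fin (m + 1) → ℝ) (x i)) v = 0 := by
      intro v x hv
      rw [Finsupp.finsetSum_apply]
      refine Finset.sum_eq_zero fun i _ => Finsupp.single_eq_of_ne ?_
      rintro rfl
      rcases hv with hv | hv
      · simp at hv
      · have := congrFun hv i.succ
        simp at this
    have hz' : ∀ (v : Fin (m + 1) → ℝ) (x : Fin m → ℝ), v 0 = 0 → (∑ i : Fin m, Finsupp.single
        (Pi.single 0 2 + Pi.single i.succ (-4) : Fin (m + 1) → ℝ) (x i)) v = 0 := by
      intro v x hv
      rw [Finsupp.finsetSum_apply]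
      refine Finset.sum_eq_zero fun i _ => Finsupp.single_eq_of_ne ?_
      rintro rfl
      simp at hv
    have hne : ∀ (v : Fin (m + 1) → ℝ) (i : Fin (m + 1)) (x : ℝ), v i ≠ 0 →
        (Finsupp.single (0 : Fin (m + 1) → ℝ) x) v = 0 := by
      intro v i x hv
      refine Finsupp.single_eq_of_ne ?_
      rintro rfl
      exact hv rfl
    refine ⟨?_, fun i => ?_, fun i => ?_⟩
    · have := DFunLike.congr_fun h 0
      simp only [Finsupp.add_apply, Finsupp.single_eq_same, hz 0 _ (Or.inr rfl), hz' 0 _ rfl] at this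
      linarith
    · have := DFunLike.congr_fun h (Pi.single i.succ (-2))
      simp only [Finsupp.add_apply, hev, hz' (Pi.single i.succ (-2)) _ (by simp),
        hne (Pi.single i.succ (-2)) i.succ _ (by simp)] at this
      linarith
    · have := DFunLike.congr_fun h (Pi.single 0 2 + Pi.single i.succ (-4))
      simp only [Finsupp.add_apply, hev', hz (Pi.single 0 2 + Pi.single i.succ (-4)) _ (by simp),
        hne (Pi.single 0 2 + Pi.single i.succ (-4)) 0 _ (by simp)] at this
      have hdi : (d i.succ : ℝ) ≠ 0 := by exact_mod_cast Nat.one_le_iff_ne_zero.1 (hd i.succ)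
      field_simp at this
      linarith
  · rintro ⟨h1, h2, h3⟩
    rw [h1]
    congr 2
    · simp only [h2]
    · refine Finset.sum_congr rfl fun i _ => ?_
      have hdi : (d i.succ : ℝ) ≠ 0 := by exact_mod_cast Nat.one_le_iff_ne_zero.1 (hd i.succ)
      rw [h3]
      congr 1
      field_simp

end CalabiCoefficients

end Soliton

end

/-! ### Sufficiency: solving the coefficient equations -/

noncomputable section

namespace Soliton

section Classification

/-- The properties of the dimensions and of the scalar curvature coefficients used in the
classification. -/
structure IsCurvatureData {r : ℕ} (d : Fin r → ℕ) (A : (Fin r → ℝ) →₀ ℝ) : Prop where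
  one_le_dim : ∀ i, 1 ≤ d i
  dim_one_unique : ∀ i j, d i = 1 → d j = 1 → i = j
  weight : ∀ w ∈ A.support, (∃ i, w = Pi.single i (-1)) ∨
    ∃ i l k, k ≠ i ∧ k ≠ l ∧ w = Pi.single k 1 - Pi.single i 1 - Pi.single l 1
  pos : ∀ j, 2 ≤ d j → 0 < A (Pi.single j (-1))
  nonpos : ∀ w k, 0 < w k → A w ≤ 0
  even : ∀ z j, d z = 1 → z ≠ j → A (Pi.single z 1 + Pi.single j (-2)) ≠ 0 → Even (d j)

variable {r : ℕ} {d : Fin r → ℕ} {A : (Fin r → ℝ) →₀ ℝ} {S : (Fin r → ℝ) → ℝ} {E : ℝ}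
  {C : Finset (Ext r)}

theorem coe_support_permCoeff {s : ℕ} (e : Fin r ≃ Fin s) (A : (Fin r → ℝ) →₀ ℝ) :
    ((permCoeff e A).support : Set (Fin s → ℝ)) = permVec e '' A.support := by
  rw [support_permCoeff, Finset.coe_map]
  rfl

theorem permExp_eq_halfShift {s : ℕ} (e : Fin r ≃ Fin s) {B : Set (Fin r → ℝ)}
    (h : (C : Set (Ext r)) = halfShift d B) :
    (permExp e C : Set (Ext s)) = halfShift (permDim e d) (permVec e '' B) := by
  rw [coe_permExp, h, image_halfShift]

theorem support_of_isCalabi {A : (Fin 3 → ℝ) →₀ ℝ} {d : Fin 3 → ℕ} (hA : IsCalabi (m := 2) d A) :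
    (A.support : Set (Fin 3 → ℝ)) = {![0, -1, 0], ![0, 0, -1], ![1, -2, 0], ![1, 0, -2]} := by
  have h1 : (Pi.single 1 (-1) : Fin 3 → ℝ) = ![0, -1, 0] := by ext i; fin_cases i <;> simp
  have h2 : (Pi.single 2 (-1) : Fin 3 → ℝ) = ![0, 0, -1] := by ext i; fin_cases i <;> simp
  have h3 : (Pi.single 0 1 + Pi.single 1 (-2) : Fin 3 → ℝ) = ![1, -2, 0] := by
    ext i; fin_cases i <;> simp
  have h4 : (Pi.single 0 1 + Pi.single 2 (-2) : Fin 3 → ℝ) = ![1, 0, -2] := by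
    ext i; fin_cases i <;> simp
  rw [hA.2.2.2, ← h1, ← h2, ← h3, ← h4]
  ext w
  simp [Fin.exists_fin_two, eq_comm]
  tauto

namespace IsCurvatureData

variable (h : IsCurvatureData d A)

include h

theorem pos_perm {s : ℕ} (e : Fin r ≃ Fin s) {i : Fin s} (hi : 2 ≤ permDim e d i) :
    0 < permCoeff e A (Pi.single i (-1)) := by
  have := h.pos _ hi
  rwa [← permCoeff_apply e, permVec_single, Equiv.apply_symm_apply] at this

theorem neg_perm {s : ℕ} (e : Fin r ≃ Fin s) {w : Fin s → ℝ} (hw : w ∈ (permCoeff e A).support)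
    {k : Fin s} (hk : 0 < w k) : permCoeff e A w < 0 := by
  refine lt_of_le_of_ne ?_ (Finsupp.mem_support_iff.1 hw)
  obtain ⟨v, rfl⟩ := (permVec e).surjective w
  rw [permCoeff_apply]
  exact h.nonpos v (e.symm k) hk

theorem one_le_permDim {s : ℕ} (e : Fin r ≃ Fin s) (i : Fin s) : 1 ≤ permDim e d i :=
  h.one_le_dim _

theorem admits_of_bryant2 (hS : ∀ q, S q = weightSum A q) (hE : E ≠ 0) (e : Fin r ≃ Fin 1)
    (hB : Bryant2 E (permDim e d) (permCoeff e A) (permExp e C)) : AdmitsSuperpotential d S E C := by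
  obtain ⟨hd, hA, hC | ⟨hpos, hC⟩⟩ := hB
  · rw [admitsSuperpotential_iff_perm e h.one_le_dim A hS E (β := ![![1], ![-1]])
      (by
        intro i j hij
        have := congrFun hij 0
        fin_cases i <;> fin_cases j <;> simp at this ⊢ <;> norm_num at this)
      (by rw [hC]; congr 1; simp [Set.pair_comm])]
    -- Only the product of the two coefficients is constrained, so E may have either sign.
    refine ⟨![E, 1], fun i => by fin_cases i <;> simp [hE], ?_⟩
    rw [hd]
    simpa using coeffEq_bryant2 hA ![E, 1]
  · rw [admitsSuperpotential_iff_perm e h.one_le_dim A hS E (β := ![![0]])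
      (Function.injective_of_subsingleton _) (by rw [hC]; congr 1; simp)]
    refine ⟨![2 * Real.sqrt E], fun i => ?_, ?_⟩
    · have := Real.sqrt_pos.2 hpos
      fin_cases i
      simp [this.ne']
    · rw [hd, coeffEq_trivial hA]
      simp only [Matrix.cons_val_zero, mul_pow, Real.sq_sqrt hpos.le]
      norm_num

theorem admits_of_bryant5 (hS : ∀ q, S q = weightSum A q) (e : Fin r ≃ Fin 1)
    (hB : Bryant5 E (permDim e d) (permCoeff e A) (permExp e C)) : AdmitsSuperpotential d S E C := by
  obtain ⟨hd, hA, hpos, hC⟩ := hB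
  rw [admitsSuperpotential_iff_perm e h.one_le_dim A hS E (β := ![![0], ![-2]])
    (by
      intro i j hij
      have := congrFun hij 0
      fin_cases i <;> fin_cases j <;> simp at this ⊢)
    (by rw [hC]; congr 1; simp [Set.pair_comm])]
  have hne : permCoeff e A ![-1] ≠ 0 := by
    rw [← Finsupp.mem_support_iff, ← Finset.mem_coe, hA]
    rfl
  have hE := Real.sqrt_pos.2 hpos
  refine ⟨![2 * Real.sqrt E, permCoeff e A ![-1] / Real.sqrt E], fun i => ?_, ?_⟩
  · fin_cases i <;> simp [hE.ne', hne]
  · rw [hd, coeffEq_bryant5 hA]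
    simp only [Matrix.cons_val_zero, Matrix.cons_val_one, mul_pow, Real.sq_sqrt hpos.le]
    refine ⟨by norm_num, ?_⟩
    field_simp

theorem admits_of_warped (hS : ∀ q, S q = weightSum A q) (e : Fin r ≃ Fin 2)
    (hB : WarpedSurfaces E (permDim e d) (permCoeff e A) (permExp e C)) :
    AdmitsSuperpotential d S E C := by
  obtain ⟨hd, hA, hpos, hC⟩ := hB
  rw [admitsSuperpotential_iff_perm e h.one_le_dim A hS E (β := ![![-1, -1], ![-1, 1], ![1, -1]])
    (by
      intro i j hij
      have h0 := congrFun hij 0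
      have h1 := congrFun hij 1
      fin_cases i <;> fin_cases j <;> simp at h0 h1 ⊢ <;> linarith)
    (by rw [hC]; congr 1; ext; simp; tauto)]
  have h1 := h.pos_perm e (i := 0) (by rw [hd]; simp)
  have h2 := h.pos_perm e (i := 1) (by rw [hd]; simp)
  rw [show (Pi.single 0 (-1) : Fin 2 → ℝ) = ![-1, 0] by ext i; fin_cases i <;> simp] at h1
  rw [show (Pi.single 1 (-1) : Fin 2 → ℝ) = ![0, -1] by ext i; fin_cases i <;> simp] at h2
  obtain ⟨x, y, z, hx, hy, hz, hyz, hxy, hxz⟩ := exists_mul_eq hpos h1 h2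
  refine ⟨![x, y, z], fun i => ?_, ?_⟩
  · fin_cases i <;> simp [hx.ne', hy.ne', hz.ne']
  · rw [hd, coeffEq_warped hA]
    simpa using ⟨hyz, hxy, hxz⟩

/-- One coefficient x, that of -e_0, has to serve all indices: -x² must equal each of the ratios
that the compatibility condition makes equal. Their common value is negative by the sign of the
curvature coefficients. -/
theorem admits_of_calabi (hS : ∀ q, S q = weightSum A q) (hE : E ≠ 0) {m : ℕ} (e : Fin r ≃ Fin (m + 1))
    (hB : Calabi (permDim e d) (permCoeff e A) (permExp e C)) : AdmitsSuperpotential d S E C := by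
  obtain ⟨⟨hm, hd0, hdi, hA⟩, hcomp, hC⟩ := hB
  rw [admitsSuperpotential_iff_perm e h.one_le_dim A hS E calabiVec_injective
    (by rw [hC, range_calabiVec])]
  have hpos : ∀ i : Fin m, 0 < permCoeff e A (Pi.single i.succ (-1)) := fun i =>
    h.pos_perm e (by
      obtain ⟨k, hk, hk'⟩ := hdi i
      omega)
  have hneg : ∀ i : Fin m, permCoeff e A (Pi.single 0 1 + Pi.single i.succ (-2)) < 0 := fun i =>
    h.neg_perm e (k := 0)
      (by
        rw [← Finset.mem_coe, hA]
        exact Or.inr ⟨i, rfl⟩)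
      (by simp)
  have hdpos : ∀ i, (0 : ℝ) < permDim e d i := fun i => by exact_mod_cast h.one_le_permDim e i
  have hprod : ∀ i : Fin m, permDim e d i.succ *
      permCoeff e A (Pi.single 0 1 + Pi.single i.succ (-2)) < 0 := fun i =>
    mul_neg_of_pos_of_neg (hdpos _) (hneg i)
  have hconst : 0 < -(permCoeff e A (Pi.single (Fin.succ ⟨0, hm⟩) (-1)) ^ 2 /
      (permDim e d (Fin.succ ⟨0, hm⟩) *
        permCoeff e A (Pi.single 0 1 + Pi.single (Fin.succ ⟨0, hm⟩) (-2)))) :=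
    neg_pos.2 (div_neg_of_pos_of_neg (by have := hpos ⟨0, hm⟩; positivity) (hprod _))
  have hx := Real.sqrt_pos.2 hconst
  have hsq := Real.sq_sqrt hconst.le
  set x := Real.sqrt (-(permCoeff e A (Pi.single (Fin.succ ⟨0, hm⟩) (-1)) ^ 2 /
      (permDim e d (Fin.succ ⟨0, hm⟩) *
        permCoeff e A (Pi.single 0 1 + Pi.single (Fin.succ ⟨0, hm⟩) (-2)))))
  refine ⟨Sum.elim ![x, E / x] fun i => permCoeff e A (Pi.single i.succ (-1)) / x, ?_, ?_⟩
  · rintro (i | i)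
    · fin_cases i <;> simp [hx.ne', hE]
    · simp [hx.ne', (hpos i).ne']
  · rw [coeffEq_calabi (h.one_le_permDim e) hd0 hA]
    simp only [Sum.elim_inl, Sum.elim_inr, Matrix.cons_val_zero, Matrix.cons_val_one]
    refine ⟨by field_simp, fun i => by field_simp, fun i => ?_⟩
    have h1 := hcomp ⟨0, hm⟩ i
    rw [h1] at hsq
    rw [div_pow, hsq]
    have h2 := (hprod i).ne
    have h3 := (hpos i).ne'
    generalize permDim e d i.succ * permCoeff e A (Pi.single 0 1 + Pi.single i.succ (-2)) = y at *
    field_simp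

theorem admits_of_calabiNew (hS : ∀ q, S q = weightSum A q) (e : Fin r ≃ Fin 3)
    (hB : CalabiNew E (permDim e d) (permCoeff e A) (permExp e C)) :
    AdmitsSuperpotential d S E C := by
  obtain ⟨hcal, hd, hcomp, hpos, hC⟩ := hB
  have hA := support_of_isCalabi hcal
  rw [admitsSuperpotential_iff_perm e h.one_le_dim A hS E
    (β := ![![0, -1, -1], ![0, 1, -1], ![0, -1, 1], ![1, 0, -2], ![1, -2, 0]])
    (by
      intro i j hij
      have h0 := congrFun hij 0
      have h1 := congrFun hij 1
      have h2 := congrFun hij 2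
      fin_cases i <;> fin_cases j <;> simp at h0 h1 h2 ⊢ <;> linarith)
    (by rw [hC]; congr 1; ext; simp; tauto)]
  have h1 := h.pos_perm e (i := 1) (by rw [hd]; simp)
  have h2 := h.pos_perm e (i := 2) (by rw [hd]; simp)
  have h3 : permCoeff e A ![1, -2, 0] < 0 := h.neg_perm e (k := 0)
    (by rw [← Finset.mem_coe, hA]; simp) (by simp)
  have h4 : permCoeff e A ![1, 0, -2] < 0 := h.neg_perm e (k := 0)
    (by rw [← Finset.mem_coe, hA]; simp) (by simp)
  have h5 := hcomp 0 1
  simp only [Fin.succ_zero_eq_one, Fin.succ_one_eq_two, hd] at h5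
  rw [show (Pi.single 0 1 + Pi.single 1 (-2) : Fin 3 → ℝ) = ![1, -2, 0] by
      ext i; fin_cases i <;> simp,
    show (Pi.single 0 1 + Pi.single 2 (-2) : Fin 3 → ℝ) = ![1, 0, -2] by
      ext i; fin_cases i <;> simp] at h5
  rw [show (Pi.single 1 (-1) : Fin 3 → ℝ) = ![0, -1, 0] by ext i; fin_cases i <;> simp] at h1 h5
  rw [show (Pi.single 2 (-1) : Fin 3 → ℝ) = ![0, 0, -1] by ext i; fin_cases i <;> simp] at h2 h5
  simp only [Matrix.cons_val_one, Matrix.cons_val, Nat.cast_ofNat, Matrix.cons_val_zero] at h5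
  -- The first three equations fix x, y, z. The fifth coefficient u is a square root, and the
  -- cancellation yu + zγ₃ = 0 forces γ₃ = -yu/z, whose square is right by the compatibility
  -- condition.
  obtain ⟨x, y, z, hx, hy, hz, hyz, hxy, hxz⟩ := exists_mul_eq hpos h2 h1
  have hu : 0 < -2 * permCoeff e A ![1, -2, 0] := by linarith
  have hu' := Real.sqrt_pos.2 hu
  have husq := Real.sq_sqrt hu.le
  set u := Real.sqrt (-2 * permCoeff e A ![1, -2, 0])
  refine ⟨![x, y, z, -(y * u / z), u], fun i => ?_, ?_⟩
  · fin_cases i <;> simp [hx.ne', hy.ne', hz.ne', hu'.ne']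
  · rw [hd, coeffEq_calabiNew hA]
    simp only [Matrix.cons_val_zero, Matrix.cons_val_one, Matrix.cons_val]
    refine ⟨hyz, hxz, hxy, husq, ?_, by field_simp; ring⟩
    rw [neg_sq, div_pow, mul_pow, husq, div_eq_iff (by positivity)]
    have h6 : x ^ 2 * z ^ 2 * permCoeff e A ![1, 0, -2] =
        x ^ 2 * y ^ 2 * permCoeff e A ![1, -2, 0] := by
      rw [← mul_pow, ← mul_pow, hxy, hxz]
      rw [div_eq_div_iff (by linarith) (by linarith)] at h5
      linarith
    have h7 : x ^ 2 ≠ 0 := by positivity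
    have h8 : z ^ 2 * permCoeff e A ![1, 0, -2] = y ^ 2 * permCoeff e A ![1, -2, 0] :=
      mul_left_cancel₀ h7 (by linarith)
    linarith

end IsCurvatureData

end Classification

end Soliton

end

/-! ### Necessity: from arrangements to the listed configurations -/

noncomputable section

namespace Soliton

namespace IsCurvatureData

variable {r : ℕ} {d : Fin r → ℕ} {A : (Fin r → ℝ) →₀ ℝ} {S : (Fin r → ℝ) → ℝ} {E : ℝ}
  {C : Finset (Ext r)} {B : Finset (Fin r → ℝ)} (h : IsCurvatureData d A)

include h

omit h in
theorem bryant2_of_pair (hCB : (C : Set (Ext r)) = halfShift d B) {z : Fin r} (hz : d z = 1) (hall : ∀ j, j = z)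
    (hB : ∀ b, b ∈ B ↔ b = Pi.single z (-1) ∨ b = Pi.single z 1) (hW : ∀ w, w ∉ A.support) :
    ∃ e : Fin r ≃ Fin 1, Bryant2 E (permDim e d) (permCoeff e A) (permExp e C) := by
  have : Unique (Fin r) := ⟨⟨z⟩, hall⟩
  refine ⟨Equiv.ofUnique _ _, ?_, ?_, Or.inl ?_⟩
  · funext i
    fin_cases i
    simpa [permDim, hall _] using hz
  · rw [coe_support_permCoeff, Finset.eq_empty_of_forall_notMem hW]
    simp
  · rw [permExp_eq_halfShift _ hCB]
    congr 1
    have : (B : Set (Fin r → ℝ)) = {Pi.single z (-1), Pi.single z 1} := Set.ext hB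
    rw [this, Set.image_pair, permVec_single, permVec_single, Set.pair_comm]
    congr <;> · ext i; fin_cases i; simp

/-- The single coefficient satisfies γ² = 4E, so E is positive. -/
theorem bryant2_of_zero (hS : ∀ q, S q = weightSum A q) (hC : AdmitsSuperpotential d S E C)
    (hCB : (C : Set (Ext r)) = halfShift d B) {z : Fin r} (hz : d z = 1) (hall : ∀ j, j = z)
    (hB : ∀ b, b ∈ B ↔ b = 0) (hW : ∀ w, w ∉ A.support) :
    ∃ e : Fin r ≃ Fin 1, Bryant2 E (permDim e d) (permCoeff e A) (permExp e C) := by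
  have : Unique (Fin r) := ⟨⟨z⟩, hall⟩
  set e : Fin r ≃ Fin 1 := Equiv.ofUnique _ _
  have h0 : (0 : Fin 1 → ℝ) = ![0] := by
    ext i
    fin_cases i
    rfl
  have hd : permDim e d = ![1] := by
    funext i
    fin_cases i
    simpa [permDim, hall _] using hz
  have hA : ((permCoeff e A).support : Set (Fin 1 → ℝ)) = ∅ := by
    rw [coe_support_permCoeff, Finset.eq_empty_of_forall_notMem hW]
    simp
  have hCe : (permExp e C : Set (Ext 1)) = halfShift (permDim e d) {![0]} := by
    rw [permExp_eq_halfShift _ hCB]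
    congr 1
    have : (B : Set (Fin r → ℝ)) = {0} := Set.ext hB
    rw [this, Set.image_singleton, permVec_zero, h0]
  refine ⟨e, hd, hA, Or.inr ⟨?_, hCe⟩⟩
  rw [admitsSuperpotential_iff_perm e h.one_le_dim A hS E (β := ![![0]])
      (Function.injective_of_subsingleton _) (by rw [hCe]; congr 1; simp)] at hC
  obtain ⟨γ, hγ, heq⟩ := hC
  rw [hd, coeffEq_trivial hA] at heq
  have := hγ 0
  have : 0 < γ 0 ^ 2 := by positivity
  linarith

theorem bryant5_of_pair (hS : ∀ q, S q = weightSum A q) (hC : AdmitsSuperpotential d S E C)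
    (hCB : (C : Set (Ext r)) = halfShift d B) {z : Fin r} (hz : d z = 4) (hall : ∀ j, j = z)
    (hB : ∀ b, b ∈ B ↔ b = 0 ∨ b = Pi.single z (-2))
    (hW : ∀ w, w ∈ A.support ↔ w = Pi.single z (-1)) :
    ∃ e : Fin r ≃ Fin 1, Bryant5 E (permDim e d) (permCoeff e A) (permExp e C) := by
  have : Unique (Fin r) := ⟨⟨z⟩, hall⟩
  set e : Fin r ≃ Fin 1 := Equiv.ofUnique _ _
  have h0 : (0 : Fin 1 → ℝ) = ![0] := by
    ext i
    fin_cases i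
    rfl
  have hd : permDim e d = ![4] := by
    funext i
    fin_cases i
    simpa [permDim, hall _] using hz
  have hsingle : ∀ x : ℝ, (Pi.single (e z) x : Fin 1 → ℝ) = ![x] := fun x => by
    rw [Subsingleton.elim (e z) 0]
    ext i
    fin_cases i
    simp
  have hA : ((permCoeff e A).support : Set (Fin 1 → ℝ)) = {![-1]} := by
    have : (A.support : Set (Fin r → ℝ)) = {Pi.single z (-1)} := Set.ext hW
    rw [coe_support_permCoeff, this, Set.image_singleton, permVec_single, hsingle]
  have hCe : (permExp e C : Set (Ext 1)) = halfShift (permDim e d) {![0], ![-2]} := by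
    rw [permExp_eq_halfShift _ hCB]
    congr 1
    have : (B : Set (Fin r → ℝ)) = {0, Pi.single z (-2)} := Set.ext hB
    rw [this, Set.image_pair, permVec_zero, permVec_single, hsingle, h0]
  refine ⟨e, hd, hA, ?_, hCe⟩
  rw [admitsSuperpotential_iff_perm e h.one_le_dim A hS E (β := ![![0], ![-2]])
    (by
      intro i j hij
      have := congrFun hij 0
      fin_cases i <;> fin_cases j <;> simp at this ⊢)
    (by rw [hCe]; congr 1; simp [Set.pair_comm])] at hC
  obtain ⟨γ, hγ, heq⟩ := hC
  rw [hd, coeffEq_bryant5 hA] at heq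
  have := hγ 0
  have : 0 < γ 0 ^ 2 := by positivity
  linarith [heq.1]

/-- Positivity of E follows from γ₀²E = 4AA', where A and A' are the positive coefficients of the
two surfaces. -/
theorem warped_of_triple (hS : ∀ q, S q = weightSum A q) (hC : AdmitsSuperpotential d S E C)
    (hCB : (C : Set (Ext r)) = halfShift d B) {j k : Fin r} (hjk : j ≠ k) (hdj : d j = 2)
    (hdk : d k = 2) (hall : ∀ i, i = j ∨ i = k)
    (hB : ∀ b, b ∈ B ↔ b = Pi.single j (-1) + Pi.single k (-1) ∨
      b = Pi.single j (-1) + Pi.single k 1 ∨ b = Pi.single j 1 + Pi.single k (-1))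
    (hW : ∀ w, w ∈ A.support ↔ w = Pi.single j (-1) ∨ w = Pi.single k (-1)) :
    ∃ e : Fin r ≃ Fin 2, WarpedSurfaces E (permDim e d) (permCoeff e A) (permExp e C) := by
  have hbij : Function.Bijective ![j, k] := by
    constructor
    · intro a b hab
      fin_cases a <;> fin_cases b <;> simp [hjk, hjk.symm] at hab ⊢
    · intro i
      rcases hall i with rfl | rfl
      exacts [⟨0, rfl⟩, ⟨1, rfl⟩]
  set e : Fin r ≃ Fin 2 := (Equiv.ofBijective _ hbij).symm
  have hej : e j = 0 := (Equiv.symm_apply_eq _).2 rfl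
  have hek : e k = 1 := (Equiv.symm_apply_eq _).2 rfl
  have hd : permDim e d = ![2, 2] := by
    funext i
    fin_cases i
    exacts [hdj, hdk]
  have hs0 : ∀ x : ℝ, (Pi.single 0 x : Fin 2 → ℝ) = ![x, 0] := fun x => by
    ext i; fin_cases i <;> simp
  have hs1 : ∀ x : ℝ, (Pi.single 1 x : Fin 2 → ℝ) = ![0, x] := fun x => by
    ext i; fin_cases i <;> simp
  have hA : ((permCoeff e A).support : Set (Fin 2 → ℝ)) = {![-1, 0], ![0, -1]} := by
    have : (A.support : Set (Fin r → ℝ)) = {Pi.single j (-1), Pi.single k (-1)} := Set.ext hW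
    rw [coe_support_permCoeff, this, Set.image_pair, permVec_single, permVec_single, hej, hek, hs0,
      hs1]
  have hCe : (permExp e C : Set (Ext 2)) =
      halfShift (permDim e d) {![-1, -1], ![-1, 1], ![1, -1]} := by
    rw [permExp_eq_halfShift _ hCB]
    congr 1
    have : (B : Set (Fin r → ℝ)) = {Pi.single j (-1) + Pi.single k (-1),
      Pi.single j (-1) + Pi.single k 1, Pi.single j 1 + Pi.single k (-1)} := Set.ext hB
    rw [this, Set.image_insert_eq, Set.image_pair]
    simp [permVec_add, permVec_single, hej, hek, hs0, hs1]
  refine ⟨e, hd, hA, ?_, hCe⟩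
  rw [admitsSuperpotential_iff_perm e h.one_le_dim A hS E (β := ![![-1, -1], ![-1, 1], ![1, -1]])
    (by
      intro i j hij
      have h0 := congrFun hij 0
      have h1 := congrFun hij 1
      fin_cases i <;> fin_cases j <;> simp at h0 h1 ⊢ <;> linarith)
    (by rw [hCe]; congr 1; ext; simp; tauto)] at hC
  obtain ⟨γ, hγ, heq⟩ := hC
  rw [hd, coeffEq_warped hA] at heq
  have h1 := h.pos_perm e (i := 0) (by rw [hd]; simp)
  have h2 := h.pos_perm e (i := 1) (by rw [hd]; simp)
  rw [hs0] at h1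
  rw [hs1] at h2
  exact pos_of_mul_eq (hγ 0) heq.1 heq.2.1 heq.2.2 h1 h2

theorem isCalabi_perm {m : ℕ} (e : Fin r ≃ Fin (m + 1)) (hm : 1 ≤ m) {z : Fin r} (hz : d z = 1)
    (hez : e z = 0)
    (hW : ∀ w, w ∈ A.support ↔
      ∃ j, j ≠ z ∧ (w = Pi.single j (-1) ∨ w = Pi.single z 1 + Pi.single j (-2))) :
    IsCalabi (permDim e d) (permCoeff e A) := by
  have hez' : e.symm 0 = z := by rw [← hez, Equiv.symm_apply_apply]
  have hsucc : ∀ i : Fin m, e.symm i.succ ≠ z := fun i hi => by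
    have := congrArg e hi
    rw [Equiv.apply_symm_apply, hez] at this
    exact Fin.succ_ne_zero i this
  have hindex : ∀ j, j ≠ z → ∃ i : Fin m, e j = i.succ := fun j hj => by
    obtain ⟨i, hi⟩ := Fin.exists_succ_eq.2 (fun h0 => hj (e.injective (h0.trans hez.symm)))
    exact ⟨i, hi.symm⟩
  refine ⟨hm, by rw [permDim, hez', hz], fun i => ?_, ?_⟩
  · have h1 := h.one_le_dim (e.symm i.succ)
    obtain ⟨k, hk⟩ := h.even z (e.symm i.succ) hz (hsucc i).symm
      (Finsupp.mem_support_iff.1 ((hW _).2 ⟨_, hsucc i, Or.inr rfl⟩))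
    refine ⟨k, by omega, ?_⟩
    rw [permDim, hk, two_mul]
  · rw [coe_support_permCoeff]
    ext w
    constructor
    · rintro ⟨v, hv, rfl⟩
      obtain ⟨j, hj, rfl | rfl⟩ := (hW v).1 hv
      · obtain ⟨i, hi⟩ := hindex j hj
        exact Or.inl ⟨i, by rw [permVec_single, hi]⟩
      · obtain ⟨i, hi⟩ := hindex j hj
        exact Or.inr ⟨i, by rw [permVec_add, permVec_single, permVec_single, hi, hez]⟩
    · rintro (⟨i, rfl⟩ | ⟨i, rfl⟩)
      · exact ⟨_, (hW _).2 ⟨_, hsucc i, Or.inl rfl⟩, by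
          rw [permVec_single, Equiv.apply_symm_apply]⟩
      · exact ⟨_, (hW _).2 ⟨_, hsucc i, Or.inr rfl⟩, by
          rw [permVec_add, permVec_single, permVec_single, Equiv.apply_symm_apply, hez]⟩

/-- Compatibility holds because each of the ratios equals minus the square of the coefficient
belonging to -e_0. -/
theorem calabi_of_arrangement (hS : ∀ q, S q = weightSum A q) (hC : AdmitsSuperpotential d S E C)
    (hCB : (C : Set (Ext r)) = halfShift d B) (hr : 2 ≤ r) {z : Fin r} (hz : d z = 1)
    (hB : ∀ b, b ∈ B ↔ b = Pi.single z (-1) ∨ b = Pi.single z 1 ∨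
        ∃ j, j ≠ z ∧ b = Pi.single z 1 + Pi.single j (-2))
    (hW : ∀ w, w ∈ A.support ↔
      ∃ j, j ≠ z ∧ (w = Pi.single j (-1) ∨ w = Pi.single z 1 + Pi.single j (-2))) :
    ∃ m : ℕ, ∃ e : Fin r ≃ Fin (m + 1),
        Calabi (permDim e d) (permCoeff e A) (permExp e C) := by
  obtain ⟨m, rfl⟩ : ∃ m, r = m + 1 := ⟨r - 1, by omega⟩
  set e : Fin (m + 1) ≃ Fin (m + 1) := Equiv.swap z 0
  have hez : e z = 0 := Equiv.swap_apply_left _ _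
  have hcal := h.isCalabi_perm e (by omega) hz hez hW
  have hindex : ∀ j, j ≠ z → ∃ i : Fin m, e j = i.succ := fun j hj => by
    obtain ⟨i, hi⟩ := Fin.exists_succ_eq.2 (fun h0 => hj (e.injective (h0.trans hez.symm)))
    exact ⟨i, hi.symm⟩
  have hsucc : ∀ i : Fin m, e.symm i.succ ≠ z := fun i hi => by
    have := congrArg e hi
    rw [Equiv.apply_symm_apply, hez] at this
    exact Fin.succ_ne_zero i this
  have hCe : (permExp e C : Set (Ext (m + 1))) = halfShift (permDim e d)
      ({Pi.single 0 (-1), Pi.single 0 1} ∪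
        Set.range (fun i : Fin m => Pi.single 0 1 + Pi.single i.succ (-2))) := by
    rw [permExp_eq_halfShift _ hCB]
    congr 1
    ext b
    constructor
    · rintro ⟨v, hv, rfl⟩
      rcases (hB v).1 hv with rfl | rfl | ⟨j, hj, rfl⟩
      · exact Or.inl (Or.inl (by rw [permVec_single, hez]))
      · exact Or.inl (Or.inr (by rw [permVec_single, hez]; rfl))
      · obtain ⟨i, hi⟩ := hindex j hj
        exact Or.inr ⟨i, by rw [permVec_add, permVec_single, permVec_single, hi, hez]⟩
    · rintro ((rfl | rfl) | ⟨i, rfl⟩)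
      · exact ⟨_, (hB _).2 (Or.inl rfl), by rw [permVec_single, hez]⟩
      · exact ⟨_, (hB _).2 (Or.inr (Or.inl rfl)), by rw [permVec_single, hez]⟩
      · exact ⟨_, (hB _).2 (Or.inr (Or.inr ⟨_, hsucc i, rfl⟩)), by
          rw [permVec_add, permVec_single, permVec_single, Equiv.apply_symm_apply, hez]⟩
  refine ⟨m, e, hcal, ?_, hCe⟩
  rw [admitsSuperpotential_iff_perm e h.one_le_dim A hS E calabiVec_injective
    (by rw [hCe, range_calabiVec])] at hC
  obtain ⟨γ, hγ, heq⟩ := hC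
  rw [coeffEq_calabi (h.one_le_permDim e) hcal.2.1 hcal.2.2.2] at heq
  obtain ⟨-, h1, h2⟩ := heq
  have hconst : ∀ i : Fin m, permCoeff e A (Pi.single i.succ (-1)) ^ 2 / (permDim e d i.succ *
      permCoeff e A (Pi.single 0 1 + Pi.single i.succ (-2))) = -γ (Sum.inl 0) ^ 2 := by
    intro i
    have h3 := hγ (Sum.inr i)
    rw [← h1 i, show (permDim e d i.succ : ℝ) * permCoeff e A
      (Pi.single 0 1 + Pi.single i.succ (-2)) = -γ (Sum.inr i) ^ 2 by rw [h2 i]; ring]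
    field_simp
  intro i j
  rw [hconst, hconst]

/-- Here the compatibility condition is the square of the cancellation γ₁γ₄ = -γ₂γ₃, with the
coefficients expressed through the A_w. -/
theorem calabiNew_of_arrangement (hS : ∀ q, S q = weightSum A q) (hC : AdmitsSuperpotential d S E C)
    (hCB : (C : Set (Ext r)) = halfShift d B) {z j k : Fin r} (hjk : j ≠ k) (hzj : z ≠ j)
    (hzk : z ≠ k) (hdz : d z = 1) (hdj : d j = 2) (hdk : d k = 2)
    (hall : ∀ i, i = z ∨ i = j ∨ i = k)
    (hB : ∀ b, b ∈ B ↔ b = Pi.single j (-1) + Pi.single k (-1) ∨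
        b = Pi.single j (-1) + Pi.single k 1 ∨
        b = Pi.single j 1 + Pi.single k (-1) ∨ b = Pi.single z 1 + Pi.single j (-2) ∨
        b = Pi.single z 1 + Pi.single k (-2))
    (hW : ∀ w, w ∈ A.support ↔ w = Pi.single j (-1) ∨ w = Pi.single k (-1) ∨
        w = Pi.single z 1 + Pi.single j (-2) ∨ w = Pi.single z 1 + Pi.single k (-2)) :
    ∃ e : Fin r ≃ Fin 3, CalabiNew E (permDim e d) (permCoeff e A) (permExp e C) := by
  have hbij : Function.Bijective ![z, j, k] := by
    constructor
    · intro a b hab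
      fin_cases a <;> fin_cases b <;>
        simp [hjk, hjk.symm, hzj, hzk, hzj.symm, hzk.symm] at hab ⊢
    · intro i
      rcases hall i with rfl | rfl | rfl
      exacts [⟨0, rfl⟩, ⟨1, rfl⟩, ⟨2, rfl⟩]
  set e : Fin r ≃ Fin 3 := (Equiv.ofBijective _ hbij).symm
  have hez : e z = 0 := (Equiv.symm_apply_eq _).2 rfl
  have hej : e j = 1 := (Equiv.symm_apply_eq _).2 rfl
  have hek : e k = 2 := (Equiv.symm_apply_eq _).2 rfl
  have hd : permDim e d = ![1, 2, 2] := by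
    funext i
    fin_cases i
    exacts [hdz, hdj, hdk]
  have hs0 : ∀ x : ℝ, (Pi.single 0 x : Fin 3 → ℝ) = ![x, 0, 0] := fun x => by
    ext i; fin_cases i <;> simp
  have hs1 : ∀ x : ℝ, (Pi.single 1 x : Fin 3 → ℝ) = ![0, x, 0] := fun x => by
    ext i; fin_cases i <;> simp
  have hs2 : ∀ x : ℝ, (Pi.single 2 x : Fin 3 → ℝ) = ![0, 0, x] := fun x => by
    ext i; fin_cases i <;> simp
  have hcal : IsCalabi (m := 2) (permDim e d) (permCoeff e A) := by
    refine h.isCalabi_perm e (by norm_num) hdz hez fun w => (hW w).trans ⟨?_, ?_⟩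
    · rintro (h1 | h1 | h1 | h1)
      exacts [⟨j, hzj.symm, Or.inl h1⟩, ⟨k, hzk.symm, Or.inl h1⟩, ⟨j, hzj.symm, Or.inr h1⟩,
        ⟨k, hzk.symm, Or.inr h1⟩]
    · rintro ⟨i, hi, h1⟩
      rcases hall i with rfl | rfl | rfl
      · exact absurd rfl hi
      · tauto
      · tauto
  have hA := support_of_isCalabi hcal
  have hCe : (permExp e C : Set (Ext 3)) = halfShift (permDim e d)
      {![0, -1, -1], ![0, 1, -1], ![0, -1, 1], ![1, 0, -2], ![1, -2, 0]} := by
    rw [permExp_eq_halfShift _ hCB]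
    congr 1
    have : (B : Set (Fin r → ℝ)) = {Pi.single j (-1) + Pi.single k (-1),
      Pi.single j (-1) + Pi.single k 1, Pi.single j 1 + Pi.single k (-1),
      Pi.single z 1 + Pi.single j (-2), Pi.single z 1 + Pi.single k (-2)} := Set.ext hB
    rw [this]
    simp only [Set.image_insert_eq, Set.image_singleton, permVec_add, permVec_single, hez, hej, hek,
      hs0, hs1, hs2]
    ext v
    simp
    tauto
  rw [admitsSuperpotential_iff_perm e h.one_le_dim A hS E
    (β := ![![0, -1, -1], ![0, 1, -1], ![0, -1, 1], ![1, 0, -2], ![1, -2, 0]])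
    (by
      intro i j hij
      have h0 := congrFun hij 0
      have h1 := congrFun hij 1
      have h2 := congrFun hij 2
      fin_cases i <;> fin_cases j <;> simp at h0 h1 h2 ⊢ <;> linarith)
    (by rw [hCe]; congr 1; ext; simp; tauto)] at hC
  obtain ⟨γ, hγ, heq⟩ := hC
  rw [hd, coeffEq_calabiNew hA] at heq
  obtain ⟨hE, h1, h2, h3, h4, h5⟩ := heq
  have hp1 := h.pos_perm e (i := 1) (by rw [hd]; simp)
  have hp2 := h.pos_perm e (i := 2) (by rw [hd]; simp)
  rw [hs1] at hp1
  rw [hs2] at hp2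
  refine ⟨e, hcal, hd, ?_, pos_of_mul_eq (hγ 0) hE h2 h1 hp2 hp1, hCe⟩
  have hg3 := hγ 3
  have hg4 := hγ 4
  have key : permCoeff e A ![0, -1, 0] ^ 2 / (2 * permCoeff e A ![1, -2, 0]) =
      permCoeff e A ![0, 0, -1] ^ 2 / (2 * permCoeff e A ![1, 0, -2]) := by
    rw [show 2 * permCoeff e A ![1, -2, 0] = -γ 4 ^ 2 by linarith,
      show 2 * permCoeff e A ![1, 0, -2] = -γ 3 ^ 2 by linarith,
      show permCoeff e A ![0, -1, 0] = γ 0 * γ 2 / 2 by linarith,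
      show permCoeff e A ![0, 0, -1] = γ 0 * γ 1 / 2 by linarith,
      div_eq_div_iff (by simpa using hg4) (by simpa using hg3)]
    have h6 : (γ 2 * γ 3) ^ 2 = (γ 1 * γ 4) ^ 2 := by
      rw [show γ 2 * γ 3 = -(γ 1 * γ 4) by linarith, neg_sq]
    linear_combination (-(γ 0 ^ 2) / 4) * h6
  have hv3 : (Pi.single 0 1 + Pi.single 1 (-2) : Fin 3 → ℝ) = ![1, -2, 0] := by
    ext i; fin_cases i <;> simp
  have hv4 : (Pi.single 0 1 + Pi.single 2 (-2) : Fin 3 → ℝ) = ![1, 0, -2] := by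
    ext i; fin_cases i <;> simp
  intro a b
  fin_cases a <;> fin_cases b <;> simp [hd, hs1, hs2]
  · simpa [hs0] using key
  · simpa [hs0] using key.symm

/-- The classification of the superpotentials with given curvature data. -/
theorem admitsSuperpotential_iff (hr : 1 ≤ r) (hS : ∀ q, S q = weightSum A q)
    (hW : 2 ≤ r → ∀ i, ∃ w ∈ A.support, w i ≠ 0) (hE : E ≠ 0) (C : Finset (Ext r)) :
    AdmitsSuperpotential d S E C ↔
      (∃ e : Fin r ≃ Fin 1, Bryant2 E (permDim e d) (permCoeff e A) (permExp e C)) ∨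
      (∃ e : Fin r ≃ Fin 1, Bryant5 E (permDim e d) (permCoeff e A) (permExp e C)) ∨
      (∃ e : Fin r ≃ Fin 2, WarpedSurfaces E (permDim e d) (permCoeff e A) (permExp e C)) ∨
      (∃ m : ℕ, ∃ e : Fin r ≃ Fin (m + 1),
        Calabi (permDim e d) (permCoeff e A) (permExp e C)) ∨
      (∃ e : Fin r ≃ Fin 3, CalabiNew E (permDim e d) (permCoeff e A) (permExp e C)) := by
  constructor
  · intro hC
    obtain ⟨B, hCB, hB⟩ := exists_isArrangement h.one_le_dim h.dim_one_unique h.weight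
      (fun j hj => Finsupp.mem_support_iff.2 (h.pos j hj).ne') hW hS hE hC
    -- The trichotomy: positive top total, zero face equal to {0}, zero face equal to {a, -a}.
    by_cases hpos : ∃ b ∈ B, 0 < total b
    · obtain ⟨z, hz, hBz, hWz⟩ := hB.calabi_of_pos hpos
      by_cases hr2 : 2 ≤ r
      · exact Or.inr (Or.inr (Or.inr (Or.inl
          (h.calabi_of_arrangement hS hC hCB hr2 hz hBz hWz))))
      · have hall : ∀ j, j = z := fun j => Fin.ext (by omega)
        refine Or.inl (bryant2_of_pair hCB hz hall (fun b => ?_) fun w hw => ?_)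
        · rw [hBz]
          simp [hall]
        · obtain ⟨j, hj, -⟩ := (hWz w).1 hw
          exact hj (hall j)
    · push Not at hpos
      rcases hB.zero_face hpos with ⟨h0, hzero⟩ | ⟨a, ha, hna, hnorm, hat, hface⟩
      · obtain ⟨i, hall, ⟨hd, hW', hB'⟩ | ⟨hd, hW', hB'⟩⟩ := hB.bryant_of_zero hr h0 hpos hzero
        · exact Or.inl (h.bryant2_of_zero hS hC hCB hd hall hB' hW')
        · exact Or.inr (Or.inl (h.bryant5_of_pair hS hC hCB hd hall hB' hW'))
      · obtain ⟨j, k, hjk, hdj, hdk, hall, hc, ha', hna', hB'⟩ :=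
          hB.exists_pair_of_face ha hna hnorm hat hpos hface
        by_cases hz : ∃ z, z ≠ j ∧ z ≠ k
        · obtain ⟨z, hzj, hzk⟩ := hz
          have hdz : d z = 1 := ((hall z).resolve_left hzj).resolve_left hzk
          obtain ⟨hBn, hWn⟩ :=
            hB.calabiNew_of_pair hjk hzj hzk hdj hdk hdz hall hc ha' hna' hB'
          refine Or.inr (Or.inr (Or.inr (Or.inr (h.calabiNew_of_arrangement hS hC hCB hjk hzj hzk
            hdz hdj hdk (fun i => ?_) hBn hWn))))
          rcases hall i with h1 | h1 | h1
          exacts [Or.inr (Or.inl h1), Or.inr (Or.inr h1), Or.inl (h.dim_one_unique i z h1 hdz)]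
        · push Not at hz
          have hall' : ∀ i, i = j ∨ i = k := fun i => by
            by_cases hij : i = j
            exacts [Or.inl hij, Or.inr (hz i hij)]
          obtain ⟨hBw, hWw⟩ := hB.warped_of_pair hjk hdj hdk hall' hc ha' hna' hB'
          exact Or.inr (Or.inr (Or.inl
            (h.warped_of_triple hS hC hCB hjk hdj hdk hall' hBw hWw)))
  · rintro (⟨e, he⟩ | ⟨e, he⟩ | ⟨e, he⟩ | ⟨m, e, he⟩ | ⟨e, he⟩)
    exacts [h.admits_of_bryant2 hS hE e he, h.admits_of_bryant5 hS e he, h.admits_of_warped hS e he,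
      h.admits_of_calabi hS hE e he, h.admits_of_calabiNew hS e he]

end IsCurvatureData

end Soliton

end

/-! ### The curvature data of an isotropy splitting, and the theorem -/

noncomputable section

namespace Soliton

namespace IsotropySplitting

variable {E : Type*} [NormedAddCommGroup E] [NormedSpace ℝ E] [FiniteDimensional ℝ E]
  {F : Type*} [NormedAddCommGroup F] [NormedSpace ℝ F]
  {G : Type*} [TopologicalSpace G] [ChartedSpace E G] [Group G] [LieGroup 𝓘(ℝ, E) ∞ G]
  {K : Subgroup G} [ChartedSpace F K] [LieGroup 𝓘(ℝ, F) ∞ K] {r : ℕ} (D : IsotropySplitting E F K r)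

omit [LieGroup 𝓘(ℝ, E) ∞ G] [LieGroup 𝓘(ℝ, F) ∞ K] in
theorem one_le_dim (i : Fin r) : 1 ≤ D.dim i := by
  have : FiniteDimensional ℝ (GroupLieAlgebra 𝓘(ℝ, E) G) := inferInstanceAs (FiniteDimensional ℝ E)
  exact Nat.one_le_iff_ne_zero.2 fun h => D.ne_bot i (Submodule.finrank_eq_zero.1 h)

theorem isCurvatureData (hK : ContMDiff 𝓘(ℝ, F) 𝓘(ℝ, E) ∞ (K.subtype : K → G))
    (hconn : IsConnected (K : Set G)) : IsCurvatureData D.dim D.coeff where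
  one_le_dim := D.one_le_dim
  dim_one_unique _ _ hi hj := D.dim_one_unique hK hconn hi hj
  weight _ hw := D.coeff_ne_zero (Finsupp.mem_support_iff.1 hw)
  pos _ hj := D.coeff_pos hK hconn hj
  nonpos _ _ hk := D.coeff_nonpos hk
  even z j hz hzj hA := D.even_dim hK hconn hz hzj (by
    rwa [sub_sub, ← Pi.single_add, sub_eq_add_neg, ← Pi.single_neg, one_add_one_eq_two])

end IsotropySplitting

end Soliton

end

open scoped Manifold ContDiff in
open Soliton in
theorem theorem3p13
    {E : Type*} [NormedAddCommGroup E] [NormedSpace ℝ E] [FiniteDimensional ℝ E]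
    {F : Type*} [NormedAddCommGroup F] [NormedSpace ℝ F] [FiniteDimensional ℝ F]
    {G : Type*} [TopologicalSpace G] [ChartedSpace E G] [Group G] [LieGroup 𝓘(ℝ, E) ∞ G]
    [CompactSpace G] [T2Space G]
    (K : Subgroup G) [ChartedSpace F K] [LieGroup 𝓘(ℝ, F) ∞ K]
    (hK_closed : IsClosed (K : Set G))
    (hK_smooth : ContMDiff 𝓘(ℝ, F) 𝓘(ℝ, E) ∞ (K.subtype : K → G))
    (hK_conn : IsConnected (K : Set G))
    {r : ℕ} (hr : 1 ≤ r) (D : IsotropySplitting E F K r)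
    (A : (Fin r → ℝ) →₀ ℝ) (hA : ∀ q, D.scalarCurvature q = weightSum A q)
    (hW : 2 ≤ r → ∀ i, ∃ w ∈ A.support, w i ≠ 0)
    (E₀ : ℝ) (hE₀ : E₀ ≠ 0) (C : Finset (Ext r)) :
    AdmitsSuperpotential D.dim D.scalarCurvature E₀ C ↔
      (∃ e : Fin r ≃ Fin 1, Bryant2 E₀ (permDim e D.dim) (permCoeff e A) (permExp e C)) ∨
      (∃ e : Fin r ≃ Fin 1, Bryant5 E₀ (permDim e D.dim) (permCoeff e A) (permExp e C)) ∨
      (∃ e : Fin r ≃ Fin 2, WarpedSurfaces E₀ (permDim e D.dim) (permCoeff e A) (permExp e C)) ∨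
      (∃ m : ℕ, ∃ e : Fin r ≃ Fin (m + 1),
        Calabi (permDim e D.dim) (permCoeff e A) (permExp e C)) ∨
      (∃ e : Fin r ≃ Fin 3, CalabiNew E₀ (permDim e D.dim) (permCoeff e A) (permExp e C)) := by
  -- The given coefficients are those computed from structure constants, so their signs and supports
  -- are known.
  obtain rfl := D.eq_coeff hA
  exact (D.isCurvatureData hK_smooth hK_conn).admitsSuperpotential_iff hr hA hW hE₀ C
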